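/- All graphs are finite and simple. For a graph $G$ and a map $w\colon E(G)\to\{1,2,3\}$ (a $3$-weighting), let $\phi_w(v)=\sum_{e\ni v}w(e)$; the weighting is proper if $\phi_w(u)\neq\phi_w(v)$ for every edge $uv$. A graph is $3$-bad if it has no isolated edge (no component that is a single edge) and no proper $3$-weighting; it is minimal $3$-bad if it is $3$-bad and no proper subgraph of it is $3$-bad. A configuration is $3$-reducible if it occurs in no minimal $3$-bad graph. A $k$-vertex, $k^+$-vertex or $k^-$-vertex is a vertex of degree $k$, at least $k$, or at most $k$, respectively; a $k$-neighbor (and likewise a $k^+$-, $k^-$-, $\alpha$-, $\beta$- or $\gamma$-neighbor) of $v$ is a neighbor of $v$ that is a $k$-vertex (respectively a $k^+$-, $k^-$-, $\alpha$-, $\beta$- or $\gamma$-vertex). An $\alpha$-vertex is a $2$-vertex with a $2$-neighbor. A $\beta$-vertex is a $3$-vertex with a $2$-neighbor. A $\gamma$-vertex is a $4$-vertex with a $1$-neighbor, or a $3$-vertex with an $\alpha$-neighbor or at least two $2$-neighbors. "A" or a number of neighbors of some kind means at least that many. Lemma 4.5. Each of the following configurations is $3$-reducible. A. A $2$-vertex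 or $3$-vertex having a $1$-neighbor. B. A $4^-$-vertex whose neighbors all have degree $2$. C. A $3$-vertex having an $\alpha$-neighbor and another $2$-neighbor. D. A $4$-vertex having a $1$-neighbor and another neighbor that is a $2^-$-vertex. E. A $5^+$-vertex $v$ with $3p_1+2p_2\ge d(v)$, where $p_i$ is the number of $i$-neighbors of $v$. F. Two adjacent $\gamma$-vertices. G. A $3$-vertex with two $\gamma$-neighbors. H. A vertex $v$ with $p_1+2q\ge d(v)$ and $p_1+q>4$, where $p_1$ is the number of $1$-neighbors and $q$ the number of $\gamma$-neighbors of $v$. I. A $5$-vertex having a $1$-neighbor and three $\gamma$-neighbors. J. A $4$-vertex with (1) two $\alpha$-neighbors, (2) an $\alpha$-neighbor, another $2$-neighbor, and a $\gamma$-neighbor, or (3) a $2$-neighbor and three $\gamma$-neighbors. K. A $\gamma$-vertex whose $3^+$-neighbors are all $\beta$-vertices. -/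

import Mathlib

namespace ThreeWeighting

universe u

variable {V : Type u} [Fintype V]

/-! ### Weightings of finite simple graphs -/

/-- The degree of `v` in `G`. -/
noncomputable def deg (G : SimpleGraph V) (v : V) : ℕ :=
  open Classical in G.degree v

/-- `φ_w(v)`: the sum of `w(e)` over the edges `e` of `G` incident to `v`. -/
noncomputable def vertexSum (G : SimpleGraph V) (w : Sym2 V → ℕ) (v : V) : ℕ :=
  open Classical in ∑ e ∈ G.incidenceFinset v, w e

/-- `w` restricts to a proper `k`-weighting of `G`: every edge gets a weight in `{1, …, k}`, and
adjacent vertices have different sums. (Values of `w` outside the edge set play no role.) -/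
def IsProperWeighting (G : SimpleGraph V) (k : ℕ) (w : Sym2 V → ℕ) : Prop :=
  (∀ e ∈ G.edgeSet, 1 ≤ w e ∧ w e ≤ k) ∧
    ∀ x y : V, G.Adj x y → vertexSum G w x ≠ vertexSum G w y

def HasProperWeighting (G : SimpleGraph V) (k : ℕ) : Prop :=
  ∃ w : Sym2 V → ℕ, IsProperWeighting G k w

/-- `G` has a component that is a single edge. -/
def HasIsolatedEdge (G : SimpleGraph V) : Prop :=
  ∃ x y : V, G.Adj x y ∧ deg G x = 1 ∧ deg G y = 1

/-- A `3`-bad graph: no isolated edge and no proper `3`-weighting. -/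
def IsThreeBad (G : SimpleGraph V) : Prop :=
  ¬ HasIsolatedEdge G ∧ ¬ HasProperWeighting G 3

/-- A minimal `3`-bad graph: it is `3`-bad and no proper subgraph (obtained by deleting vertices
and/or edges) is `3`-bad. -/
def IsMinimalThreeBad (G : SimpleGraph V) : Prop :=
  open Classical in
  IsThreeBad G ∧ ∀ H : G.Subgraph, H ≠ ⊤ → ¬ IsThreeBad H.coe

/-! ### Special vertices -/

/-- The number of neighbors of `v` that satisfy `P`. -/
noncomputable def numNbrs (G : SimpleGraph V) (v : V) (P : V → Prop) : ℕ :=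
  open Classical in ((G.neighborFinset v).filter P).card

/-- An `α`-vertex: a `2`-vertex with a `2`-neighbor. -/
def IsAlpha (G : SimpleGraph V) (v : V) : Prop :=
  deg G v = 2 ∧ ∃ x, G.Adj v x ∧ deg G x = 2

/-- A `β`-vertex: a `3`-vertex with a `2`-neighbor. -/
def IsBeta (G : SimpleGraph V) (v : V) : Prop :=
  deg G v = 3 ∧ ∃ x, G.Adj v x ∧ deg G x = 2

/-- A `γ`-vertex: a `4`-vertex with a `1`-neighbor, or a `3`-vertex with an `α`-neighbor or (at
least) two `2`-neighbors. -/
def IsGamma (G : SimpleGraph V) (v : V) : Prop :=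
  (deg G v = 4 ∧ ∃ x, G.Adj v x ∧ deg G x = 1) ∨
    (deg G v = 3 ∧
      ((∃ x, G.Adj v x ∧ IsAlpha G x) ∨ 2 ≤ numNbrs G v (fun x => deg G x = 2)))

/-! ### The configurations -/

/-- A `2`-vertex or `3`-vertex having a `1`-neighbor. -/
def ConfigA (G : SimpleGraph V) : Prop :=
  ∃ v, (deg G v = 2 ∨ deg G v = 3) ∧ ∃ x, G.Adj v x ∧ deg G x = 1

/-- A vertex of degree at most `4` whose neighbors all have degree `2`. -/
def ConfigB (G : SimpleGraph V) : Prop :=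
  ∃ v, deg G v ≤ 4 ∧ ∀ x, G.Adj v x → deg G x = 2

/-- A `3`-vertex having an `α`-neighbor and another `2`-neighbor. -/
def ConfigC (G : SimpleGraph V) : Prop :=
  ∃ v, deg G v = 3 ∧ ∃ x y, x ≠ y ∧ G.Adj v x ∧ IsAlpha G x ∧ G.Adj v y ∧ deg G y = 2

/-- A `4`-vertex having a `1`-neighbor and another neighbor of degree at most `2`. -/
def ConfigD (G : SimpleGraph V) : Prop :=
  ∃ v, deg G v = 4 ∧ ∃ x y, x ≠ y ∧ G.Adj v x ∧ deg G x = 1 ∧ G.Adj v y ∧ deg G y ≤ 2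

/-- A vertex `v` of degree at least `5` with `3 p₁ + 2 p₂ ≥ d(v)`. -/
def ConfigE (G : SimpleGraph V) : Prop :=
  ∃ v, 5 ≤ deg G v ∧
    deg G v ≤ 3 * numNbrs G v (fun x => deg G x = 1) + 2 * numNbrs G v (fun x => deg G x = 2)

/-- Two adjacent `γ`-vertices. -/
def ConfigF (G : SimpleGraph V) : Prop :=
  ∃ v x, G.Adj v x ∧ IsGamma G v ∧ IsGamma G x

/-- A `3`-vertex with two `γ`-neighbors. -/
def ConfigG (G : SimpleGraph V) : Prop :=
  ∃ v, deg G v = 3 ∧ 2 ≤ numNbrs G v (IsGamma G)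

/-- A vertex `v` with `p₁ + 2 q ≥ d(v)` and `p₁ + q > 4`. -/
def ConfigH (G : SimpleGraph V) : Prop :=
  ∃ v, deg G v ≤ numNbrs G v (fun x => deg G x = 1) + 2 * numNbrs G v (IsGamma G) ∧
    4 < numNbrs G v (fun x => deg G x = 1) + numNbrs G v (IsGamma G)

/-- A `5`-vertex having a `1`-neighbor and three `γ`-neighbors. -/
def ConfigI (G : SimpleGraph V) : Prop :=
  ∃ v, deg G v = 5 ∧ (∃ x, G.Adj v x ∧ deg G x = 1) ∧ 3 ≤ numNbrs G v (IsGamma G)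

/-- A `4`-vertex with two `α`-neighbors. -/
def ConfigJ1 (G : SimpleGraph V) : Prop :=
  ∃ v, deg G v = 4 ∧ 2 ≤ numNbrs G v (IsAlpha G)

/-- A `4`-vertex with an `α`-neighbor, another `2`-neighbor, and a `γ`-neighbor. -/
def ConfigJ2 (G : SimpleGraph V) : Prop :=
  ∃ v, deg G v = 4 ∧
    (∃ x y, x ≠ y ∧ G.Adj v x ∧ IsAlpha G x ∧ G.Adj v y ∧ deg G y = 2) ∧
    ∃ z, G.Adj v z ∧ IsGamma G z

/-- A `4`-vertex with a `2`-neighbor and three `γ`-neighbors. -/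
def ConfigJ3 (G : SimpleGraph V) : Prop :=
  ∃ v, deg G v = 4 ∧ (∃ x, G.Adj v x ∧ deg G x = 2) ∧ 3 ≤ numNbrs G v (IsGamma G)

/-- A `γ`-vertex whose neighbors of degree at least `3` are all `β`-vertices. -/
def ConfigK (G : SimpleGraph V) : Prop :=
  ∃ v, IsGamma G v ∧ ∀ x, G.Adj v x → 3 ≤ deg G x → IsBeta G x

end ThreeWeighting

/-!
All configurations are excluded by one reduction, `IsMinimalThreeBad.star`. In a minimal `3`-bad graph
`G`, deleting the edges inside a vertex set `T`, together with the isolated edges that this creates,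
leaves a graph with a proper `3`-weighting; back in `G`, it is proper on all edges that avoid `T`
(`IsMinimalThreeBad.exists_weighting_off`). Let `T` consist of a vertex `v`, some of its neighbours, and
pairwise `Separated` gadgets: small sets such as an `α`-vertex with its `2`-neighbour, or a `γ`-vertex
with its neighbours of small degree. The edges from `v` into `T` get arbitrary new weights, and a gadget
is repairable (`LocalFix`) if the weights inside it can then be chosen such that all edges touching it
become proper. If all gadgets are repairable, then a conflict remains, and it can only be between `v` and
a neighbour of `v` outside of `T`, whose sum has not changed. A configuration is excluded once the
weights at `v` can be chosen such that all gadgets are repairable and the sum at `v` avoids the few sums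
at the untouched neighbours. What is left is to find the repairs and to count.

* Leaves impose no condition on their edge, which settles A. A `2`-neighbour forbids one of the three
  weights, so that each edge to a `2`-neighbour has two admissible weights. The smallest sum at `v` that
  the edges to `2`-neighbours realize can be increased one edge at a time (`exists_chain`, which also
  deals with adjacent `2`-neighbours). The leaves contribute an interval of sums, and by the
  Cauchy–Davenport bound for sumsets of integers the total number of sums exceeds the number of
  untouched neighbours in E. For B there are no leaves and no untouched neighbours; it only remains to
  make the sum at `v` differ from the sums at the `2`-neighbours themselves.
* C, D and J1 only need the repairs at `2`-vertices and `α`-vertices (`localFix_two`, `localFix_alpha`).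
* For a `γ`-neighbour of `v`, each weight towards `v` is blocked by at most one value of the sum at `v`,
  and some weight by none (`gamma_repair`). This settles F and J2, except that gadgets which touch
  each other, in short cycles, are repaired together (such as in `localFix_fourCycle`).
* For G, H, I and J3, several edges at `v` lead to `γ`-vertices. Since A–D and F are already excluded,
  the gadgets of two `γ`-vertices can only meet along a path with one or two `2`-vertices inside. The
  former is impossible (`not_two_gamma`), which leaves the latter (`Paired`, `separated_gammaSet`). Such
  a pair is repaired together, and each of its members still accounts for at most two blocked
  combinations of a weight and a sum (`pair_blocked`). The weights at `v` realize `2n + 1` consecutive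
  sums if `n` edges are re-weighted, and blocking all of them takes more combinations than are
  available (`exists_weights`, `star_gamma`).
* For K, the neighbours of degree at least `3` of the `γ`-vertex `v` are themselves gadgets: the edge from
  a `β`-vertex to its `2`-neighbour is re-weighted. The cases are the three kinds of `γ`-vertices
  `v` (`not_leaf_of_betas`, `not_alpha_of_betas`, `not_two_of_beta`). If two of these gadgets touch,
  then either they are repaired together (`localFix_shared`, `localFix_adjacent`), or, next to a leaf,
  another pair of `β`-neighbours with separated gadgets is used.
-/

namespace ThreeWeighting

set_option linter.unusedSectionVars false

variable {V : Type*} [Fintype V] {G : SimpleGraph V}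

/-! ### Neighbourhoods, weightings and vertex sums -/

/-- The finset of neighbours of `v`, with classical decidability. -/
noncomputable def nbrs (G : SimpleGraph V) (v : V) : Finset V :=
  open Classical in Finset.univ.filter (G.Adj v)

@[simp] theorem mem_nbrs {v u : V} : u ∈ nbrs G v ↔ G.Adj v u := by
  simp [nbrs]

theorem nbrs_eq_neighborFinset (v : V) [Fintype (G.neighborSet v)] :
    G.neighborFinset v = nbrs G v := by
  ext u; simp

theorem deg_eq_card (v : V) : deg G v = (nbrs G v).card := by
  classical
  rw [deg, ← SimpleGraph.card_neighborFinset_eq_degree, nbrs_eq_neighborFinset]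

theorem vertexSum_eq_sum (w : Sym2 V → ℕ) (v : V) :
    vertexSum G w v = ∑ u ∈ nbrs G v, w s(v, u) := by
  classical
  have himg : G.incidenceFinset v = (nbrs G v).image (fun u => s(v, u)) := by
    ext e
    induction e with | _ x y => ?_
    simp only [SimpleGraph.mem_incidenceFinset, SimpleGraph.mk'_mem_incidenceSet_iff,
      Finset.mem_image, mem_nbrs, Sym2.eq_iff]
    constructor
    · rintro ⟨h, rfl | rfl⟩
      · exact ⟨y, h, Or.inl ⟨rfl, rfl⟩⟩
      · exact ⟨x, h.symm, Or.inr ⟨rfl, rfl⟩⟩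
    · rintro ⟨u, h, ⟨rfl, rfl⟩ | ⟨rfl, rfl⟩⟩
      · exact ⟨h, Or.inl rfl⟩
      · exact ⟨h.symm, Or.inr rfl⟩
  unfold vertexSum
  rw [himg, Finset.sum_image]
  exact fun a _ b _ hab => Sym2.congr_right.mp hab

/-- `w` gives every edge of `G` a weight in `{1, 2, 3}`. -/
def IsWeighting (G : SimpleGraph V) (w : Sym2 V → ℕ) : Prop :=
  ∀ x y : V, G.Adj x y → 1 ≤ w s(x, y) ∧ w s(x, y) ≤ 3

theorem isProperWeighting_iff {w : Sym2 V → ℕ} : IsProperWeighting G 3 w ↔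
    IsWeighting G w ∧ ∀ x y : V, G.Adj x y → vertexSum G w x ≠ vertexSum G w y := by
  refine and_congr_left fun _ => ⟨fun h x y hxy => h _ hxy, fun h e => ?_⟩
  induction e with | _ x y => exact h x y

theorem vertexSum_congr {H : SimpleGraph V} {w w' : Sym2 V → ℕ} {x : V}
    (hadj : ∀ y, G.Adj x y ↔ H.Adj x y) (hw : ∀ y, G.Adj x y → w s(x, y) = w' s(x, y)) :
    vertexSum G w x = vertexSum H w' x := by
  rw [vertexSum_eq_sum, vertexSum_eq_sum]
  have : nbrs G x = nbrs H x := by ext; simp [hadj]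
  rw [← this]
  exact Finset.sum_congr rfl fun y hy => hw y (by simpa using hy)

/-! ### Minimal `3`-bad graphs -/

theorem HasIsolatedEdge.of_coe {H : G.Subgraph} [Fintype H.verts]
    (h : HasIsolatedEdge H.coe) : HasIsolatedEdge H.spanningCoe := by
  classical
  have hd : ∀ x : H.verts, deg H.coe x = deg H.spanningCoe x := by
    intro x
    rw [deg_eq_card, deg_eq_card]
    have : nbrs H.spanningCoe (x : V) = (nbrs H.coe x).map ⟨Subtype.val, Subtype.val_injective⟩ := by
      ext u
      simp only [mem_nbrs, SimpleGraph.Subgraph.spanningCoe_adj, Finset.mem_map,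
        Function.Embedding.coeFn_mk, SimpleGraph.Subgraph.coe_adj]
      exact ⟨fun h => ⟨⟨u, H.edge_vert h.symm⟩, h, rfl⟩, by rintro ⟨a, ha, rfl⟩; exact ha⟩
    rw [this, Finset.card_map]
  obtain ⟨x, y, hxy, hx, hy⟩ := h
  exact ⟨x, y, hxy, by rw [← hd, hx], by rw [← hd, hy]⟩

theorem HasProperWeighting.of_coe {H : G.Subgraph} [Fintype H.verts]
    (h : HasProperWeighting H.coe 3) : HasProperWeighting H.spanningCoe 3 := by
  classical
  obtain ⟨w, hw⟩ := h
  rw [isProperWeighting_iff] at hw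
  let w' : Sym2 V → ℕ := fun e =>
    if h : ∃ p : Sym2 H.verts, p.map Subtype.val = e then w h.choose else 1
  have hw' : ∀ x y : H.verts, w' s((x : V), (y : V)) = w s(x, y) := by
    intro x y
    have h : ∃ p : Sym2 H.verts, p.map Subtype.val = s((x : V), (y : V)) := ⟨s(x, y), rfl⟩
    have : h.choose = s(x, y) :=
      Sym2.map.injective Subtype.val_injective (h.choose_spec.trans rfl)
    simp only [w', dif_pos h, this]
  have hs : ∀ x : H.verts, vertexSum H.coe w x = vertexSum H.spanningCoe w' x := by
    intro x
    rw [vertexSum_eq_sum, vertexSum_eq_sum]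
    have : nbrs H.spanningCoe (x : V) = (nbrs H.coe x).map ⟨Subtype.val, Subtype.val_injective⟩ := by
      ext u
      simp only [mem_nbrs, SimpleGraph.Subgraph.spanningCoe_adj, Finset.mem_map,
        Function.Embedding.coeFn_mk, SimpleGraph.Subgraph.coe_adj]
      exact ⟨fun h => ⟨⟨u, H.edge_vert h.symm⟩, h, rfl⟩, by rintro ⟨a, ha, rfl⟩; exact ha⟩
    rw [this, Finset.sum_map]
    exact Finset.sum_congr rfl fun u _ => (hw' x u).symm
  refine ⟨w', isProperWeighting_iff.mpr ⟨fun x y hxy => ?_, fun x y hxy => ?_⟩⟩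
  · have := hw.1 ⟨x, H.edge_vert hxy⟩ ⟨y, H.edge_vert hxy.symm⟩ hxy
    rwa [← hw'] at this
  · have := hw.2 ⟨x, H.edge_vert hxy⟩ ⟨y, H.edge_vert hxy.symm⟩ hxy
    rwa [hs, hs] at this

/-- Minimality, with subgraphs regarded as graphs on the vertex set of `G`. -/
theorem IsMinimalThreeBad.subgraph (hG : IsMinimalThreeBad G) (H : G.Subgraph) (hH : H ≠ ⊤) :
    HasIsolatedEdge H.spanningCoe ∨ HasProperWeighting H.spanningCoe 3 := by
  classical
  by_contra hcon
  rw [not_or] at hcon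
  exact hG.2 H hH ⟨fun h => hcon.1 h.of_coe, fun h => hcon.2 h.of_coe⟩

/-- Deleting an isolated vertex would leave a smaller `3`-bad graph. -/
theorem IsMinimalThreeBad.deg_ne_zero (hG : IsMinimalThreeBad G) (v : V) : deg G v ≠ 0 := by
  intro h0
  have hv : ∀ u, ¬ G.Adj v u := by
    intro u hu
    rw [deg_eq_card, Finset.card_eq_zero] at h0
    have : u ∈ nbrs G v := by simpa using hu
    rw [h0] at this
    simp at this
  let H : G.Subgraph :=
    { verts := {v}ᶜ
      Adj := G.Adj
      adj_sub := id
      edge_vert := by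
        intro a b hab ha
        rw [Set.mem_singleton_iff] at ha
        exact hv b (ha ▸ hab)
      symm := G.symm }
  have hH : H ≠ ⊤ := by
    intro h
    have : v ∈ H.verts := by rw [h]; trivial
    exact this rfl
  have hs : H.spanningCoe = G := by ext; rfl
  have := hG.subgraph H hH
  rw [hs] at this
  exact this.elim hG.1.1 hG.1.2

/-- In a minimal `3`-bad graph, un-weighting the edges inside a vertex set `T` leaves a weighting
that is proper on all edges avoiding `T`. Isolated edges created by the deletion touch `T`, so they
may be deleted as well. -/
theorem IsMinimalThreeBad.exists_weighting_off (hG : IsMinimalThreeBad G) (T : Set V) {a b : V}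
    (hab : G.Adj a b) (ha : a ∈ T) (hb : b ∈ T) :
    ∃ w, IsWeighting G w ∧
      ∀ x y, G.Adj x y → x ∉ T → y ∉ T → vertexSum G w x ≠ vertexSum G w y := by
  classical
  let G₁ : SimpleGraph V :=
    { Adj := fun x y => G.Adj x y ∧ ¬ (x ∈ T ∧ y ∈ T)
      symm := ⟨fun x y h => ⟨h.1.symm, fun k => h.2 k.symm⟩⟩
      loopless := ⟨fun x h => G.loopless.irrefl x h.1⟩ }
  -- `H` arises from `G` by deleting the edges inside `T` and then all isolated edges
  let H : G.Subgraph :=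
    { verts := Set.univ
      Adj := fun x y => G₁.Adj x y ∧ ¬ (deg G₁ x = 1 ∧ deg G₁ y = 1)
      adj_sub := fun h => h.1.1
      edge_vert := fun _ => trivial
      symm := ⟨fun x y h => ⟨h.1.symm, fun k => h.2 k.symm⟩⟩ }
  have hH : H ≠ ⊤ := by
    intro h
    have : H.Adj a b := by rw [h]; exact hab
    exact this.1.2 ⟨ha, hb⟩
  have huniq : ∀ (K : SimpleGraph V) (x y z : V), deg K x = 1 → K.Adj x y → K.Adj x z → y = z := by
    intro K x y z hd hy hz
    rw [deg_eq_card] at hd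
    exact Finset.card_le_one.mp hd.le y (by simpa using hy) z (by simpa using hz)
  have hiso : ¬ HasIsolatedEdge H.spanningCoe := by
    rintro ⟨x, y, hxy, hx, hy⟩
    have key : ∀ x y, H.Adj x y → nbrs H.spanningCoe x = nbrs G₁ x := by
      intro x y hxy
      ext z
      rw [mem_nbrs, mem_nbrs]
      refine ⟨fun h => h.1, fun h => ⟨h, fun hd => ?_⟩⟩
      have hzy := huniq G₁ x z y hd.1 h hxy.1
      subst hzy
      exact hxy.2 hd
    refine hxy.2 ⟨?_, ?_⟩
    · rw [deg_eq_card, ← key x y hxy, ← deg_eq_card, hx]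
    · rw [deg_eq_card, ← key y x hxy.symm, ← deg_eq_card, hy]
  obtain ⟨w, hw⟩ := (hG.subgraph H hH).resolve_left hiso
  rw [isProperWeighting_iff] at hw
  refine ⟨fun e => if e ∈ H.edgeSet then w e else 1, fun x y hxy => ?_, fun x y hxy hx hy => ?_⟩
  · by_cases h : s(x, y) ∈ H.edgeSet
    · simpa [h] using hw.1 x y h
    · simp [h]
  · have hG₁ : ∀ x, x ∉ T → nbrs G₁ x = nbrs G x := by
      intro x hx
      ext z
      rw [mem_nbrs, mem_nbrs]
      exact ⟨fun h => h.1, fun h => ⟨h, fun k => hx k.1⟩⟩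
    have hdeg : ∀ x, x ∉ T → deg G₁ x = deg G x := by
      intro x hx
      rw [deg_eq_card, deg_eq_card, hG₁ x hx]
    have hHxy : H.Adj x y := by
      refine ⟨⟨hxy, fun k => hx k.1⟩, fun hd => hG.1.1 ⟨x, y, hxy, ?_, ?_⟩⟩
      · rw [← hdeg x hx, hd.1]
      · rw [← hdeg y hy, hd.2]
    have hadj : ∀ x y, H.Adj x y → x ∉ T → ∀ z, G.Adj x z ↔ H.Adj x z := by
      intro x y hxy hx z
      refine ⟨fun h => ⟨⟨h, fun k => hx k.1⟩, fun hd => ?_⟩, fun h => h.1.1⟩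
      have hzy := huniq G₁ x z y hd.1 ⟨h, fun k => hx k.1⟩ hxy.1
      subst hzy
      exact hxy.2 hd
    have hsum : ∀ x y, H.Adj x y → x ∉ T →
        vertexSum G (fun e => if e ∈ H.edgeSet then w e else 1) x =
          vertexSum H.spanningCoe w x := by
      intro x y hxy hx
      refine vertexSum_congr (hadj x y hxy hx) fun z hz => ?_
      have : s(x, z) ∈ H.edgeSet := (hadj x y hxy hx z).mp hz
      simp [this]
    rw [hsum x y hHxy hx, hsum y x hHxy.symm hy]
    exact hw.2 x y hHxy

/-! ### Local repairs -/

/-- The sum that a neighbour of `u` must avoid when `v` is regarded as having sum `A`, whatever its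
actual sum is. -/
noncomputable def target (G : SimpleGraph V) (w : Sym2 V → ℕ) (v : V) (A : ℕ) (u : V) : ℕ :=
  open Classical in if u = v then A else vertexSum G w u

@[simp] theorem target_self {w : Sym2 V → ℕ} {v : V} {A : ℕ} : target G w v A v = A := by
  simp [target]

theorem target_of_ne {w : Sym2 V → ℕ} {v u : V} {A : ℕ} (h : u ≠ v) :
    target G w v A u = vertexSum G w u := by
  simp [target, h]

/-- Changing `w` only on the edges inside `T` can make all edges that touch `T` proper, when `v` is
regarded as having sum `A`. Used with `v ∉ T`, so that the change does not affect the sum at `v`. -/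
def LocalFix (G : SimpleGraph V) (w : Sym2 V → ℕ) (T : Set V) (v : V) (A : ℕ) : Prop :=
  ∃ w', IsWeighting G w' ∧
    (∀ x y, G.Adj x y → ¬ (x ∈ T ∧ y ∈ T) → w' s(x, y) = w s(x, y)) ∧
    ∀ x ∈ T, ∀ y, G.Adj x y → vertexSum G w' x ≠ target G w' v A y

/-- `T` and `T'` are disjoint and no edge joins them. -/
def Separated (G : SimpleGraph V) (T T' : Set V) : Prop :=
  ∀ x ∈ T, ∀ y ∈ T', x ≠ y ∧ ¬ G.Adj x y

theorem Separated.symm {T T' : Set V} (h : Separated G T T') : Separated G T' T :=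
  fun x hx y hy => ⟨(h y hy x hx).1.symm, fun k => (h y hy x hx).2 k.symm⟩

/-- The weighting `w` with the weight of the edge `s(v, s)` replaced by `f s`, for all `s ∈ S`. -/
noncomputable def overwrite (w : Sym2 V → ℕ) (v : V) (S : Finset V) (f : V → ℕ) : Sym2 V → ℕ :=
  fun e => open Classical in if h : ∃ s ∈ S, e = s(v, s) then f h.choose else w e

section overwrite

variable {w : Sym2 V → ℕ} {v : V} {S : Finset V} {f : V → ℕ}

theorem overwrite_mem {s : V} (hs : s ∈ S) : overwrite w v S f s(v, s) = f s := by
  have h : ∃ t ∈ S, s(v, s) = s(v, t) := ⟨s, hs, rfl⟩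
  have := Sym2.congr_right.mp h.choose_spec.2
  rw [overwrite, dif_pos h, ← this]

theorem overwrite_mem' {s : V} (hs : s ∈ S) : overwrite w v S f s(s, v) = f s := by
  rw [Sym2.eq_swap, overwrite_mem hs]

theorem overwrite_notMem {u : V} (hu : u ∉ S) : overwrite w v S f s(v, u) = w s(v, u) := by
  rw [overwrite, dif_neg]
  rintro ⟨t, ht, h⟩
  exact hu (Sym2.congr_right.mp h ▸ ht)

theorem overwrite_notMem' {u : V} (hu : u ∉ S) : overwrite w v S f s(u, v) = w s(u, v) := by
  rw [Sym2.eq_swap, overwrite_notMem hu]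

theorem overwrite_of_ne {x y : V} (hx : x ≠ v) (hy : y ≠ v) :
    overwrite w v S f s(x, y) = w s(x, y) := by
  rw [overwrite, dif_neg]
  rintro ⟨t, -, h⟩
  rw [Sym2.eq_iff] at h
  rcases h with h | h
  · exact hx h.1
  · exact hy h.2

theorem vertexSum_overwrite_of_ne {z : V} (hz : z ≠ v) (hzS : z ∉ S) :
    vertexSum G (overwrite w v S f) z = vertexSum G w z := by
  refine vertexSum_congr (fun _ => Iff.rfl) fun y _ => ?_
  by_cases hy : y = v
  · rw [hy, overwrite_notMem' hzS]
  · exact overwrite_of_ne hz hy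

theorem vertexSum_overwrite_self [DecidableEq V] (hS : ∀ s ∈ S, G.Adj v s) :
    vertexSum G (overwrite w v S f) v = ∑ s ∈ S, f s + ∑ u ∈ nbrs G v \ S, w s(v, u) := by
  have hsub : S ⊆ nbrs G v := fun s hs => by simpa using hS s hs
  rw [vertexSum_eq_sum, ← Finset.sum_sdiff hsub, add_comm]
  congr 1
  · exact Finset.sum_congr rfl fun s hs => overwrite_mem hs
  · exact Finset.sum_congr rfl fun s hs => overwrite_notMem (Finset.mem_sdiff.mp hs).2

theorem IsWeighting.overwrite (hw : IsWeighting G w) (hf : ∀ s ∈ S, 1 ≤ f s ∧ f s ≤ 3) :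
    IsWeighting G (overwrite w v S f) := by
  intro x y hxy
  unfold ThreeWeighting.overwrite
  split_ifs with h
  · exact hf _ h.choose_spec.1
  · exact hw x y hxy

end overwrite

/-- The basic reduction. In a minimal `3`-bad graph, re-weight the edges from `v` to the vertices of
`S` and the edges inside the members of the family `𝒯` of pairwise separated sets, where each vertex
of `S` is a leaf or lies in a member of `𝒯`. If all members of `𝒯` can be repaired, then the new sum
at `v` must equal the sum of some neighbour that has not been touched. -/
theorem IsMinimalThreeBad.star [DecidableEq V] (hG : IsMinimalThreeBad G) {v : V} {S : Finset V}
    (𝒯 : Set (Set V)) (hne : S.Nonempty) (hS : ∀ s ∈ S, G.Adj v s) (hd : 2 ≤ deg G v)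
    (hv : ∀ T ∈ 𝒯, v ∉ T) (hsep : ∀ T ∈ 𝒯, ∀ T' ∈ 𝒯, T ≠ T' → Separated G T T')
    (hleaf : ∀ s ∈ S, (∃ T ∈ 𝒯, s ∈ T) ∨ deg G s = 1) :
    ∃ w, IsWeighting G w ∧ ∀ f : V → ℕ, (∀ s ∈ S, 1 ≤ f s ∧ f s ≤ 3) →
      (∀ T ∈ 𝒯, LocalFix G (overwrite w v S f) T v
        (∑ s ∈ S, f s + ∑ u ∈ nbrs G v \ S, w s(v, u))) →
      ∃ u, G.Adj v u ∧ u ∉ S ∧ (∀ T ∈ 𝒯, u ∉ T) ∧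
        vertexSum G w u = ∑ s ∈ S, f s + ∑ u ∈ nbrs G v \ S, w s(v, u) := by
  obtain ⟨s₀, hs₀⟩ := hne
  obtain ⟨w, hw, hprop⟩ := hG.exists_weighting_off ({v} ∪ S ∪ ⋃₀ 𝒯) (hS s₀ hs₀)
    (Or.inl (Or.inl rfl)) (Or.inl (Or.inr hs₀))
  refine ⟨w, hw, fun f hf hfix => ?_⟩
  rw [← vertexSum_overwrite_self (w := w) (f := f) hS] at hfix ⊢
  have hw₁ := hw.overwrite (v := v) hf
  set w₁ := overwrite w v S f with hw₁_def
  by_contra! hcon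
  choose! W hW hWoff hWon using hfix
  let w₂ : Sym2 V → ℕ := fun e =>
    open Classical in if h : ∃ T ∈ 𝒯, ∀ x ∈ e, x ∈ T then W h.choose e else w₁ e
  -- `w₂` glues the repairs `W T` of all members `T` of `𝒯` together
  have huniq : ∀ T ∈ 𝒯, ∀ T' ∈ 𝒯, ∀ x, x ∈ T → x ∈ T' → T = T' := by
    intro T hT T' hT' x hx hx'
    by_contra hne
    exact (hsep T hT T' hT' hne x hx x hx').1 rfl
  have hon : ∀ T ∈ 𝒯, ∀ x ∈ T, ∀ y, G.Adj x y → w₂ s(x, y) = W T s(x, y) := by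
    intro T hT x hx y hxy
    by_cases h : ∃ T ∈ 𝒯, ∀ z ∈ s(x, y), z ∈ T
    · have hT' := huniq _ h.choose_spec.1 T hT x (h.choose_spec.2 x (by simp)) hx
      simp only [w₂, dif_pos h]
      rw [hT']
    · simp only [w₂, dif_neg h]
      rw [hWoff T hT x y hxy]
      rintro ⟨-, hy⟩
      exact h ⟨T, hT, by simp [hx, hy]⟩
  have hoff : ∀ x y, (∀ T ∈ 𝒯, x ∉ T) → w₂ s(x, y) = w₁ s(x, y) := by
    intro x y hx
    have h : ¬ ∃ T ∈ 𝒯, ∀ z ∈ s(x, y), z ∈ T := by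
      rintro ⟨T, hT, h⟩
      exact hx T hT (h x (by simp))
    simp only [w₂, dif_neg h]
  have hsum_on : ∀ T ∈ 𝒯, ∀ x ∈ T, vertexSum G w₂ x = vertexSum G (W T) x := fun T hT x hx =>
    vertexSum_congr (fun _ => Iff.rfl) (hon T hT x hx)
  have hsum_off : ∀ x, (∀ T ∈ 𝒯, x ∉ T) → vertexSum G w₂ x = vertexSum G w₁ x := fun x hx =>
    vertexSum_congr (fun _ => Iff.rfl) fun y _ => hoff x y hx
  have hw₂ : IsWeighting G w₂ := by
    intro x y hxy
    by_cases hx : ∃ T ∈ 𝒯, x ∈ T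
    · obtain ⟨T, hT, hx⟩ := hx
      rw [hon T hT x hx y hxy]
      exact hW T hT x y hxy
    · push Not at hx
      rw [hoff x y hx]
      exact hw₁ x y hxy
  have htouch : ∀ T ∈ 𝒯, ∀ x ∈ T, ∀ y, G.Adj x y → vertexSum G w₂ x ≠ vertexSum G w₂ y := by
    intro T hT x hx y hxy
    have := hWon T hT x hx y hxy
    rw [hsum_on T hT x hx]
    by_cases hy : ∃ T' ∈ 𝒯, y ∈ T'
    · obtain ⟨T', hT', hy⟩ := hy
      have hTT' : T = T' := by
        by_contra hne
        exact (hsep T hT T' hT' hne x hx y hy).2 hxy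
      subst hTT'
      have hyv : y ≠ v := by
        rintro rfl
        exact hv T hT hy
      rw [target_of_ne hyv] at this
      rwa [hsum_on T hT y hy]
    · push Not at hy
      rw [hsum_off y hy]
      by_cases hyv : y = v
      · subst hyv
        simpa using this
      · rw [target_of_ne hyv] at this
        rwa [← vertexSum_congr (fun _ => Iff.rfl)
          fun z hz => hWoff T hT y z hz fun k => hy T hT k.1]
  have hvT : ∀ y, G.Adj v y → (∀ T ∈ 𝒯, y ∉ T) → vertexSum G w₂ v ≠ vertexSum G w₂ y := by
    intro y hy hyT
    rw [hsum_off v hv, hsum_off y hyT]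
    by_cases hyS : y ∈ S
    · have hdy := (hleaf y hyS).resolve_left fun ⟨T, hT, h⟩ => hyT T hT h
      have hyn : nbrs G y = {v} := by
        rw [deg_eq_card, Finset.card_eq_one] at hdy
        obtain ⟨a, ha⟩ := hdy
        have : v ∈ nbrs G y := by simpa using hy.symm
        rw [ha, Finset.mem_singleton] at this
        rw [ha, this]
      -- a leaf has a smaller sum than its neighbour `v`, which has another edge
      have hpos : ∃ z, G.Adj v z ∧ z ≠ y := by
        rw [deg_eq_card] at hd
        obtain ⟨z, hz, hzy⟩ := Finset.exists_mem_ne (by omega : 1 < (nbrs G v).card) y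
        exact ⟨z, by simpa using hz, hzy⟩
      obtain ⟨z, hz, hzy⟩ := hpos
      have hle : w₁ s(v, y) + w₁ s(v, z) ≤ vertexSum G w₁ v := by
        rw [vertexSum_eq_sum, ← Finset.sum_pair (f := fun u => w₁ s(v, u)) hzy.symm]
        refine Finset.sum_le_sum_of_subset ?_
        intro u hu
        simp only [Finset.mem_insert, Finset.mem_singleton] at hu
        rcases hu with rfl | rfl <;> simpa
      have hy' : vertexSum G w₁ y = w₁ s(v, y) := by
        rw [vertexSum_eq_sum, hyn, Finset.sum_singleton, Sym2.eq_swap]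
      have := (hw₁ v z hz).1
      omega
    · rw [vertexSum_overwrite_of_ne (G.ne_of_adj hy).symm hyS]
      exact (hcon y hy hyS hyT).symm
  refine hG.1.2 ⟨w₂, isProperWeighting_iff.mpr ⟨hw₂, fun x y hxy => ?_⟩⟩
  by_cases hx : ∃ T ∈ 𝒯, x ∈ T
  · obtain ⟨T, hT, hx⟩ := hx
    exact htouch T hT x hx y hxy
  by_cases hy : ∃ T ∈ 𝒯, y ∈ T
  · obtain ⟨T, hT, hy⟩ := hy
    exact (htouch T hT y hy x hxy.symm).symm
  push Not at hx hy
  by_cases hxv : x = v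
  · subst hxv
    exact hvT y hxy hy
  by_cases hyv : y = v
  · subst hyv
    exact (hvT x hxy.symm hx).symm
  have hnS : ∀ x y, G.Adj x y → y ≠ v → (∀ T ∈ 𝒯, x ∉ T) → x ∉ S := by
    intro x y hxy hyv hx hxS
    have hdx := (hleaf x hxS).resolve_left fun ⟨T, hT, h⟩ => hx T hT h
    rw [deg_eq_card] at hdx
    exact hyv (Finset.card_le_one.mp hdx.le y (by simpa using hxy) v
      (by simpa using (hS x hxS).symm))
  have hxS := hnS x y hxy hyv hx
  have hyS := hnS y x hxy.symm hxv hy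
  rw [hsum_off x hx, hsum_off y hy, vertexSum_overwrite_of_ne hxv hxS,
    vertexSum_overwrite_of_ne hyv hyS]
  refine hprop x y hxy ?_ ?_
  · rintro ((h | h) | ⟨T, hT, h⟩)
    · exact hxv h
    · exact hxS h
    · exact hx T hT h
  · rintro ((h | h) | ⟨T, hT, h⟩)
    · exact hyv h
    · exact hyS h
    · exact hy T hT h

/-! ### Explicit neighbourhoods -/

/-- The neighbours of `v` are the distinct vertices `a`, `b`. -/
def IsNbrs₂ (G : SimpleGraph V) (v a b : V) : Prop :=
  a ≠ b ∧ ∀ u, G.Adj v u ↔ u = a ∨ u = b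

/-- The neighbours of `v` are the distinct vertices `a`, `b`, `c`. -/
def IsNbrs₃ (G : SimpleGraph V) (v a b c : V) : Prop :=
  (a ≠ b ∧ a ≠ c ∧ b ≠ c) ∧ ∀ u, G.Adj v u ↔ u = a ∨ u = b ∨ u = c

/-- The neighbours of `v` are the distinct vertices `a`, `b`, `c`, `d`. -/
def IsNbrs₄ (G : SimpleGraph V) (v a b c d : V) : Prop :=
  (a ≠ b ∧ a ≠ c ∧ a ≠ d ∧ b ≠ c ∧ b ≠ d ∧ c ≠ d) ∧
    ∀ u, G.Adj v u ↔ u = a ∨ u = b ∨ u = c ∨ u = d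

theorem IsNbrs₂.symm {v a b : V} (h : IsNbrs₂ G v a b) : IsNbrs₂ G v b a :=
  ⟨h.1.symm, fun u => (h.2 u).trans or_comm⟩

section nbrs

variable [DecidableEq V] {v a b c d : V}

theorem IsNbrs₂.nbrs_eq (h : IsNbrs₂ G v a b) : nbrs G v = {a, b} := by
  ext u; simp [h.2]

theorem IsNbrs₃.nbrs_eq (h : IsNbrs₃ G v a b c) : nbrs G v = {a, b, c} := by
  ext u; simp [h.2]

theorem IsNbrs₄.nbrs_eq (h : IsNbrs₄ G v a b c d) : nbrs G v = {a, b, c, d} := by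
  ext u; simp [h.2]

end nbrs

section nbrs

variable {v a b c d : V} {w : Sym2 V → ℕ}

theorem IsNbrs₂.vertexSum_eq (h : IsNbrs₂ G v a b) :
    vertexSum G w v = w s(v, a) + w s(v, b) := by
  classical
  rw [vertexSum_eq_sum, h.nbrs_eq, Finset.sum_pair h.1]

theorem IsNbrs₃.vertexSum_eq (h : IsNbrs₃ G v a b c) :
    vertexSum G w v = w s(v, a) + w s(v, b) + w s(v, c) := by
  classical
  rw [vertexSum_eq_sum, h.nbrs_eq, Finset.sum_insert (by simp [h.1]), Finset.sum_pair h.1.2.2,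
    add_assoc]

theorem IsNbrs₄.vertexSum_eq (h : IsNbrs₄ G v a b c d) :
    vertexSum G w v = w s(v, a) + w s(v, b) + w s(v, c) + w s(v, d) := by
  classical
  rw [vertexSum_eq_sum, h.nbrs_eq, Finset.sum_insert (by simp [h.1]),
    Finset.sum_insert (by simp [h.1]), Finset.sum_pair h.1.2.2.2.2.2]
  ring

theorem IsNbrs₂.deg_eq (h : IsNbrs₂ G v a b) : deg G v = 2 := by
  classical
  rw [deg_eq_card, h.nbrs_eq, Finset.card_pair h.1]

theorem IsNbrs₃.deg_eq (h : IsNbrs₃ G v a b c) : deg G v = 3 := by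
  classical
  rw [deg_eq_card, h.nbrs_eq, Finset.card_insert_of_notMem (by simp [h.1]),
    Finset.card_pair h.1.2.2]

theorem exists_nbrs₂ (hd : deg G v = 2) (ha : G.Adj v a) : ∃ b, IsNbrs₂ G v a b := by
  classical
  rw [deg_eq_card] at hd
  have ha' : a ∈ nbrs G v := by simpa
  have hc := Finset.card_erase_of_mem ha'
  rw [hd] at hc
  obtain ⟨b, hb⟩ := Finset.card_eq_one.mp hc
  have hmem : ∀ u, u ∈ (nbrs G v).erase a ↔ u = b := by simp [hb]
  simp only [Finset.mem_erase, mem_nbrs] at hmem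
  refine ⟨b, fun h => ((hmem b).mpr rfl).1 h.symm, fun u => ⟨fun hu => ?_, ?_⟩⟩
  · by_cases h : u = a
    · exact Or.inl h
    · exact Or.inr ((hmem u).mp ⟨h, hu⟩)
  · rintro (rfl | rfl)
    · exact ha
    · exact ((hmem u).mpr rfl).2

theorem exists_nbrs₃ (hd : deg G v = 3) (ha : G.Adj v a) (hb : G.Adj v b) (hab : a ≠ b) :
    ∃ c, IsNbrs₃ G v a b c := by
  classical
  rw [deg_eq_card] at hd
  have hc := Finset.card_sdiff_of_subset (s := {a, b}) (t := nbrs G v)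
    (by intro u hu; simp only [Finset.mem_insert, Finset.mem_singleton] at hu
        rcases hu with rfl | rfl <;> simpa)
  rw [hd, Finset.card_pair hab] at hc
  obtain ⟨c, hc⟩ := Finset.card_eq_one.mp hc
  have hmem : ∀ u, u ∈ nbrs G v \ {a, b} ↔ u = c := by simp [hc]
  simp only [Finset.mem_sdiff, mem_nbrs, Finset.mem_insert, Finset.mem_singleton, not_or] at hmem
  have h := (hmem c).mpr rfl
  refine ⟨c, ⟨hab, Ne.symm h.2.1, Ne.symm h.2.2⟩, fun u => ⟨fun hu => ?_, ?_⟩⟩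
  · by_cases h1 : u = a
    · exact Or.inl h1
    by_cases h2 : u = b
    · exact Or.inr (Or.inl h2)
    exact Or.inr (Or.inr ((hmem u).mp ⟨hu, h1, h2⟩))
  · rintro (rfl | rfl | rfl)
    exacts [ha, hb, h.1]

theorem exists_nbrs₄ (hd : deg G v = 4) (ha : G.Adj v a) (hb : G.Adj v b) (hc : G.Adj v c)
    (hab : a ≠ b) (hac : a ≠ c) (hbc : b ≠ c) : ∃ d, IsNbrs₄ G v a b c d := by
  classical
  rw [deg_eq_card] at hd
  have hc' := Finset.card_sdiff_of_subset (s := {a, b, c}) (t := nbrs G v)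
    (by intro u hu; simp only [Finset.mem_insert, Finset.mem_singleton] at hu
        rcases hu with rfl | rfl | rfl <;> simpa)
  rw [hd, Finset.card_insert_of_notMem (by simp [hab, hac]), Finset.card_pair hbc] at hc'
  obtain ⟨d, hd⟩ := Finset.card_eq_one.mp hc'
  have hmem : ∀ u, u ∈ nbrs G v \ {a, b, c} ↔ u = d := by simp [hd]
  simp only [Finset.mem_sdiff, mem_nbrs, Finset.mem_insert, Finset.mem_singleton, not_or] at hmem
  have h := (hmem d).mpr rfl
  refine ⟨d, ⟨hab, hac, Ne.symm h.2.1, hbc, Ne.symm h.2.2.1, Ne.symm h.2.2.2⟩,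
    fun u => ⟨fun hu => ?_, ?_⟩⟩
  · by_cases h1 : u = a
    · exact Or.inl h1
    by_cases h2 : u = b
    · exact Or.inr (Or.inl h2)
    by_cases h3 : u = c
    · exact Or.inr (Or.inr (Or.inl h3))
    exact Or.inr (Or.inr (Or.inr ((hmem u).mp ⟨hu, h1, h2, h3⟩)))
  · rintro (rfl | rfl | rfl | rfl)
    exacts [ha, hb, hc, h.1]

theorem exists_nbrs₄' (hd : deg G v = 4) (ha : G.Adj v a) (hb : G.Adj v b) (hab : a ≠ b) :
    ∃ c d, IsNbrs₄ G v a b c d := by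
  classical
  have hd' := hd
  rw [deg_eq_card] at hd'
  obtain ⟨c, hc, hcab⟩ := Finset.exists_mem_notMem_of_card_lt_card
    (show ({a, b} : Finset V).card < (nbrs G v).card by rw [Finset.card_pair hab]; omega)
  simp only [Finset.mem_insert, Finset.mem_singleton, not_or, mem_nbrs] at hc hcab
  obtain ⟨d, hd⟩ := exists_nbrs₄ hd ha hb hc hab (Ne.symm hcab.1) (Ne.symm hcab.2)
  exact ⟨c, d, hd⟩

theorem exists_adj_of_deg_eq_one (hd : deg G v = 1) (ha : G.Adj v a) : ∀ u, G.Adj v u ↔ u = a := by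
  rw [deg_eq_card] at hd
  refine fun u => ⟨fun hu => Finset.card_le_one.mp hd.le u (by simpa) a (by simpa), ?_⟩
  rintro rfl
  exact ha

end nbrs

/-! ### Changing the weight of one edge -/

/-- The weighting `w` with the weight of `s(x, y)` replaced by `b`. -/
noncomputable def setEdge (w : Sym2 V → ℕ) (x y : V) (b : ℕ) : Sym2 V → ℕ :=
  fun e => open Classical in if e = s(x, y) then b else w e

section setEdge

variable {w : Sym2 V → ℕ} {x y v : V} {b A : ℕ} {T : Set V}

theorem setEdge_self : setEdge w x y b s(x, y) = b := by simp [setEdge]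

theorem setEdge_self' : setEdge w x y b s(y, x) = b := by rw [Sym2.eq_swap, setEdge_self]

theorem setEdge_left {p q : V} (h : p ≠ x) (h' : p ≠ y) : setEdge w x y b s(p, q) = w s(p, q) := by
  simp [setEdge, h, h']

theorem setEdge_right {p q : V} (h : q ≠ x) (h' : q ≠ y) :
    setEdge w x y b s(p, q) = w s(p, q) := by
  simp [setEdge, h, h']

theorem vertexSum_setEdge {z : V} (hx : z ≠ x) (hy : z ≠ y) :
    vertexSum G (setEdge w x y b) z = vertexSum G w z :=
  vertexSum_congr (fun _ => Iff.rfl) fun _ _ => setEdge_left hx hy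

theorem IsWeighting.setEdge (hw : IsWeighting G w) (hb : 1 ≤ b ∧ b ≤ 3) :
    IsWeighting G (setEdge w x y b) := by
  intro p q hpq
  unfold ThreeWeighting.setEdge
  split_ifs
  · exact hb
  · exact hw p q hpq

/-- A repair of `T` may begin with re-weighting an edge inside `T`. -/
theorem LocalFix.of_setEdge (hx : x ∈ T) (hy : y ∈ T) (h : LocalFix G (setEdge w x y b) T v A) :
    LocalFix G w T v A := by
  obtain ⟨w', hw', hoff, hon⟩ := h
  refine ⟨w', hw', fun p q hpq hT => ?_, hon⟩
  rw [hoff p q hpq hT, ThreeWeighting.setEdge, if_neg]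
  intro h
  rw [Sym2.eq_iff] at h
  rcases h with ⟨rfl, rfl⟩ | ⟨rfl, rfl⟩
  · exact hT ⟨hx, hy⟩
  · exact hT ⟨hy, hx⟩

theorem LocalFix.of_proper (hw : IsWeighting G w)
    (h : ∀ x ∈ T, ∀ y, G.Adj x y → vertexSum G w x ≠ target G w v A y) : LocalFix G w T v A :=
  ⟨w, hw, fun _ _ _ _ => rfl, h⟩

theorem target_setEdge {z : V} (hx : z ≠ x) (hy : z ≠ y) :
    target G (setEdge w x y b) v A z = target G w v A z := by
  by_cases hz : z = v
  · simp [hz]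
  · rw [target_of_ne hz, target_of_ne hz, vertexSum_setEdge hx hy]

end setEdge

theorem exists_avoid₂ (p q r s : ℕ) : ∃ b, (1 ≤ b ∧ b ≤ 3) ∧ b + p ≠ q ∧ b + r ≠ s := by
  by_contra! h
  have h1 := h 1
  have h2 := h 2
  have h3 := h 3
  omega

/-! ### Repairable gadgets -/

section gadgets

variable {w : Sym2 V → ℕ} {v : V} {A : ℕ}

/-- An `α`-neighbour `x` of `v` with its `2`-neighbour `x'`: the weight of `s(x, x')` contributes equally
to both of them, so their sums differ as soon as the weights of their other edges do. -/
theorem localFix_alpha {x x' x'' : V} (hw : IsWeighting G w) (hx : IsNbrs₂ G x v x')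
    (hx' : IsNbrs₂ G x' x x'') (hne : w s(x, v) ≠ w s(x', x'')) : LocalFix G w {x, x'} v A := by
  have hxx' : x ≠ x' := G.ne_of_adj ((hx.2 x').mpr (Or.inr rfl))
  have hxv : x ≠ v := G.ne_of_adj ((hx.2 v).mpr (Or.inl rfl))
  have hx'x'' : x' ≠ x'' := G.ne_of_adj ((hx'.2 x'').mpr (Or.inr rfl))
  have hx'v : x' ≠ v := hx.1.symm
  have hxx'' : x ≠ x'' := hx'.1
  obtain ⟨c, hc, hc1, hc2⟩ := exists_avoid₂ (w s(x, v)) A (w s(x', x'')) (target G w v A x'')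
  refine LocalFix.of_setEdge (x := x) (y := x') (b := c) (by simp) (by simp)
    (LocalFix.of_proper (hw.setEdge hc) ?_)
  have e1 : vertexSum G (setEdge w x x' c) x = w s(x, v) + c := by
    rw [hx.vertexSum_eq, setEdge_self, setEdge_right hxv.symm hx'v.symm]
  have e2 : vertexSum G (setEdge w x x' c) x' = c + w s(x', x'') := by
    rw [hx'.vertexSum_eq, setEdge_self', setEdge_right hxx''.symm hx'x''.symm]
  have e3 : target G (setEdge w x x' c) v A x'' = target G w v A x'' :=
    target_setEdge hxx''.symm hx'x''.symm
  rintro p (rfl | rfl) q hpq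
  · rcases (hx.2 q).mp hpq with rfl | rfl
    · rw [e1, target_self]; omega
    · rw [e1, target_of_ne hx'v, e2]; omega
  · rcases (hx'.2 q).mp hpq with rfl | rfl
    · rw [e2, target_of_ne hxv, e1]; omega
    · rw [e2, e3]; omega

end gadgets

section gadgets

variable {w : Sym2 V → ℕ} {v : V} {A : ℕ}

theorem IsNbrs₂.adj_left {v a b : V} (h : IsNbrs₂ G v a b) : G.Adj v a := (h.2 a).mpr (Or.inl rfl)
theorem IsNbrs₂.adj_right {v a b : V} (h : IsNbrs₂ G v a b) : G.Adj v b := (h.2 b).mpr (Or.inr rfl)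
theorem IsNbrs₃.adj₁ {v a b c : V} (h : IsNbrs₃ G v a b c) : G.Adj v a := (h.2 a).mpr (Or.inl rfl)
theorem IsNbrs₃.adj₂ {v a b c : V} (h : IsNbrs₃ G v a b c) : G.Adj v b :=
  (h.2 b).mpr (Or.inr (Or.inl rfl))
theorem IsNbrs₃.adj₃ {v a b c : V} (h : IsNbrs₃ G v a b c) : G.Adj v c :=
  (h.2 c).mpr (Or.inr (Or.inr rfl))
theorem IsNbrs₄.adj₁ {v a b c d : V} (h : IsNbrs₄ G v a b c d) : G.Adj v a :=
  (h.2 a).mpr (Or.inl rfl)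
theorem IsNbrs₄.adj₂ {v a b c d : V} (h : IsNbrs₄ G v a b c d) : G.Adj v b :=
  (h.2 b).mpr (Or.inr (Or.inl rfl))
theorem IsNbrs₄.adj₃ {v a b c d : V} (h : IsNbrs₄ G v a b c d) : G.Adj v c :=
  (h.2 c).mpr (Or.inr (Or.inr (Or.inl rfl)))
theorem IsNbrs₄.adj₄ {v a b c d : V} (h : IsNbrs₄ G v a b c d) : G.Adj v d :=
  (h.2 d).mpr (Or.inr (Or.inr (Or.inr rfl)))

/-- A `2`-neighbour of `v`, with nothing to re-weight. -/
theorem localFix_two {y y' : V} (hw : IsWeighting G w) (hy : IsNbrs₂ G y v y')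
    (h : w s(y, v) + w s(y, y') ≠ A) (h' : w s(y, v) + w s(y, y') ≠ vertexSum G w y') :
    LocalFix G w {y} v A := by
  refine LocalFix.of_proper hw ?_
  rintro p rfl q hpq
  rw [hy.vertexSum_eq]
  rcases (hy.2 q).mp hpq with rfl | rfl
  · rwa [target_self]
  · rwa [target_of_ne hy.1.symm]

/-- Two adjacent `2`-neighbours of `v`; the edge between them is re-weighted. -/
theorem localFix_triangle {x y : V} (hw : IsWeighting G w) (hx : IsNbrs₂ G x v y)
    (hy : IsNbrs₂ G y v x) (hne : w s(x, v) ≠ w s(y, v)) : LocalFix G w {x, y} v A := by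
  have hxv := G.ne_of_adj hx.adj_left
  have hxy := G.ne_of_adj hx.adj_right
  have hyv := G.ne_of_adj hy.adj_left
  obtain ⟨c, hc, hc1, hc2⟩ := exists_avoid₂ (w s(x, v)) A (w s(y, v)) A
  refine LocalFix.of_setEdge (x := x) (y := y) (b := c) (by simp) (by simp)
    (LocalFix.of_proper (hw.setEdge hc) ?_)
  have e1 : vertexSum G (setEdge w x y c) x = w s(x, v) + c := by
    rw [hx.vertexSum_eq, setEdge_self, setEdge_right hxv.symm hyv.symm]
  have e2 : vertexSum G (setEdge w x y c) y = w s(y, v) + c := by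
    rw [hy.vertexSum_eq, setEdge_self', setEdge_right hxv.symm hyv.symm]
  rintro p (rfl | rfl) q hpq
  · rcases (hx.2 q).mp hpq with rfl | rfl
    · rw [e1, target_self]; omega
    · rw [e1, target_of_ne hyv, e2]; omega
  · rcases (hy.2 q).mp hpq with rfl | rfl
    · rw [e2, target_self]; omega
    · rw [e2, target_of_ne hxv, e1]; omega

/-- A `3`-vertex `g` adjacent to `v` and to the `2`-vertex `y`; the edge `s(g, y)` is re-weighted. The
other neighbour `y'` of `y` may be `v` itself, which is why its `target` occurs. -/
theorem localFix_beta {g y z y' : V} (hw : IsWeighting G w) (hg : IsNbrs₃ G g v y z)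
    (hy : IsNbrs₂ G y g y') (hm : w s(g, v) + w s(g, z) ≠ w s(y, y'))
    (h : ∃ b, (1 ≤ b ∧ b ≤ 3) ∧ b + w s(y, y') ≠ target G w v A y' ∧
      w s(g, v) + b + w s(g, z) ≠ vertexSum G w z ∧ w s(g, v) + b + w s(g, z) ≠ A) :
    LocalFix G w {g, y} v A := by
  obtain ⟨b, hb, h1, h2, h3⟩ := h
  have hgv := G.ne_of_adj hg.adj₁
  have hgy := G.ne_of_adj hg.adj₂
  have hgz := G.ne_of_adj hg.adj₃
  have hyy' := G.ne_of_adj hy.adj_right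
  obtain ⟨hvy, hvz, hyz⟩ := hg.1
  have hgy' := hy.1
  refine LocalFix.of_setEdge (x := g) (y := y) (b := b) (by simp) (by simp)
    (LocalFix.of_proper (hw.setEdge hb) ?_)
  have e1 : vertexSum G (setEdge w g y b) g = w s(g, v) + b + w s(g, z) := by
    rw [hg.vertexSum_eq, setEdge_self, setEdge_right hgv.symm hvy,
      setEdge_right hgz.symm hyz.symm]
  have e2 : vertexSum G (setEdge w g y b) y = b + w s(y, y') := by
    rw [hy.vertexSum_eq, setEdge_self', setEdge_right hgy'.symm hyy'.symm]
  rintro p (rfl | rfl) q hpq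
  · rcases (hg.2 q).mp hpq with rfl | rfl | rfl
    · rwa [e1, target_self]
    · rw [e1, target_of_ne hvy.symm, e2]; omega
    · rwa [e1, target_setEdge hgz.symm hyz.symm, target_of_ne hvz.symm]
  · rcases (hy.2 q).mp hpq with rfl | rfl
    · rw [e2, target_of_ne hgv, e1]; omega
    · rwa [e2, target_setEdge hgy'.symm hyy'.symm]

/-- A `γ`-vertex of degree four; the edge to its leaf `x` is re-weighted. -/
theorem localFix_gamma_leaf {g x z₁ z₂ : V} (hw : IsWeighting G w) (hg : IsNbrs₄ G g v x z₁ z₂)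
    (hx : ∀ u, G.Adj x u ↔ u = g)
    (h : ∃ b, (1 ≤ b ∧ b ≤ 3) ∧ w s(g, v) + b + w s(g, z₁) + w s(g, z₂) ≠ vertexSum G w z₁ ∧
      w s(g, v) + b + w s(g, z₁) + w s(g, z₂) ≠ vertexSum G w z₂ ∧
      w s(g, v) + b + w s(g, z₁) + w s(g, z₂) ≠ A) :
    LocalFix G w {g, x} v A := by
  classical
  obtain ⟨b, hb, h1, h2, h3⟩ := h
  have hgv := G.ne_of_adj hg.adj₁
  have hgx := G.ne_of_adj hg.adj₂
  have hgz₁ := G.ne_of_adj hg.adj₃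
  have hgz₂ := G.ne_of_adj hg.adj₄
  obtain ⟨hvx, hvz₁, hvz₂, hxz₁, hxz₂, hz₁z₂⟩ := hg.1
  refine LocalFix.of_setEdge (x := g) (y := x) (b := b) (by simp) (by simp)
    (LocalFix.of_proper (hw.setEdge hb) ?_)
  have e1 : vertexSum G (setEdge w g x b) g = w s(g, v) + b + w s(g, z₁) + w s(g, z₂) := by
    rw [hg.vertexSum_eq, setEdge_self, setEdge_right hgv.symm hvx,
      setEdge_right hgz₁.symm hxz₁.symm, setEdge_right hgz₂.symm hxz₂.symm]
  have e2 : vertexSum G (setEdge w g x b) x = b := by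
    have : nbrs G x = {g} := by ext u; simp [hx]
    rw [vertexSum_eq_sum, this, Finset.sum_singleton, setEdge_self']
  have hpos := hw g v hg.adj₁
  rintro p (rfl | rfl) q hpq
  · rcases (hg.2 q).mp hpq with rfl | rfl | rfl | rfl
    · rwa [e1, target_self]
    · rw [e1, target_of_ne hvx.symm, e2]; omega
    · rwa [e1, target_setEdge hgz₁.symm hxz₁.symm, target_of_ne hvz₁.symm]
    · rwa [e1, target_setEdge hgz₂.symm hxz₂.symm, target_of_ne hvz₂.symm]
  · obtain rfl := (hx q).mp hpq
    rw [e2, target_of_ne hgv, e1]; omega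

/-- A `γ`-vertex with an `α`-neighbour `x`; the edges `s(g, x)` and `s(x, x')` are re-weighted. The latter
adjusts the sums of `x` and `x'` only, so that only the condition `b ≠ w s(x', x'')` remains. -/
theorem localFix_gamma_alpha {g x z x' x'' : V} (hw : IsWeighting G w) (hg : IsNbrs₃ G g v x z)
    (hx : IsNbrs₂ G x g x') (hx' : IsNbrs₂ G x' x x'') (hx'' : x'' ≠ g)
    (h : ∃ b, (1 ≤ b ∧ b ≤ 3) ∧ b ≠ w s(x', x'') ∧
      w s(g, v) + b + w s(g, z) ≠ vertexSum G w z ∧ w s(g, v) + b + w s(g, z) ≠ A) :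
    LocalFix G w {g, x, x'} v A := by
  obtain ⟨b, hb, h1, h2, h3⟩ := h
  obtain ⟨c, hc, hc1, hc2⟩ := exists_avoid₂ 0 (w s(g, v) + w s(g, z))
    (w s(x', x'')) (target G w v A x'')
  have hgv := G.ne_of_adj hg.adj₁
  have hgx := G.ne_of_adj hg.adj₂
  have hgz := G.ne_of_adj hg.adj₃
  have hxx' := G.ne_of_adj hx.adj_right
  have hx'x'' := G.ne_of_adj hx'.adj_right
  obtain ⟨hvx, hvz, hxz⟩ := hg.1
  have hgx' := hx.1
  have hxx'' := hx'.1
  have hnadj : ¬ G.Adj g x' := fun h => by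
    rcases (hx'.2 g).mp h.symm with h | h
    · exact hgx h
    · exact hx'' h.symm
  have hvx' : v ≠ x' := by rintro rfl; exact hnadj hg.adj₁
  have hzx' : z ≠ x' := by rintro rfl; exact hnadj hg.adj₃
  refine LocalFix.of_setEdge (x := g) (y := x) (b := b) (by simp) (by simp) ?_
  refine LocalFix.of_setEdge (x := x) (y := x') (b := c) (by simp) (by simp)
    (LocalFix.of_proper ((hw.setEdge hb).setEdge hc) ?_)
  have e1 : vertexSum G (setEdge (setEdge w g x b) x x' c) g = w s(g, v) + b + w s(g, z) := by
    rw [hg.vertexSum_eq, setEdge_left hgx hgx', setEdge_left hgx hgx', setEdge_left hgx hgx',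
      setEdge_self, setEdge_right hgv.symm hvx, setEdge_right hgz.symm hxz.symm]
  have e2 : vertexSum G (setEdge (setEdge w g x b) x x' c) x = b + c := by
    rw [hx.vertexSum_eq, setEdge_self, setEdge_right hgx hgx', setEdge_self']
  have e3 : vertexSum G (setEdge (setEdge w g x b) x x' c) x' = c + w s(x', x'') := by
    rw [hx'.vertexSum_eq, setEdge_self', setEdge_right hxx''.symm hx'x''.symm,
      setEdge_right hx'' hxx''.symm]
  rintro p (rfl | rfl | rfl) q hpq
  · rcases (hg.2 q).mp hpq with rfl | rfl | rfl
    · rwa [e1, target_self]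
    · rw [e1, target_of_ne hvx.symm, e2]; omega
    · rwa [e1, target_setEdge hxz.symm hzx', target_setEdge hgz.symm hxz.symm,
        target_of_ne hvz.symm]
  · rcases (hx.2 q).mp hpq with rfl | rfl
    · rw [e2, target_of_ne hgv, e1]; omega
    · rw [e2, target_of_ne hvx'.symm, e3]; omega
  · rcases (hx'.2 q).mp hpq with rfl | rfl
    · rw [e3, target_of_ne hvx.symm, e2]; omega
    · rwa [e3, target_setEdge hxx''.symm hx'x''.symm, target_setEdge hx'' hxx''.symm]

/-- A `γ`-vertex with two `2`-neighbours; the edges to both are re-weighted. -/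
theorem localFix_gamma_two {g y₁ y₂ y₁' y₂' : V} (hw : IsWeighting G w)
    (hg : IsNbrs₃ G g v y₁ y₂) (hy₁ : IsNbrs₂ G y₁ g y₁') (hy₂ : IsNbrs₂ G y₂ g y₂')
    (hnadj : ¬ G.Adj y₁ y₂)
    (h : ∃ b₁ b₂, (1 ≤ b₁ ∧ b₁ ≤ 3) ∧ (1 ≤ b₂ ∧ b₂ ≤ 3) ∧
      b₁ + w s(y₁, y₁') ≠ target G w v A y₁' ∧ b₂ + w s(y₂, y₂') ≠ target G w v A y₂' ∧
      w s(g, v) + b₂ ≠ w s(y₁, y₁') ∧ w s(g, v) + b₁ ≠ w s(y₂, y₂') ∧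
      w s(g, v) + b₁ + b₂ ≠ A) :
    LocalFix G w {g, y₁, y₂} v A := by
  obtain ⟨b₁, b₂, hb₁, hb₂, h1, h2, h3, h4, h5⟩ := h
  have hgv := G.ne_of_adj hg.adj₁
  have hgy₁ := G.ne_of_adj hg.adj₂
  have hgy₂ := G.ne_of_adj hg.adj₃
  have hyy₁ := G.ne_of_adj hy₁.adj_right
  have hyy₂ := G.ne_of_adj hy₂.adj_right
  obtain ⟨hvy₁, hvy₂, hy₁y₂⟩ := hg.1
  have hgy₁' := hy₁.1
  have hgy₂' := hy₂.1
  have h12 : y₁' ≠ y₂ := by rintro rfl; exact hnadj hy₁.adj_right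
  have h21 : y₂' ≠ y₁ := by rintro rfl; exact hnadj hy₂.adj_right.symm
  refine LocalFix.of_setEdge (x := g) (y := y₁) (b := b₁) (by simp) (by simp) ?_
  refine LocalFix.of_setEdge (x := g) (y := y₂) (b := b₂) (by simp) (by simp)
    (LocalFix.of_proper ((hw.setEdge hb₁).setEdge hb₂) ?_)
  have e1 : vertexSum G (setEdge (setEdge w g y₁ b₁) g y₂ b₂) g = w s(g, v) + b₁ + b₂ := by
    rw [hg.vertexSum_eq, setEdge_self, setEdge_right hgv.symm hvy₂,
      setEdge_right hgv.symm hvy₁, setEdge_right hgy₁.symm hy₁y₂, setEdge_self]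
  have e2 : vertexSum G (setEdge (setEdge w g y₁ b₁) g y₂ b₂) y₁ = b₁ + w s(y₁, y₁') := by
    rw [hy₁.vertexSum_eq, setEdge_left hgy₁.symm hy₁y₂, setEdge_left hgy₁.symm hy₁y₂,
      setEdge_self', setEdge_right hgy₁'.symm hyy₁.symm]
  have e3 : vertexSum G (setEdge (setEdge w g y₁ b₁) g y₂ b₂) y₂ = b₂ + w s(y₂, y₂') := by
    rw [hy₂.vertexSum_eq, setEdge_self', setEdge_right hgy₂'.symm hyy₂.symm,
      setEdge_right hgy₂'.symm h21]
  rintro p (rfl | rfl | rfl) q hpq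
  · rcases (hg.2 q).mp hpq with rfl | rfl | rfl
    · rwa [e1, target_self]
    · rw [e1, target_of_ne hvy₁.symm, e2]; omega
    · rw [e1, target_of_ne hvy₂.symm, e3]; omega
  · rcases (hy₁.2 q).mp hpq with rfl | rfl
    · rw [e2, target_of_ne hgv, e1]; omega
    · rwa [e2, target_setEdge hgy₁'.symm h12, target_setEdge hgy₁'.symm hyy₁.symm]
  · rcases (hy₂.2 q).mp hpq with rfl | rfl
    · rw [e3, target_of_ne hgv, e1]; omega
    · rwa [e3, target_setEdge hgy₂'.symm hyy₂.symm, target_setEdge hgy₂'.symm h21]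

/-- Two `γ`-neighbours `g` and `h` of `v` in a `5`-cycle `v`, `g`, `x`, `x'`, `h`; the edges on the path from
`g` to `h` are re-weighted. -/
theorem localFix_pair {g h x x' z t : V} (hw : IsWeighting G w) (hg : IsNbrs₃ G g v x z)
    (hx : IsNbrs₂ G x g x') (hx' : IsNbrs₂ G x' x h) (hh : IsNbrs₃ G h v x' t)
    (hne : g ≠ h) (hnadj : ¬ G.Adj g h)
    (hfix : ∃ b₁ b₂, (1 ≤ b₁ ∧ b₁ ≤ 3) ∧ (1 ≤ b₂ ∧ b₂ ≤ 3) ∧ b₁ ≠ b₂ ∧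
      w s(g, v) + b₁ + w s(g, z) ≠ vertexSum G w z ∧ w s(g, v) + b₁ + w s(g, z) ≠ A ∧
      w s(h, v) + b₂ + w s(h, t) ≠ vertexSum G w t ∧ w s(h, v) + b₂ + w s(h, t) ≠ A) :
    LocalFix G w {g, x, x', h} v A := by
  obtain ⟨b₁, b₂, hb₁, hb₂, h1, h2, h3, h4, h5⟩ := hfix
  obtain ⟨c, hc, hc1, hc2⟩ := exists_avoid₂ 0 (w s(g, v) + w s(g, z)) 0 (w s(h, v) + w s(h, t))
  have hgv := G.ne_of_adj hg.adj₁
  have hgx := G.ne_of_adj hg.adj₂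
  have hgz := G.ne_of_adj hg.adj₃
  have hhv := G.ne_of_adj hh.adj₁
  have hhx' := G.ne_of_adj hh.adj₂
  have hht := G.ne_of_adj hh.adj₃
  have hxx' := G.ne_of_adj hx.adj_right
  obtain ⟨hvx, hvz, hxz⟩ := hg.1
  obtain ⟨hvx', hvt, hx't⟩ := hh.1
  have hgx' := hx.1
  have hxh := hx'.1
  have hzh : z ≠ h := by rintro rfl; exact hnadj hg.adj₃
  have htg : t ≠ g := by rintro rfl; exact hnadj hh.adj₃.symm
  have hzx' : z ≠ x' := by
    rintro rfl
    rcases (hx'.2 g).mp hg.adj₃.symm with h | h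
    exacts [hgx h, hne h]
  have htx : t ≠ x := by
    rintro rfl
    rcases (hx.2 h).mp hh.adj₃.symm with h | h
    exacts [hne h.symm, hhx' h]
  refine LocalFix.of_setEdge (x := g) (y := x) (b := b₁) (by simp) (by simp) ?_
  refine LocalFix.of_setEdge (x := h) (y := x') (b := b₂) (by simp) (by simp) ?_
  refine LocalFix.of_setEdge (x := x) (y := x') (b := c) (by simp) (by simp)
    (LocalFix.of_proper (((hw.setEdge hb₁).setEdge hb₂).setEdge hc) ?_)
  set w' := setEdge (setEdge (setEdge w g x b₁) h x' b₂) x x' c with hw'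
  have e1 : vertexSum G w' g = w s(g, v) + b₁ + w s(g, z) := by
    simp only [hg.vertexSum_eq, hw', setEdge_left hgx hgx', setEdge_left hne hgx']
    rw [setEdge_self, setEdge_right hgv.symm hvx, setEdge_right hgz.symm hxz.symm]
  have e2 : vertexSum G w' x = b₁ + c := by
    rw [hx.vertexSum_eq, hw', setEdge_self, setEdge_right hgx hgx', setEdge_right hne hgx',
      setEdge_self']
  have e3 : vertexSum G w' x' = c + b₂ := by
    rw [hx'.vertexSum_eq, hw', setEdge_self', setEdge_right hxh.symm hhx', setEdge_self']
  have e4 : vertexSum G w' h = w s(h, v) + b₂ + w s(h, t) := by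
    rw [hh.vertexSum_eq, hw', setEdge_left hxh.symm hhx', setEdge_left hxh.symm hhx',
      setEdge_left hxh.symm hhx', setEdge_self, setEdge_right hhv.symm hvx',
      setEdge_right hht.symm hx't.symm, setEdge_left hne.symm hxh.symm,
      setEdge_left hne.symm hxh.symm]
  have e5 : target G w' v A z = vertexSum G w z := by
    rw [hw', target_setEdge hxz.symm hzx', target_setEdge hzh hzx',
      target_setEdge hgz.symm hxz.symm, target_of_ne hvz.symm]
  have e6 : target G w' v A t = vertexSum G w t := by
    rw [hw', target_setEdge htx hx't.symm, target_setEdge hht.symm hx't.symm,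
      target_setEdge htg htx, target_of_ne hvt.symm]
  rintro p (rfl | rfl | rfl | rfl) q hpq
  · rcases (hg.2 q).mp hpq with rfl | rfl | rfl
    · rwa [e1, target_self]
    · rw [e1, target_of_ne hvx.symm, e2]; omega
    · rwa [e1, e5]
  · rcases (hx.2 q).mp hpq with rfl | rfl
    · rw [e2, target_of_ne hgv, e1]; omega
    · rw [e2, target_of_ne hvx'.symm, e3]; omega
  · rcases (hx'.2 q).mp hpq with rfl | rfl
    · rw [e3, target_of_ne hvx.symm, e2]; omega
    · rw [e3, target_of_ne hhv, e4]; omega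
  · rcases (hh.2 q).mp hpq with rfl | rfl | rfl
    · rwa [e4, target_self]
    · rw [e4, target_of_ne hvx'.symm, e3]; omega
    · rwa [e4, e6]

/-- A `4`-cycle `v`, `x`, `x'`, `g` with `2`-vertices `x` and `x'`; the edges `s(x, x')` and `s(x', g)` are
re-weighted. -/
theorem localFix_fourCycle {x x' g z : V} (hw : IsWeighting G w) (hx : IsNbrs₂ G x v x')
    (hx' : IsNbrs₂ G x' x g) (hg : IsNbrs₃ G g v x' z)
    (h : ∃ b, (1 ≤ b ∧ b ≤ 3) ∧ b ≠ w s(x, v) ∧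
      w s(g, v) + b + w s(g, z) ≠ vertexSum G w z ∧ w s(g, v) + b + w s(g, z) ≠ A) :
    LocalFix G w {x, x', g} v A := by
  obtain ⟨b, hb, h1, h2, h3⟩ := h
  obtain ⟨c, hc, hc1, hc2⟩ := exists_avoid₂ (w s(x, v)) A 0 (w s(g, v) + w s(g, z))
  have hgv := G.ne_of_adj hg.adj₁
  have hgx' := G.ne_of_adj hg.adj₂
  have hgz := G.ne_of_adj hg.adj₃
  have hxv := G.ne_of_adj hx.adj_left
  have hxx' := G.ne_of_adj hx.adj_right
  obtain ⟨hvx', hvz, hx'z⟩ := hg.1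
  have hxg := hx'.1
  have hzx : z ≠ x := by
    rintro rfl
    rcases (hx.2 g).mp hg.adj₃.symm with h | h
    exacts [hgv h, hgx' h]
  refine LocalFix.of_setEdge (x := g) (y := x') (b := b) (by simp) (by simp) ?_
  refine LocalFix.of_setEdge (x := x) (y := x') (b := c) (by simp) (by simp)
    (LocalFix.of_proper ((hw.setEdge hb).setEdge hc) ?_)
  set w' := setEdge (setEdge w g x' b) x x' c with hw'
  have e1 : vertexSum G w' x = w s(x, v) + c := by
    rw [hx.vertexSum_eq, hw', setEdge_self, setEdge_right hxv.symm hvx',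
      setEdge_right hgv.symm hvx']
  have e2 : vertexSum G w' x' = c + b := by
    rw [hx'.vertexSum_eq, hw', setEdge_self', setEdge_right hxg.symm hgx', setEdge_self']
  have e3 : vertexSum G w' g = w s(g, v) + b + w s(g, z) := by
    rw [hg.vertexSum_eq, hw', setEdge_left hxg.symm hgx', setEdge_left hxg.symm hgx',
      setEdge_left hxg.symm hgx', setEdge_self, setEdge_right hgv.symm hvx',
      setEdge_right hgz.symm hx'z.symm]
  have e4 : target G w' v A z = vertexSum G w z := by
    rw [hw', target_setEdge hzx hx'z.symm, target_setEdge hgz.symm hx'z.symm,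
      target_of_ne hvz.symm]
  rintro p (rfl | rfl | rfl) q hpq
  · rcases (hx.2 q).mp hpq with rfl | rfl
    · rw [e1, target_self]; omega
    · rw [e1, target_of_ne hvx'.symm, e2]; omega
  · rcases (hx'.2 q).mp hpq with rfl | rfl
    · rw [e2, target_of_ne hxv, e1]; omega
    · rw [e2, target_of_ne hgv, e3]; omega
  · rcases (hg.2 q).mp hpq with rfl | rfl | rfl
    · rwa [e3, target_self]
    · rw [e3, target_of_ne hvx'.symm, e2]; omega
    · rwa [e3, e4]

/-- Two neighbours `g` and `h` of `v` with a common `2`-neighbour `y`: if both have weight `3` towards `v`,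
then the edges at `y` can be re-weighted suitably for every sum `A` at `v`. Here `g` and `h` may be
adjacent. -/
theorem localFix_shared {g h y z t : V} (hw : IsWeighting G w) (hg : IsNbrs₃ G g v y z)
    (hh : IsNbrs₃ G h v y t) (hy : IsNbrs₂ G y g h)
    (h1 : w s(g, v) = 3) (h2 : w s(h, v) = 3) :
    LocalFix G w {g, h, y} v A := by
  classical
  have hgv := G.ne_of_adj hg.adj₁
  have hgy := G.ne_of_adj hg.adj₂
  have hgz := G.ne_of_adj hg.adj₃
  have hhv := G.ne_of_adj hh.adj₁
  have hhy := G.ne_of_adj hh.adj₂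
  have hht := G.ne_of_adj hh.adj₃
  obtain ⟨hvy, hvz, hyz⟩ := hg.1
  obtain ⟨-, hvt, hyt⟩ := hh.1
  have hgh := hy.1
  have hpz := hw g z hg.adj₃
  have hpt := hw h t hh.adj₃
  -- the weights 3 make the edges at `y` proper; if `g` and `h` are adjacent, then the sum at `g` is
  -- chosen first and the sum at `h` has to avoid it
  obtain ⟨b, hb, hb1, hb2⟩ := exists_avoid₂ (3 + w s(g, z)) (vertexSum G w z) (3 + w s(g, z)) A
  obtain ⟨b', hb', hb1', hb2'⟩ := exists_avoid₂ (3 + w s(h, t))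
    (if t = g then 3 + b + w s(g, z) else vertexSum G w t) (3 + w s(h, t)) A
  refine LocalFix.of_setEdge (x := g) (y := y) (b := b) (by simp) (by simp) ?_
  refine LocalFix.of_setEdge (x := h) (y := y) (b := b') (by simp) (by simp)
    (LocalFix.of_proper ((hw.setEdge hb).setEdge hb') ?_)
  set w' := setEdge (setEdge w g y b) h y b' with hw'
  have e1 : vertexSum G w' g = 3 + b + w s(g, z) := by
    rw [hg.vertexSum_eq, hw', setEdge_left hgh hgy, setEdge_left hgh hgy, setEdge_left hgh hgy,
      setEdge_self, setEdge_right hgv.symm hvy, setEdge_right hgz.symm hyz.symm, h1]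
  have e2 : vertexSum G w' h = 3 + b' + w s(h, t) := by
    rw [hh.vertexSum_eq, hw', setEdge_self, setEdge_right hhv.symm hvy,
      setEdge_right hht.symm hyt.symm, setEdge_left hgh.symm hhy, setEdge_left hgh.symm hhy, h2]
  have e3 : vertexSum G w' y = b + b' := by
    rw [hy.vertexSum_eq, hw', setEdge_self', setEdge_right hgh hgy, setEdge_self']
  have hzt : z = h ↔ t = g := by
    constructor
    · rintro rfl
      rcases (hh.2 g).mp hg.adj₃.symm with k | k | k
      exacts [absurd k hgv, absurd k hgy, k.symm]
    · rintro rfl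
      rcases (hg.2 h).mp hh.adj₃.symm with k | k | k
      exacts [absurd k hhv, absurd k hhy, k.symm]
  have e4 : z ≠ h → target G w' v A z = vertexSum G w z := fun hzh => by
    rw [hw', target_setEdge hzh hyz.symm, target_setEdge hgz.symm hyz.symm,
      target_of_ne hvz.symm]
  have e5 : t ≠ g → target G w' v A t = vertexSum G w t := fun htg => by
    rw [hw', target_setEdge hht.symm hyt.symm, target_setEdge htg hyt.symm,
      target_of_ne hvt.symm]
  have e6 : 3 + b' + w s(h, t) ≠ if t = g then 3 + b + w s(g, z) else vertexSum G w t := by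
    intro k; apply hb1'; rw [← k]; ring
  rintro p (rfl | rfl | rfl) q hpq
  · rcases (hg.2 q).mp hpq with rfl | rfl | rfl
    · rw [e1, target_self]; omega
    · rw [e1, target_of_ne hvy.symm, e3]; omega
    · rw [e1]
      by_cases hzh : q = h
      · rw [if_pos (hzt.mp hzh)] at e6
        subst hzh
        rw [target_of_ne hhv, e2]
        exact e6.symm
      · rw [e4 hzh]; omega
  · rcases (hh.2 q).mp hpq with rfl | rfl | rfl
    · rw [e2, target_self]; omega
    · rw [e2, target_of_ne hvy.symm, e3]; omega
    · rw [e2]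
      by_cases htg : q = g
      · rw [if_pos htg] at e6
        subst htg
        rwa [target_of_ne hgv, e1]
      · rw [if_neg htg] at e6
        rwa [e5 htg]
  · rcases (hy.2 q).mp hpq with rfl | rfl
    · rw [e3, target_of_ne hgv, e1]; omega
    · rw [e3, target_of_ne hhv, e2]; omega

/-- Two adjacent neighbours `g` and `h` of `v` with different `2`-neighbours `y` and `u`; the edges
`s(g, y)` and `s(h, u)` are re-weighted. -/
theorem localFix_adjacent {g h y u y' u' : V} (hw : IsWeighting G w) (hg : IsNbrs₃ G g v y h)
    (hh : IsNbrs₃ G h v u g) (hy : IsNbrs₂ G y g y') (hu : IsNbrs₂ G u h u') (hyu : y ≠ u)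
    (hnadj : ¬ G.Adj y u) (hy'v : y' ≠ v) (hu'v : u' ≠ v)
    (hm₁ : w s(g, v) + w s(g, h) ≠ w s(y, y')) (hm₂ : w s(h, v) + w s(g, h) ≠ w s(u, u'))
    (hfix : ∃ b₁ b₂, (1 ≤ b₁ ∧ b₁ ≤ 3) ∧ (1 ≤ b₂ ∧ b₂ ≤ 3) ∧
      b₁ + w s(y, y') ≠ vertexSum G w y' ∧ b₂ + w s(u, u') ≠ vertexSum G w u' ∧
      w s(g, v) + b₁ ≠ w s(h, v) + b₂ ∧
      w s(g, v) + b₁ + w s(g, h) ≠ A ∧ w s(h, v) + b₂ + w s(g, h) ≠ A) :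
    LocalFix G w {g, h, y, u} v A := by
  obtain ⟨b₁, b₂, hb₁, hb₂, h1, h2, h3, h4, h5⟩ := hfix
  have hgv := G.ne_of_adj hg.adj₁
  have hgy := G.ne_of_adj hg.adj₂
  have hgh := G.ne_of_adj hg.adj₃
  have hhv := G.ne_of_adj hh.adj₁
  have hhu := G.ne_of_adj hh.adj₂
  have hyy' := G.ne_of_adj hy.adj_right
  have huu' := G.ne_of_adj hu.adj_right
  obtain ⟨hvy, -, hyh⟩ := hg.1
  obtain ⟨hvu, -, hug⟩ := hh.1
  have hgy' := hy.1
  have hhu' := hu.1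
  have hy'u : y' ≠ u := by rintro rfl; exact hnadj hy.adj_right
  have hu'y : u' ≠ y := by rintro rfl; exact hnadj hu.adj_right.symm
  have hy'h : y' ≠ h := by
    rintro rfl
    rcases (hh.2 y).mp hy.adj_right.symm with k | k | k
    exacts [hvy k.symm, hyu k, hgy k.symm]
  have hu'g : u' ≠ g := by
    rintro rfl
    rcases (hg.2 u).mp hu.adj_right.symm with k | k | k
    exacts [hvu k.symm, hyu k.symm, hhu k.symm]
  refine LocalFix.of_setEdge (x := g) (y := y) (b := b₁) (by simp) (by simp) ?_
  refine LocalFix.of_setEdge (x := h) (y := u) (b := b₂) (by simp) (by simp)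
    (LocalFix.of_proper ((hw.setEdge hb₁).setEdge hb₂) ?_)
  set w' := setEdge (setEdge w g y b₁) h u b₂ with hw'
  have e1 : vertexSum G w' g = w s(g, v) + b₁ + w s(g, h) := by
    rw [hg.vertexSum_eq, hw', setEdge_left hgh hug.symm, setEdge_left hgh hug.symm,
      setEdge_left hgh hug.symm, setEdge_self, setEdge_right hgv.symm hvy,
      setEdge_right hgh.symm hyh.symm]
  have e2 : vertexSum G w' h = w s(h, v) + b₂ + w s(g, h) := by
    rw [hh.vertexSum_eq, hw', setEdge_self, setEdge_right hhv.symm hvu,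
      setEdge_right hgh hug.symm, setEdge_left hgh.symm hyh.symm,
      setEdge_left hgh.symm hyh.symm, Sym2.eq_swap (a := g) (b := h)]
  have e3 : vertexSum G w' y = b₁ + w s(y, y') := by
    rw [hy.vertexSum_eq, hw', setEdge_left hyh hyu, setEdge_left hyh hyu, setEdge_self',
      setEdge_right hgy'.symm hyy'.symm]
  have e4 : vertexSum G w' u = b₂ + w s(u, u') := by
    rw [hu.vertexSum_eq, hw', setEdge_self', setEdge_right hhu'.symm huu'.symm,
      setEdge_right hu'g hu'y]
  have e5 : target G w' v A y' = vertexSum G w y' := by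
    rw [hw', target_setEdge hy'h hy'u, target_setEdge hgy'.symm hyy'.symm, target_of_ne hy'v]
  have e6 : target G w' v A u' = vertexSum G w u' := by
    rw [hw', target_setEdge hhu'.symm huu'.symm, target_setEdge hu'g hu'y, target_of_ne hu'v]
  rintro p (rfl | rfl | rfl | rfl) q hpq
  · rcases (hg.2 q).mp hpq with rfl | rfl | rfl
    · rwa [e1, target_self]
    · rw [e1, target_of_ne hvy.symm, e3]; omega
    · rw [e1, target_of_ne hhv, e2]; omega
  · rcases (hh.2 q).mp hpq with rfl | rfl | rfl
    · rwa [e2, target_self]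
    · rw [e2, target_of_ne hvu.symm, e4]; omega
    · rw [e2, target_of_ne hgv, e1]; omega
  · rcases (hy.2 q).mp hpq with rfl | rfl
    · rw [e3, target_of_ne hgv, e1]; omega
    · rwa [e3, e5]
  · rcases (hu.2 q).mp hpq with rfl | rfl
    · rw [e4, target_of_ne hhv, e2]; omega
    · rwa [e4, e6]

end gadgets

/-! ### Small stars -/

/-- `w₁` arises from `w` by giving the edges from `v` to the vertices `s` of `S` the weights `f s`. -/
structure IsStarChange (G : SimpleGraph V) (w w₁ : Sym2 V → ℕ) (v : V) (S : Finset V)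
    (f : V → ℕ) : Prop where
  isWeighting : IsWeighting G w₁
  mem : ∀ s ∈ S, w₁ s(s, v) = f s
  notMem : ∀ u, u ∉ S → w₁ s(u, v) = w s(u, v)
  of_ne : ∀ x y, x ≠ v → y ≠ v → w₁ s(x, y) = w s(x, y)
  sum : ∀ z, z ≠ v → z ∉ S → vertexSum G w₁ z = vertexSum G w z

theorem isStarChange_overwrite {w : Sym2 V → ℕ} {v : V} {S : Finset V} {f : V → ℕ}
    (hw : IsWeighting G w) (hf : ∀ s ∈ S, 1 ≤ f s ∧ f s ≤ 3) :
    IsStarChange G w (overwrite w v S f) v S f where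
  isWeighting := hw.overwrite hf
  mem _ hs := overwrite_mem' hs
  notMem _ hu := overwrite_notMem' hu
  of_ne _ _ hx hy := overwrite_of_ne hx hy
  sum _ hz hzS := vertexSum_overwrite_of_ne hz hzS

/-- The reduction `IsMinimalThreeBad.star`, with the re-weighted star described by `IsStarChange`. The
number `R` is the total weight of the other edges at `v`. -/
theorem IsMinimalThreeBad.star' [DecidableEq V] (hG : IsMinimalThreeBad G) {v : V} {S : Finset V}
    (𝒯 : Set (Set V)) (hne : S.Nonempty) (hS : ∀ s ∈ S, G.Adj v s) (hd : 2 ≤ deg G v)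
    (hv : ∀ T ∈ 𝒯, v ∉ T) (hsep : ∀ T ∈ 𝒯, ∀ T' ∈ 𝒯, T ≠ T' → Separated G T T')
    (hleaf : ∀ s ∈ S, (∃ T ∈ 𝒯, s ∈ T) ∨ deg G s = 1) :
    ∃ w R, IsWeighting G w ∧ R = ∑ u ∈ nbrs G v \ S, w s(v, u) ∧
      ∀ f : V → ℕ, (∀ s ∈ S, 1 ≤ f s ∧ f s ≤ 3) →
      (∀ w₁, IsStarChange G w w₁ v S f → ∀ T ∈ 𝒯, LocalFix G w₁ T v (∑ s ∈ S, f s + R)) →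
      ∃ u, G.Adj v u ∧ u ∉ S ∧ (∀ T ∈ 𝒯, u ∉ T) ∧ vertexSum G w u = ∑ s ∈ S, f s + R := by
  obtain ⟨w, hw, h⟩ := hG.star 𝒯 hne hS hd hv hsep hleaf
  exact ⟨w, _, hw, rfl, fun f hf hT => h f hf (hT _ (isStarChange_overwrite hw hf))⟩

/-- The reduction for a single edge at `v`. -/
theorem IsMinimalThreeBad.star₁ (hG : IsMinimalThreeBad G) {v s : V}
    (𝒯 : Set (Set V)) (hs : G.Adj v s) (hd : 2 ≤ deg G v)
    (hv : ∀ T ∈ 𝒯, v ∉ T) (hsep : ∀ T ∈ 𝒯, ∀ T' ∈ 𝒯, T ≠ T' → Separated G T T')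
    (hleaf : (∃ T ∈ 𝒯, s ∈ T) ∨ deg G s = 1) :
    ∃ w R, IsWeighting G w ∧
      ∀ a, (1 ≤ a ∧ a ≤ 3) →
      (∀ w₁ f, f s = a → IsStarChange G w w₁ v {s} f → ∀ T ∈ 𝒯, LocalFix G w₁ T v (a + R)) →
      ∃ u, G.Adj v u ∧ u ≠ s ∧ (∀ T ∈ 𝒯, u ∉ T) ∧ vertexSum G w u = a + R := by
  classical
  obtain ⟨w, R, hw, -, h⟩ := hG.star' (S := {s}) 𝒯 (by simp) (by simpa) hd hv hsep (by simpa)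
  refine ⟨w, R, hw, fun a ha hT => ?_⟩
  have := h (fun _ => a) (by simpa) (fun w₁ h₁ => by simpa using hT w₁ _ rfl h₁)
  simpa using this

/-- The reduction for two edges at `v`. -/
theorem IsMinimalThreeBad.star₂ [DecidableEq V] (hG : IsMinimalThreeBad G) {v s t : V}
    (𝒯 : Set (Set V)) (hst : s ≠ t) (hs : G.Adj v s) (ht : G.Adj v t)
    (hv : ∀ T ∈ 𝒯, v ∉ T) (hsep : ∀ T ∈ 𝒯, ∀ T' ∈ 𝒯, T ≠ T' → Separated G T T')
    (hleaf : (∃ T ∈ 𝒯, s ∈ T) ∨ deg G s = 1) (hleaf' : (∃ T ∈ 𝒯, t ∈ T) ∨ deg G t = 1) :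
    ∃ w R, IsWeighting G w ∧ (∀ u, G.Adj v u → u ≠ s → u ≠ t → 1 ≤ R) ∧
      ∀ a b, (1 ≤ a ∧ a ≤ 3) → (1 ≤ b ∧ b ≤ 3) →
      (∀ w₁ f, f s = a → f t = b → IsStarChange G w w₁ v {s, t} f →
        ∀ T ∈ 𝒯, LocalFix G w₁ T v (a + b + R)) →
      ∃ u, G.Adj v u ∧ u ≠ s ∧ u ≠ t ∧ (∀ T ∈ 𝒯, u ∉ T) ∧ vertexSum G w u = a + b + R := by
  have hd : 2 ≤ deg G v := by
    rw [deg_eq_card, ← Finset.card_pair hst]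
    refine Finset.card_le_card fun u hu => ?_
    simp only [Finset.mem_insert, Finset.mem_singleton] at hu
    rcases hu with rfl | rfl <;> simpa
  obtain ⟨w, R, hw, hR, h⟩ := hG.star' (S := {s, t}) 𝒯 (by simp) (by simp [hs, ht]) hd hv hsep
    (by simp [hleaf, hleaf'])
  refine ⟨w, R, hw, fun u hu hus hut => ?_, fun a b ha hb hT => ?_⟩
  · have hu' : u ∈ nbrs G v \ {s, t} := by simp [hu, hus, hut]
    rw [hR]
    exact (hw v u hu).1.trans
      (Finset.single_le_sum (f := fun u => w s(v, u)) (fun _ _ => Nat.zero_le _) hu')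
  have hs' : ∑ x ∈ ({s, t} : Finset V), (if x = s then a else b) = a + b := by
    rw [Finset.sum_pair hst, if_pos rfl, if_neg hst.symm]
  have := h (fun x => if x = s then a else b) (by simp [ha, hst.symm, hb])
    (fun w₁ h₁ => by
      rw [hs']
      exact hT w₁ (fun x => if x = s then a else b) (if_pos rfl) (if_neg hst.symm) h₁)
  rw [hs'] at this
  simpa [and_assoc] using this

/-- The reduction for three edges at `v`. -/
theorem IsMinimalThreeBad.star₃ [DecidableEq V] (hG : IsMinimalThreeBad G) {v s t r : V}
    (𝒯 : Set (Set V)) (hst : s ≠ t) (hsr : s ≠ r) (htr : t ≠ r)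
    (hs : G.Adj v s) (ht : G.Adj v t) (hr : G.Adj v r)
    (hv : ∀ T ∈ 𝒯, v ∉ T) (hsep : ∀ T ∈ 𝒯, ∀ T' ∈ 𝒯, T ≠ T' → Separated G T T')
    (hleaf : (∃ T ∈ 𝒯, s ∈ T) ∨ deg G s = 1) (hleaf' : (∃ T ∈ 𝒯, t ∈ T) ∨ deg G t = 1)
    (hleaf'' : (∃ T ∈ 𝒯, r ∈ T) ∨ deg G r = 1) :
    ∃ w R, IsWeighting G w ∧ (∀ u, G.Adj v u → u ≠ s → u ≠ t → u ≠ r → 1 ≤ R) ∧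
      ((∀ u, G.Adj v u → u = s ∨ u = t ∨ u = r) → R = 0) ∧
      ∀ a b c, (1 ≤ a ∧ a ≤ 3) → (1 ≤ b ∧ b ≤ 3) → (1 ≤ c ∧ c ≤ 3) →
      (∀ w₁ f, f s = a → f t = b → f r = c → IsStarChange G w w₁ v {s, t, r} f →
        ∀ T ∈ 𝒯, LocalFix G w₁ T v (a + b + c + R)) →
      ∃ u, G.Adj v u ∧ u ≠ s ∧ u ≠ t ∧ u ≠ r ∧ (∀ T ∈ 𝒯, u ∉ T) ∧
        vertexSum G w u = a + b + c + R := by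
  have hd : 2 ≤ deg G v := by
    rw [deg_eq_card, ← Finset.card_pair hst]
    refine Finset.card_le_card fun u hu => ?_
    simp only [Finset.mem_insert, Finset.mem_singleton] at hu
    rcases hu with rfl | rfl <;> simpa
  obtain ⟨w, R, hw, hR, h⟩ := hG.star' (S := {s, t, r}) 𝒯 (by simp) (by simp [hs, ht, hr]) hd hv
    hsep (by simp [hleaf, hleaf', hleaf''])
  refine ⟨w, R, hw, fun u hu hus hut hur => ?_, fun hall => ?_, fun a b c ha hb hc hT => ?_⟩
  · have hu' : u ∈ nbrs G v \ {s, t, r} := by simp [hu, hus, hut, hur]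
    rw [hR]
    exact (hw v u hu).1.trans
      (Finset.single_le_sum (f := fun u => w s(v, u)) (fun _ _ => Nat.zero_le _) hu')
  · have : nbrs G v \ {s, t, r} = ∅ := by
      rw [Finset.sdiff_eq_empty_iff_subset]
      intro u hu
      simpa using hall u (by simpa using hu)
    rw [hR, this, Finset.sum_empty]
  let f : V → ℕ := fun x => if x = s then a else if x = t then b else c
  have hfs : f s = a := if_pos rfl
  have hft : f t = b := by simp [f, hst.symm]
  have hfr : f r = c := by simp [f, hsr.symm, htr.symm]
  have hs' : ∑ x ∈ ({s, t, r} : Finset V), f x = a + b + c := by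
    rw [Finset.sum_insert (by simp [hst, hsr]), Finset.sum_pair htr, hfs, hft, hfr, add_assoc]
  have := h f (by simp [hfs, hft, hfr, ha, hb, hc])
    (fun w₁ h₁ => by rw [hs']; exact hT w₁ f hfs hft hfr h₁)
  rw [hs'] at this
  simpa [and_assoc] using this

theorem sep_empty : ∀ T ∈ (∅ : Set (Set V)), ∀ T' ∈ (∅ : Set (Set V)), T ≠ T' → Separated G T T' := by
  simp

theorem sep_singleton (T₀ : Set V) :
    ∀ T ∈ ({T₀} : Set (Set V)), ∀ T' ∈ ({T₀} : Set (Set V)), T ≠ T' → Separated G T T' := by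
  rintro _ rfl _ rfl h
  exact absurd rfl h

theorem sep_pair {T₁ T₂ : Set V} (h : Separated G T₁ T₂) :
    ∀ T ∈ ({T₁, T₂} : Set (Set V)), ∀ T' ∈ ({T₁, T₂} : Set (Set V)), T ≠ T' →
      Separated G T T' := by
  rintro _ (rfl | rfl) _ (rfl | rfl) hne
  exacts [absurd rfl hne, h, h.symm, absurd rfl hne]

theorem sep_triple {T₁ T₂ T₃ : Set V} (h₁₂ : Separated G T₁ T₂) (h₁₃ : Separated G T₁ T₃)
    (h₂₃ : Separated G T₂ T₃) :
    ∀ T ∈ ({T₁, T₂, T₃} : Set (Set V)), ∀ T' ∈ ({T₁, T₂, T₃} : Set (Set V)), T ≠ T' →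
      Separated G T T' := by
  rintro _ (rfl | rfl | rfl) _ (rfl | rfl | rfl) hne
  exacts [absurd rfl hne, h₁₂, h₁₃, h₁₂.symm, absurd rfl hne, h₂₃, h₁₃.symm, h₂₃.symm,
    absurd rfl hne]

/-! ### Vertices with a leaf -/

theorem IsMinimalThreeBad.not_configA (hG : IsMinimalThreeBad G) : ¬ ConfigA G := by
  rintro ⟨v, hv, x, hvx, hx⟩
  have hd : 2 ≤ deg G v := by omega
  obtain ⟨w, R, -, h⟩ := hG.star₁ (v := v) (s := x) ∅ hvx hd (by simp) sep_empty (Or.inr hx)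
  -- each weight of the leaf edge is blocked by a different neighbour, so `v` has degree at least four
  obtain ⟨u₁, hu₁, hx₁, -, h₁⟩ := h 1 (by omega) (by simp)
  obtain ⟨u₂, hu₂, hx₂, -, h₂⟩ := h 2 (by omega) (by simp)
  obtain ⟨u₃, hu₃, hx₃, -, h₃⟩ := h 3 (by omega) (by simp)
  have h12 : u₁ ≠ u₂ := by rintro rfl; omega
  have h13 : u₁ ≠ u₃ := by rintro rfl; omega
  have h23 : u₂ ≠ u₃ := by rintro rfl; omega
  classical
  have : ({x, u₁, u₂, u₃} : Finset V).card ≤ (nbrs G v).card := by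
    refine Finset.card_le_card fun u hu => ?_
    simp only [Finset.mem_insert, Finset.mem_singleton] at hu
    rcases hu with rfl | rfl | rfl | rfl <;> simpa
  rw [← deg_eq_card, Finset.card_insert_of_notMem (by simp [hx₁.symm, hx₂.symm, hx₃.symm]),
    Finset.card_insert_of_notMem (by simp [h12, h13]), Finset.card_pair h23] at this
  omega

/-! ### Vertices all of whose neighbours are `2`-vertices, and vertices of large degree -/

theorem exists_pair_avoid (m k : ℕ) :
    ∃ lo hi, (1 ≤ lo ∧ lo < hi ∧ hi ≤ 3) ∧ lo + m ≠ k ∧ hi + m ≠ k := by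
  by_contra! h
  have h1 := h 1 2
  have h2 := h 1 3
  have h3 := h 2 3
  omega

/-- The weights of the edges from `v` to its `2`-neighbours can be moved one after another from
`lo` to `hi` without ever violating the constraints at the other ends. If two `2`-neighbours are
adjacent, then their weights must differ; the one that is moved first uses `{2, 3}`, the other one
`{1, 2}`. -/
theorem exists_chain (w : Sym2 V → ℕ) {v : V} {Y : Finset V} {o : V → V}
    (ho : ∀ y ∈ Y, IsNbrs₂ G y v (o y)) (hY : ∀ y ∈ Y, G.Adj v y) :
    ∃ lo hi r : V → ℕ, Function.Injective r ∧ (∀ y ∈ Y, 1 ≤ lo y ∧ lo y < hi y ∧ hi y ≤ 3) ∧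
      ∀ t : ℕ, (∀ y ∈ Y, o y ∈ Y →
          (if r y < t then hi y else lo y) ≠ (if r (o y) < t then hi (o y) else lo (o y))) ∧
        ∀ y ∈ Y, o y ∉ Y →
          (if r y < t then hi y else lo y) + w s(y, o y) ≠ vertexSum G w (o y) := by
  classical
  have hoo : ∀ y ∈ Y, o y ∈ Y → o (o y) = y := by
    intro y hy hoy
    rcases ((ho _ hoy).2 y).mp (ho y hy).adj_right.symm with h | h
    · exact absurd (hY y hy) (by rw [h]; exact G.loopless.irrefl v)
    · exact h.symm
  let r : V → ℕ := fun v => (Fintype.equivFin V v : ℕ)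
  have hr : Function.Injective r := fun a b h => (Fintype.equivFin V).injective (Fin.ext h)
  choose lo₀ hi₀ h₀ h₁ h₂ using fun y => exists_pair_avoid (w s(y, o y)) (vertexSum G w (o y))
  refine ⟨fun y => if o y ∈ Y then (if r y < r (o y) then 2 else 1) else lo₀ y,
    fun y => if o y ∈ Y then (if r y < r (o y) then 3 else 2) else hi₀ y, r, hr, ?_, ?_⟩
  · intro y hy
    by_cases h : o y ∈ Y
    · by_cases h' : r y < r (o y) <;> simp [h, h']
    · simpa [h] using h₀ y
  · refine fun t => ⟨fun y hy hoy => ?_, fun y hy hoy => ?_⟩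
    · have hne : r y ≠ r (o y) := fun k => G.ne_of_adj (ho y hy).adj_right (hr k)
      simp only [hoo y hy hoy, hoy, hy, if_true]
      split_ifs <;> omega
    · simp only [hoy, if_false]
      split_ifs
      · exact h₂ y
      · exact h₁ y

/-- The star at `v` formed by the edges to a set `X` of leaves and to the set `Y` of all
`2`-neighbours, with the weights moving along the chain of `exists_chain`. -/
theorem IsMinimalThreeBad.chain_star [DecidableEq V] (hG : IsMinimalThreeBad G) {v : V}
    {X Y : Finset V} (hd : 2 ≤ deg G v) (hX : ∀ x ∈ X, G.Adj v x ∧ deg G x = 1)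
    (hY : ∀ y, y ∈ Y ↔ G.Adj v y ∧ deg G y = 2) (hne : (X ∪ Y).Nonempty) :
    ∃ (w : Sym2 V → ℕ) (R : ℕ) (lo hi r : V → ℕ), (nbrs G v \ (X ∪ Y)).card ≤ R ∧
      Function.Injective r ∧
      (∀ y ∈ Y, 1 ≤ lo y ∧ lo y < hi y ∧ hi y ≤ 3) ∧
      ∀ (t : ℕ) (g : V → ℕ), (∀ x ∈ X, 1 ≤ g x ∧ g x ≤ 3) →
        (∀ y ∈ Y, 4 + (if r y < t then hi y else lo y) ≤
          ∑ x ∈ X, g x + ∑ y ∈ Y, (if r y < t then hi y else lo y) + R) →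
        ∃ u ∈ nbrs G v \ (X ∪ Y), vertexSum G w u =
          ∑ x ∈ X, g x + ∑ y ∈ Y, (if r y < t then hi y else lo y) + R := by
  classical
  have hXY : Disjoint X Y := by
    rw [Finset.disjoint_left]
    intro x hx hy
    have := (hX x hx).2
    have := ((hY x).mp hy).2
    omega
  have hoex : ∀ y, ∃ o, y ∈ Y → IsNbrs₂ G y v o := by
    intro y
    by_cases hy : y ∈ Y
    · obtain ⟨o, ho⟩ := exists_nbrs₂ ((hY y).mp hy).2 ((hY y).mp hy).1.symm
      exact ⟨o, fun _ => ho⟩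
    · exact ⟨y, fun h => absurd h hy⟩
  choose o ho using hoex
  have hYv : ∀ y ∈ Y, G.Adj v y := fun y hy => ((hY y).mp hy).1
  have hoo : ∀ y ∈ Y, o y ∈ Y → o (o y) = y := by
    intro y hy hoy
    rcases ((ho _ hoy).2 y).mp (ho y hy).adj_right.symm with h | h
    · exact absurd (hYv y hy) (by rw [h]; exact G.loopless.irrefl v)
    · exact h.symm
  let T : V → Set V := fun y => if o y ∈ Y then {y, o y} else {y}
  have hTmem : ∀ y ∈ Y, ∀ z ∈ T y, z ∈ Y ∧ T z = T y := by
    intro y hy z hz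
    by_cases h : o y ∈ Y
    · simp only [T, h, if_true] at hz
      rcases hz with rfl | rfl
      · exact ⟨hy, rfl⟩
      · refine ⟨h, ?_⟩
        simp only [T, h, hoo y hy h, hy, if_true]
        exact Set.pair_comm _ _
    · simp only [T, h, if_false] at hz
      rw [hz]
      exact ⟨hy, rfl⟩
  have hself : ∀ y, y ∈ T y := by
    intro y
    by_cases h : o y ∈ Y <;> simp [T, h]
  have hsep : ∀ S ∈ T '' Y, ∀ S' ∈ T '' Y, S ≠ S' → Separated G S S' := by
    rintro _ ⟨y, hy, rfl⟩ _ ⟨z, hz, rfl⟩ hne a ha b hb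
    obtain ⟨haY, haT⟩ := hTmem y hy a ha
    obtain ⟨hbY, hbT⟩ := hTmem z hz b hb
    rw [← haT, ← hbT] at hne
    refine ⟨fun h => hne (by rw [h]), fun h => hne ?_⟩
    have hoa : o a = b := by
      rcases ((ho a haY).2 b).mp h with k | k
      · exact absurd (hYv b hbY) (by rw [k]; exact G.loopless.irrefl v)
      · exact k.symm
    have hob : o b = a := by rw [← hoa]; exact hoo a haY (hoa ▸ hbY)
    simp only [T, hoa, hob, haY, hbY, if_true]
    exact Set.pair_comm _ _
  obtain ⟨w, R, hw, hR, hstar⟩ := hG.star' (v := v) (S := X ∪ Y) (T '' Y) hne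
    (fun s hs => (Finset.mem_union.mp hs).elim (fun h => (hX s h).1) (fun h => hYv s h)) hd
    (by
      rintro _ ⟨y, hy, rfl⟩ hv
      exact G.loopless.irrefl v (hYv v (hTmem y hy v hv).1)) hsep
    (fun s hs => (Finset.mem_union.mp hs).elim (fun h => Or.inr (hX s h).2)
      (fun h => Or.inl ⟨T s, ⟨s, h, rfl⟩, hself s⟩))
  obtain ⟨lo, hi, r, hr, hb, hchain⟩ := exists_chain w ho hYv
  refine ⟨w, R, lo, hi, r, ?_, hr, hb, fun t g hg hA => ?_⟩
  · rw [hR, Finset.card_eq_sum_ones]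
    exact Finset.sum_le_sum fun u hu => (hw v u (by simpa using (Finset.mem_sdiff.mp hu).1)).1
  let f : V → ℕ := fun s => if s ∈ Y then (if r s < t then hi s else lo s) else g s
  have hfY : ∀ y ∈ Y, f y = if r y < t then hi y else lo y := fun y hy => if_pos hy
  have hfX : ∀ x ∈ X, f x = g x := fun x hx => if_neg (Finset.disjoint_left.mp hXY hx)
  have hsum : ∑ s ∈ X ∪ Y, f s + R =
      ∑ x ∈ X, g x + ∑ y ∈ Y, (if r y < t then hi y else lo y) + R := by
    rw [Finset.sum_union hXY, Finset.sum_congr rfl hfX, Finset.sum_congr rfl hfY]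
  have hfb : ∀ s ∈ X ∪ Y, 1 ≤ f s ∧ f s ≤ 3 := by
    intro s hs
    rcases Finset.mem_union.mp hs with h | h
    · rw [hfX s h]; exact hg s h
    · rw [hfY s h]
      have := hb s h
      split_ifs <;> omega
  obtain ⟨u, hu, huS, -, hsu⟩ := hstar f hfb (by
    rintro w₁ h₁ _ ⟨y, hy, rfl⟩
    rw [hsum]
    have hyS : y ∈ X ∪ Y := Finset.mem_union_right _ hy
    have h1 := h₁.mem y hyS
    have h1' := hfY y hy
    have hyv := (G.ne_of_adj (hYv y hy)).symm
    have hyo : o y ≠ v := (ho y hy).1.symm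
    by_cases hoy : o y ∈ Y
    · simp only [T, hoy, if_true]
      have hoyn := ho _ hoy
      rw [hoo y hy hoy] at hoyn
      refine localFix_triangle h₁.isWeighting (ho y hy) hoyn ?_
      rw [h1, h1', h₁.mem _ (Finset.mem_union_right _ hoy), hfY _ hoy]
      exact (hchain t).1 y hy hoy
    · simp only [T, hoy, if_false]
      have hoX : o y ∉ X := by
        intro h
        have := exists_adj_of_deg_eq_one (hX _ h).2 (hX _ h).1.symm
        exact hyv ((this y).mp (ho y hy).adj_right.symm)
      have hle := h₁.isWeighting _ _ (ho y hy).adj_right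
      have hne := (hchain t).2 y hy hoy
      have hA' := hA y hy
      refine localFix_two h₁.isWeighting (ho y hy) ?_ ?_
      · rw [h1, h1']; omega
      · rw [h1, h1', h₁.of_ne _ _ hyv hyo, h₁.sum _ hyo (by simp [hoX, hoy])]
        exact hne)
  exact ⟨u, by simp only [Finset.mem_sdiff, mem_nbrs]; exact ⟨hu, huS⟩, by rw [hsu, hsum]⟩

theorem IsMinimalThreeBad.not_configB (hG : IsMinimalThreeBad G) : ¬ ConfigB G := by
  classical
  rintro ⟨v, hv4, hv⟩
  have h0 := hG.deg_ne_zero v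
  have hnb : ∃ a, G.Adj v a := by
    rw [deg_eq_card] at h0
    obtain ⟨a, ha⟩ := Finset.card_pos.mp (Nat.pos_of_ne_zero h0)
    exact ⟨a, by simpa using ha⟩
  obtain ⟨a, ha⟩ := hnb
  have h1 : deg G v ≠ 1 := fun h1 => hG.not_configA ⟨a, Or.inl (hv a ha), v, ha.symm, h1⟩
  by_cases h2 : deg G v = 2
  · obtain ⟨b, hab⟩ := exists_nbrs₂ h2 ha
    have hb := hab.adj_right
    obtain ⟨a', ha'⟩ := exists_nbrs₂ (hv a ha) ha.symm
    obtain ⟨b', hb'⟩ := exists_nbrs₂ (hv b hb) hb.symm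
    have hnone : ∀ u, G.Adj v u → u ≠ a → u ≠ b → False := fun u hu h h' =>
      ((hab.2 u).mp hu).elim h h'
    have hav := G.ne_of_adj ha
    have hbv := G.ne_of_adj hb
    by_cases hadj : G.Adj a b
    · have hb₁ : a' = b := by
        rcases (ha'.2 b).mp hadj with h | h
        exacts [absurd h hbv.symm, h.symm]
      have ha₁ : b' = a := by
        rcases (hb'.2 a).mp hadj.symm with h | h
        exacts [absurd h hav.symm, h.symm]
      subst hb₁ ha₁
      obtain ⟨w, R, hw, -, h⟩ := hG.star₂ (v := v) (s := b') (t := a') {{b', a'}} hab.1 ha hb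
        (by simp [hav, hbv]) (sep_singleton _) (Or.inl ⟨_, rfl, by simp⟩)
        (Or.inl ⟨_, rfl, by simp⟩)
      obtain ⟨u, hu, hua, hub, -⟩ := h 1 2 (by omega) (by omega) (by
        rintro w₁ f h1 h2 h₁ _ rfl
        refine localFix_triangle h₁.isWeighting ha' hb' ?_
        rw [h₁.mem _ (by simp), h₁.mem _ (by simp), h1, h2]
        omega)
      exact hnone u hu hua hub
    · have hsep : Separated G {a} {b} := by
        rintro _ rfl _ rfl
        exact ⟨hab.1, hadj⟩
      obtain ⟨w, R, hw, -, h⟩ := hG.star₂ (v := v) (s := a) (t := b) {{a}, {b}} hab.1 ha hb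
        (by simp [hav, hbv]) (sep_pair hsep) (Or.inl ⟨{a}, by simp⟩)
        (Or.inl ⟨{b}, by simp⟩)
      obtain ⟨s, hs, hs1, hs2⟩ := exists_avoid₂ (w s(a, a')) (vertexSum G w a') R (w s(b, b'))
      obtain ⟨t, ht, ht1, ht2⟩ := exists_avoid₂ (w s(b, b')) (vertexSum G w b') R (w s(a, a'))
      have haa' : a' ≠ a := (G.ne_of_adj ha'.adj_right).symm
      have hbb' : b' ≠ b := (G.ne_of_adj hb'.adj_right).symm
      have hab' : a' ≠ b := by rintro rfl; exact hadj ha'.adj_right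
      have hba' : b' ≠ a := by rintro rfl; exact hadj hb'.adj_right.symm
      obtain ⟨u, hu, hua, hub, -⟩ := h s t hs ht (by
        rintro w₁ f h1 h2 h₁ _ (rfl | rfl)
        · refine localFix_two h₁.isWeighting ha' ?_ ?_
          · rw [h₁.mem _ (by simp), h₁.of_ne _ _ hav.symm ha'.1.symm, h1]; omega
          · rw [h₁.mem _ (by simp), h₁.of_ne _ _ hav.symm ha'.1.symm, h1,
              h₁.sum _ ha'.1.symm (by simp [haa', hab'])]
            exact hs1
        · refine localFix_two h₁.isWeighting hb' ?_ ?_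
          · rw [h₁.mem _ (by simp), h₁.of_ne _ _ hbv.symm hb'.1.symm, h2]; omega
          · rw [h₁.mem _ (by simp), h₁.of_ne _ _ hbv.symm hb'.1.symm, h2,
              h₁.sum _ hb'.1.symm (by simp [hbb', hba'])]
            exact ht1)
      exact hnone u hu hua hub
  · have hd : 3 ≤ (nbrs G v).card := by rw [← deg_eq_card]; omega
    obtain ⟨w, R, lo, hi, r, -, -, hb, h⟩ := hG.chain_star (v := v) (X := ∅) (Y := nbrs G v)
      (by omega) (by simp) (fun y => by rw [mem_nbrs]; exact ⟨fun h => ⟨h, hv y h⟩, fun h => h.1⟩)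
      ⟨a, by simpa using ha⟩
    -- with the larger weights everywhere, the sum at `v` exceeds the sums at its neighbours, and no
    -- neighbour of `v` is left untouched
    have hmax : ∃ t, ∀ u, r u < t :=
      ⟨∑ u, r u + 1, fun u => Nat.lt_succ_of_le
        (Finset.single_le_sum (fun _ _ => Nat.zero_le _) (Finset.mem_univ u))⟩
    obtain ⟨t, ht⟩ := hmax
    obtain ⟨u, hu, -⟩ := h t (fun _ => 1) (by simp) (fun y hy => by
      simp only [ht, if_true, Finset.sum_empty]
      rw [← Finset.add_sum_erase _ _ hy]
      have hc := Finset.card_erase_of_mem hy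
      have : ((nbrs G v).erase y).card • 2 ≤ ∑ z ∈ (nbrs G v).erase y, hi z :=
        Finset.card_nsmul_le_sum _ _ _ fun z hz => by
          have := hb z (Finset.mem_of_mem_erase hz)
          omega
      rw [smul_eq_mul] at this
      omega)
    simp at hu

theorem exists_sum_eq (X : Finset V) (n : ℕ) (h₁ : X.card ≤ n) (h₂ : n ≤ 3 * X.card) :
    ∃ g : V → ℕ, (∀ x ∈ X, 1 ≤ g x ∧ g x ≤ 3) ∧ ∑ x ∈ X, g x = n := by
  classical
  induction X using Finset.induction_on generalizing n with
  | empty => exact ⟨fun _ => 0, by simp, by simp at h₂ ⊢; omega⟩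
  | insert a X ha ih =>
    rw [Finset.card_insert_of_notMem ha] at h₁ h₂
    obtain ⟨k, hk, hk₁, hk₂⟩ : ∃ k, (1 ≤ k ∧ k ≤ 3) ∧ X.card + k ≤ n ∧ n ≤ 3 * X.card + k := by
      rcases Nat.lt_or_ge (X.card + 3) n with h | h
      · exact ⟨3, by omega⟩
      · exact ⟨n - X.card, by omega⟩
    obtain ⟨g, hg, hs⟩ := ih (n - k) (by omega) (by omega)
    refine ⟨Function.update g a k, ?_, ?_⟩
    · intro x hx
      by_cases hxa : x = a
      · subst hxa; simpa using hk
      · rw [Function.update_of_ne hxa]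
        exact hg x ((Finset.mem_insert.mp hx).resolve_left hxa)
    · rw [Finset.sum_insert ha, Function.update_self,
        Finset.sum_congr rfl (g := g) fun x hx => Function.update_of_ne (by
          rintro rfl; exact ha hx) _ _, hs]
      omega

open scoped Pointwise in
theorem IsMinimalThreeBad.not_configE (hG : IsMinimalThreeBad G) : ¬ ConfigE G := by
  classical
  rintro ⟨v, hv, hle⟩
  set X := (nbrs G v).filter (fun x => deg G x = 1) with hX
  set Y := (nbrs G v).filter (fun x => deg G x = 2) with hY
  have hXc : numNbrs G v (fun x => deg G x = 1) = X.card := by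
    rw [numNbrs, nbrs_eq_neighborFinset]
    congr
  have hYc : numNbrs G v (fun x => deg G x = 2) = Y.card := by
    rw [numNbrs, nbrs_eq_neighborFinset]
    congr
  rw [hXc, hYc] at hle
  have hXY : Disjoint X Y := by
    rw [Finset.disjoint_left]
    intro x hx hy
    have := (Finset.mem_filter.mp hx).2
    have := (Finset.mem_filter.mp hy).2
    omega
  have hcard : (nbrs G v \ (X ∪ Y)).card + X.card + Y.card = deg G v := by
    have hsub : X ∪ Y ⊆ nbrs G v :=
      Finset.union_subset (Finset.filter_subset _ _) (Finset.filter_subset _ _)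
    have := Finset.card_sdiff_add_card_eq_card hsub
    rw [Finset.card_union_of_disjoint hXY] at this
    rw [deg_eq_card]
    omega
  obtain ⟨w, R, lo, hi, r, hR, hr, hb, h⟩ := hG.chain_star (v := v) (X := X) (Y := Y) (by omega)
    (by simp [hX]) (by simp [hY]) (by
      rw [← Finset.card_pos, Finset.card_union_of_disjoint hXY]
      omega)
  let Φ : ℕ → ℕ := fun t => ∑ y ∈ Y, (if r y < t then hi y else lo y)
  let D : Finset ℕ := insert 0 (Y.image fun y => r y + 1)
  have hD : D.card = Y.card + 1 := by
    rw [Finset.card_insert_of_notMem (by simp), Finset.card_image_of_injective _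
      (fun a b hab => hr (by simpa using hab))]
  have hΦ : StrictMonoOn Φ D := by
    intro t _ t' ht' htt'
    have ht'' : t' ∈ D := ht'
    rcases Finset.mem_insert.mp ht'' with rfl | ht''
    · omega
    obtain ⟨y, hy, rfl⟩ := Finset.mem_image.mp ht''
    refine Finset.sum_lt_sum (fun z hz => ?_) ⟨y, hy, ?_⟩
    · have := hb z hz
      split_ifs <;> omega
    · have := hb y hy
      split_ifs <;> omega
  -- the leaves realize `2|X| + 1` sums and the chain realizes `|Y| + 1` sums, so together they realize
  -- at least `2|X| + |Y| + 1`, more than the number of untouched neighbours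
  have hcd := cauchy_davenport_add_of_linearOrder_isCancelAdd (s := Finset.Icc X.card (3 * X.card))
    (t := D.image Φ) ⟨X.card, by simp; omega⟩ ⟨Φ 0, Finset.mem_image_of_mem _ (by simp [D])⟩
  rw [Finset.card_image_of_injOn hΦ.injOn, hD, Nat.card_Icc] at hcd
  obtain ⟨a, ha, haM⟩ := Finset.exists_mem_notMem_of_card_lt_card
    (s := (nbrs G v \ (X ∪ Y)).image (fun u => vertexSum G w u))
    (t := (Finset.Icc X.card (3 * X.card) + D.image Φ).image (· + R)) (by
      refine Finset.card_image_le.trans_lt ?_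
      rw [Finset.card_image_of_injective _ (add_left_injective R)]
      omega)
  obtain ⟨b, hb', rfl⟩ := Finset.mem_image.mp ha
  obtain ⟨n, hn, m, hm, rfl⟩ := Finset.mem_add.mp hb'
  obtain ⟨t, -, rfl⟩ := Finset.mem_image.mp hm
  rw [Finset.mem_Icc] at hn
  obtain ⟨g, hg, rfl⟩ := exists_sum_eq X n hn.1 hn.2
  obtain ⟨u, hu, hsu⟩ := h t g hg (fun y hy => by
    have h1 : X.card ≤ ∑ x ∈ X, g x := by
      rw [Finset.card_eq_sum_ones]
      exact Finset.sum_le_sum fun x hx => (hg x hx).1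
    have h2 : (Y.erase y).card ≤ ∑ z ∈ Y.erase y, (if r z < t then hi z else lo z) := by
      rw [Finset.card_eq_sum_ones]
      refine Finset.sum_le_sum fun z hz => ?_
      have := hb z (Finset.mem_of_mem_erase hz)
      split_ifs <;> omega
    rw [Finset.card_erase_of_mem hy] at h2
    have h3 := Finset.card_pos.mpr ⟨y, hy⟩
    rw [← Finset.add_sum_erase _ _ hy]
    omega)
  exact haM (Finset.mem_image.mpr ⟨u, hu, hsu⟩)

/-! ### Arithmetic of the gadgets at `γ`-vertices -/

/-- At a `γ`-vertex with a leaf, a weight `a` towards `v` is blocked by at most one sum `A` at `v`. -/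
theorem gamma_leaf_unique (a p q k₁ k₂ A A' : ℕ) (hA : A ≠ A') :
    (∃ b, (1 ≤ b ∧ b ≤ 3) ∧ a + b + p + q ≠ k₁ ∧ a + b + p + q ≠ k₂ ∧ a + b + p + q ≠ A) ∨
    (∃ b, (1 ≤ b ∧ b ≤ 3) ∧ a + b + p + q ≠ k₁ ∧ a + b + p + q ≠ k₂ ∧ a + b + p + q ≠ A') := by
  by_contra! h
  have h1 := h.1 1
  have h2 := h.1 2
  have h3 := h.1 3
  have h1' := h.2 1
  have h2' := h.2 2
  have h3' := h.2 3
  omega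

/-- Some weight `a` is blocked by no sum: blocking both `1` and `3` would put `k₁` and `k₂` into two windows
that share a single value. -/
theorem gamma_leaf_exists (p q k₁ k₂ : ℕ) : ∃ a, (1 ≤ a ∧ a ≤ 3) ∧ ∀ A,
    ∃ b, (1 ≤ b ∧ b ≤ 3) ∧ a + b + p + q ≠ k₁ ∧ a + b + p + q ≠ k₂ ∧ a + b + p + q ≠ A := by
  by_contra! h
  obtain ⟨A, hA⟩ := h 1 (by omega)
  obtain ⟨A', hA'⟩ := h 3 (by omega)
  have h1 := hA 1
  have h2 := hA 2
  have h3 := hA 3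
  have h1' := hA' 1
  have h2' := hA' 2
  have h3' := hA' 3
  omega

/-- The analogue of `gamma_leaf_unique` for a `γ`-vertex with an `α`-neighbour. -/
theorem gamma_alpha_unique (a p m k A A' : ℕ) (hA : A ≠ A') :
    (∃ b, (1 ≤ b ∧ b ≤ 3) ∧ b ≠ m ∧ a + b + p ≠ k ∧ a + b + p ≠ A) ∨
    (∃ b, (1 ≤ b ∧ b ≤ 3) ∧ b ≠ m ∧ a + b + p ≠ k ∧ a + b + p ≠ A') := by
  by_contra! h
  have h1 := h.1 1
  have h2 := h.1 2
  have h3 := h.1 3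
  have h1' := h.2 1
  have h2' := h.2 2
  have h3' := h.2 3
  omega

theorem gamma_alpha_exists (p m k : ℕ) : ∃ a, (1 ≤ a ∧ a ≤ 3) ∧ ∀ A,
    ∃ b, (1 ≤ b ∧ b ≤ 3) ∧ b ≠ m ∧ a + b + p ≠ k ∧ a + b + p ≠ A := by
  by_contra! h
  obtain ⟨A₁, hA₁⟩ := h 1 (by omega)
  obtain ⟨A₂, hA₂⟩ := h 2 (by omega)
  obtain ⟨A₃, hA₃⟩ := h 3 (by omega)
  have := hA₁ 1
  have := hA₁ 2
  have := hA₁ 3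
  have := hA₂ 1
  have := hA₂ 2
  have := hA₂ 3
  have := hA₃ 1
  have := hA₃ 2
  have := hA₃ 3
  omega

/-- At a `γ`-vertex with two `2`-neighbours, a failure of all nine pairs `b₁`, `b₂` forces
`k₁ + k₂ + A = 12 + 3 * a`. If `k₁` and `k₂` do not decrease when `A` grows, then this holds for at most
one `A`. -/
theorem gamma_two_of_ne (a m₁ m₂ k₁ k₂ A : ℕ) (ha : 1 ≤ a ∧ a ≤ 3) (hm₁ : 1 ≤ m₁ ∧ m₁ ≤ 3)
    (hm₂ : 1 ≤ m₂ ∧ m₂ ≤ 3) (hA : k₁ + k₂ + A ≠ 12 + 3 * a) :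
    ∃ b₁ b₂, (1 ≤ b₁ ∧ b₁ ≤ 3) ∧ (1 ≤ b₂ ∧ b₂ ≤ 3) ∧ b₁ + m₁ ≠ k₁ ∧ b₂ + m₂ ≠ k₂ ∧
      a + b₂ ≠ m₁ ∧ a + b₁ ≠ m₂ ∧ a + b₁ + b₂ ≠ A := by
  by_contra! h
  have h11 := h 1 1
  have h12 := h 1 2
  have h13 := h 1 3
  have h21 := h 2 1
  have h22 := h 2 2
  have h23 := h 2 3
  have h31 := h 3 1
  have h32 := h 3 2
  have h33 := h 3 3
  clear h
  obtain rfl | rfl | rfl : a = 1 ∨ a = 2 ∨ a = 3 := by omega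
  all_goals
    obtain rfl | rfl | rfl : m₁ = 1 ∨ m₁ = 2 ∨ m₁ = 3 := by omega
    all_goals
      obtain rfl | rfl | rfl : m₂ = 1 ∨ m₂ = 2 ∨ m₂ = 3 := by omega
      all_goals
        norm_num at h11 h12 h13 h21 h22 h23 h31 h32 h33
        omega

/-- With weight `3` towards `v`, the conditions on `m₁` and `m₂` hold automatically. -/
theorem gamma_two_three (m₁ m₂ k₁ k₂ A : ℕ) (hm₁ : 1 ≤ m₁ ∧ m₁ ≤ 3)
    (hm₂ : 1 ≤ m₂ ∧ m₂ ≤ 3) :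
    ∃ b₁ b₂, (1 ≤ b₁ ∧ b₁ ≤ 3) ∧ (1 ≤ b₂ ∧ b₂ ≤ 3) ∧ b₁ + m₁ ≠ k₁ ∧ b₂ + m₂ ≠ k₂ ∧
      3 + b₂ ≠ m₁ ∧ 3 + b₁ ≠ m₂ ∧ 3 + b₁ + b₂ ≠ A := by
  by_contra! h
  have h11 := h 1 1
  have h12 := h 1 2
  have h13 := h 1 3
  have h21 := h 2 1
  have h22 := h 2 2
  have h23 := h 2 3
  have h31 := h 3 1
  have h32 := h 3 2
  have h33 := h 3 3
  omega


/-! ### The neighbourhoods of `α`- and `γ`-vertices -/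

theorem two_le_card_filter {v : V} {P : V → Prop} (h : 2 ≤ numNbrs G v P) :
    ∃ x y, x ≠ y ∧ G.Adj v x ∧ P x ∧ G.Adj v y ∧ P y := by
  classical
  rw [numNbrs] at h
  obtain ⟨x, hx, y, hy, hne⟩ := Finset.one_lt_card.mp (show 1 < _ from h)
  simp only [Finset.mem_filter, SimpleGraph.mem_neighborFinset] at hx hy
  exact ⟨x, y, hne, hx.1, hx.2, hy.1, hy.2⟩

namespace IsMinimalThreeBad

variable (hG : IsMinimalThreeBad G)
include hG

theorem deg_ne_one {v x : V} (hv : deg G v = 2 ∨ deg G v = 3) (hx : G.Adj v x) : deg G x ≠ 1 :=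
  fun h => hG.not_configA ⟨v, hv, x, hx, h⟩

theorem three_le_deg {v x : V} (hv : deg G v = 2 ∨ deg G v = 3) (hx : G.Adj v x)
    (h2 : deg G x ≠ 2) : 3 ≤ deg G x := by
  have := hG.deg_ne_zero x
  have := hG.deg_ne_one hv hx
  omega

/-- The path from a vertex `v` of large degree through an `α`-neighbour ends in another vertex of
large degree. -/
theorem exists_alpha_path {v x : V} (hv : 3 ≤ deg G v) (hvx : G.Adj v x) (hx : IsAlpha G x) :
    ∃ x' x'', IsNbrs₂ G x v x' ∧ IsNbrs₂ G x' x x'' ∧ 3 ≤ deg G x'' := by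
  obtain ⟨hx2, x', hxx', hx'⟩ := hx
  obtain ⟨b, hb⟩ := exists_nbrs₂ hx2 hvx.symm
  obtain rfl : x' = b := by
    rcases (hb.2 x').mp hxx' with h | h
    · subst h; omega
    · exact h
  obtain ⟨x'', hx''⟩ := exists_nbrs₂ hx' hxx'.symm
  refine ⟨x', x'', hb, hx'', hG.three_le_deg (Or.inl hx') hx''.adj_right fun h => ?_⟩
  refine hG.not_configB ⟨x', by omega, fun u hu => ?_⟩
  rcases (hx''.2 u).mp hu with rfl | rfl
  exacts [hx2, h]

theorem not_configC : ¬ ConfigC G := by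
  classical
  rintro ⟨v, hv, x, y, hxy, hvx, hx, hvy, hy⟩
  obtain ⟨x', x'', hx₂, hx'₂, hx''⟩ := hG.exists_alpha_path hv.ge hvx hx
  obtain ⟨y', hy₂⟩ := exists_nbrs₂ hy hvy.symm
  obtain ⟨z, hz⟩ := exists_nbrs₃ hv hvx hvy hxy
  have hvxn := G.ne_of_adj hvx
  have hvyn := G.ne_of_adj hvy
  by_cases hx'y : x' = y
  · subst hx'y
    obtain rfl : y' = x := by
      rcases (hy₂.2 x).mp hx'₂.adj_left with h | h
      exacts [absurd h.symm hvxn, h.symm]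
    obtain ⟨w, R, hw, -, h⟩ := hG.star₂ (v := v) (s := y') (t := x') {{y', x'}} hxy hvx hvy
      (by simp [hvxn, hvyn]) (sep_singleton _) (Or.inl ⟨_, rfl, by simp⟩)
      (Or.inl ⟨_, rfl, by simp⟩)
    -- `x` and `y` are adjacent: their edges to `v` get the weights `1` and `b ≠ 1`
    obtain ⟨b, hb, hb1, hb2⟩ := exists_avoid₂ 0 1 (1 + R) (vertexSum G w z)
    obtain ⟨u, hu, hua, hub, -, hs⟩ := h 1 b (by omega) hb (by
      rintro w₁ f h1 h2 h₁ _ rfl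
      refine localFix_triangle h₁.isWeighting hx₂ hy₂ ?_
      rw [h₁.mem _ (by simp), h₁.mem _ (by simp), h1, h2]
      omega)
    rcases (hz.2 u).mp hu with rfl | rfl | rfl
    exacts [hua rfl, hub rfl, by omega]
  · have hnxy : ¬ G.Adj x y := fun h => by
      rcases (hx₂.2 y).mp h with h | h
      exacts [hvyn h.symm, hx'y h.symm]
    have hyx'' : y ≠ x'' := by rintro rfl; omega
    have hnx'y : ¬ G.Adj x' y := fun h => by
      rcases (hx'₂.2 y).mp h with h | h
      exacts [hxy h.symm, hyx'' h]
    have hsep : Separated G {x, x'} {y} := by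
      rintro _ (rfl | rfl) _ rfl
      exacts [⟨hxy, hnxy⟩, ⟨hx'y, hnx'y⟩]
    have hx'v := hx₂.1.symm
    obtain ⟨w, R, hw, -, h⟩ := hG.star₂ (v := v) (s := x) (t := y) {{x, x'}, {y}} hxy hvx hvy
      (by simp [hvxn, hvyn, hx₂.1]) (sep_pair hsep) (Or.inl ⟨{x, x'}, by simp⟩)
      (Or.inl ⟨{y}, by simp⟩)
    obtain ⟨a, ha, ha1, ha2⟩ := exists_avoid₂ 0 (w s(x', x'')) R (w s(y, y'))
    obtain ⟨b, hb, hb1, hb2⟩ := exists_avoid₂ (w s(y, y')) (vertexSum G w y') (a + R)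
      (vertexSum G w z)
    have hy'x : y' ≠ x := by rintro rfl; exact hnxy hy₂.adj_right.symm
    have hy'y : y' ≠ y := (G.ne_of_adj hy₂.adj_right).symm
    have hx'x : x' ≠ x := (G.ne_of_adj hx₂.adj_right).symm
    have hw' : ∀ w₁ f, IsStarChange G w w₁ v {x, y} f → w₁ s(x', x'') = w s(x', x'') := by
      intro w₁ f h₁
      by_cases hx''v : x'' = v
      · rw [hx''v]; exact h₁.notMem _ (by simp [hx'x, hx'y])
      · exact h₁.of_ne _ _ hx'v hx''v
    obtain ⟨u, hu, hua, hub, -, hs⟩ := h a b ha hb (by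
      rintro w₁ f h1 h2 h₁ _ (rfl | rfl)
      · refine localFix_alpha h₁.isWeighting hx₂ hx'₂ ?_
        rw [h₁.mem _ (by simp), hw' _ _ h₁, h1]
        omega
      · refine localFix_two h₁.isWeighting hy₂ ?_ ?_
        · rw [h₁.mem _ (by simp), h₁.of_ne _ _ hvyn.symm hy₂.1.symm, h2]; omega
        · rw [h₁.mem _ (by simp), h₁.of_ne _ _ hvyn.symm hy₂.1.symm, h2,
            h₁.sum _ hy₂.1.symm (by simp [hy'x, hy'y])]
          exact hb1)
    rcases (hz.2 u).mp hu with rfl | rfl | rfl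
    exacts [hua rfl, hub rfl, by omega]

theorem not_configD : ¬ ConfigD G := by
  classical
  rintro ⟨v, hv, x, y, hxy, hvx, hx, hvy, hy⟩
  obtain ⟨z₁, z₂, hz⟩ := exists_nbrs₄' hv hvx hvy hxy
  have hvxn := G.ne_of_adj hvx
  have hvyn := G.ne_of_adj hvy
  have hy0 := hG.deg_ne_zero y
  have hx' := exists_adj_of_deg_eq_one hx hvx.symm
  rcases (by omega : deg G y = 1 ∨ deg G y = 2) with hy | hy
  · obtain ⟨w, R, hw, -, h⟩ := hG.star₂ (v := v) (s := x) (t := y) ∅ hxy hvx hvy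
      (by simp) sep_empty (Or.inr hx) (Or.inr hy)
    obtain ⟨b, hb, hb1, hb2⟩ := exists_avoid₂ (1 + R) (vertexSum G w z₁) (1 + R) (vertexSum G w z₂)
    obtain ⟨u, hu, hua, hub, -, hs⟩ := h 1 b (by omega) hb (by simp)
    rcases (hz.2 u).mp hu with rfl | rfl | rfl | rfl
    exacts [hua rfl, hub rfl, by omega, by omega]
  · obtain ⟨y', hy₂⟩ := exists_nbrs₂ hy hvy.symm
    obtain ⟨w, R, hw, -, h⟩ := hG.star₂ (v := v) (s := x) (t := y) {{y}} hxy hvx hvy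
      (by simp [hvyn]) (sep_singleton _) (Or.inr hx) (Or.inl ⟨{y}, by simp⟩)
    have hy'x : y' ≠ x := by
      rintro rfl
      exact hvyn ((hx' y).mp hy₂.adj_right.symm).symm
    have hy'y : y' ≠ y := (G.ne_of_adj hy₂.adj_right).symm
    have hnum : ∃ a b, (1 ≤ a ∧ a ≤ 3) ∧ (1 ≤ b ∧ b ≤ 3) ∧ a + R ≠ w s(y, y') ∧
        b + w s(y, y') ≠ vertexSum G w y' ∧ a + b + R ≠ vertexSum G w z₁ ∧
        a + b + R ≠ vertexSum G w z₂ := by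
      by_contra! h
      have h11 := h 1 1
      have h12 := h 1 2
      have h13 := h 1 3
      have h21 := h 2 1
      have h22 := h 2 2
      have h23 := h 2 3
      have h31 := h 3 1
      have h32 := h 3 2
      have h33 := h 3 3
      omega
    obtain ⟨a, b, ha, hb, h1, h2, h3, h4⟩ := hnum
    obtain ⟨u, hu, hua, hub, -, hs⟩ := h a b ha hb (by
      rintro w₁ f hf1 hf2 h₁ _ rfl
      refine localFix_two h₁.isWeighting hy₂ ?_ ?_
      · rw [h₁.mem _ (by simp), h₁.of_ne _ _ hvyn.symm hy₂.1.symm, hf2]; omega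
      · rw [h₁.mem _ (by simp), h₁.of_ne _ _ hvyn.symm hy₂.1.symm, hf2,
          h₁.sum _ hy₂.1.symm (by simp [hy'x, hy'y])]
        exact h2)
    rcases (hz.2 u).mp hu with rfl | rfl | rfl | rfl
    exacts [hua rfl, hub rfl, by omega, by omega]

end IsMinimalThreeBad

/-! ### Repairs at `γ`-vertices -/

theorem IsStarChange.left {w w₁ : Sym2 V → ℕ} {v : V} {S : Finset V} {f : V → ℕ}
    (h : IsStarChange G w w₁ v S f) {p : V} (hp : p ≠ v) (hpS : p ∉ S) (q : V) :
    w₁ s(p, q) = w s(p, q) := by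
  by_cases hq : q = v
  · rw [hq]; exact h.notMem p hpS
  · exact h.of_ne p q hp hq

theorem IsStarChange.target {w w₁ : Sym2 V → ℕ} {v : V} {S : Finset V} {f : V → ℕ} {A : ℕ}
    (h : IsStarChange G w w₁ v S f) {z : V} (hzS : z ∉ S) :
    target G w₁ v A z = target G w v A z := by
  by_cases hz : z = v
  · simp [hz]
  · rw [target_of_ne hz, target_of_ne hz, h.sum z hz hzS]

/-- The gadget of a `γ`-vertex `g`: the vertex itself, its neighbours of degree at most `2`, and the
`2`-neighbours of its `2`-neighbours. -/
def gammaSet (G : SimpleGraph V) (g : V) : Set V :=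
  {x | x = g ∨ (G.Adj g x ∧ deg G x ≤ 2) ∨
    (deg G x = 2 ∧ ∃ y, G.Adj g y ∧ deg G y = 2 ∧ G.Adj y x)}

theorem self_mem_gammaSet (g : V) : g ∈ gammaSet G g := Or.inl rfl

theorem notMem_gammaSet {g p : V} (hp : p ≠ g) (h : 3 ≤ deg G p) : p ∉ gammaSet G g := by
  rintro (h1 | ⟨-, h1⟩ | ⟨h1, -⟩)
  · exact hp h1
  · omega
  · omega

theorem separated_gammaSet_two {g v y o : V} (hy : IsNbrs₂ G y v o) (hvg : v ≠ g)
    (hv : 3 ≤ deg G v) (hog : o ≠ g) (ho : 3 ≤ deg G o) (hg : 3 ≤ deg G g) :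
    Separated G {y} (gammaSet G g) := by
  have hyd := hy.deg_eq
  rintro _ rfl p hp
  refine ⟨?_, fun h => ?_⟩
  · rintro rfl
    rcases hp with rfl | ⟨h, -⟩ | ⟨-, q, -, hq, h⟩
    · omega
    · rcases (hy.2 g).mp h.symm with h | h
      exacts [hvg h.symm, hog h.symm]
    · rcases (hy.2 q).mp h.symm with rfl | rfl <;> omega
  · rcases (hy.2 p).mp h with rfl | rfl
    exacts [notMem_gammaSet hvg hv hp, notMem_gammaSet hog ho hp]

theorem separated_gammaSet_alpha {g v x x' x'' : V} (hx : IsNbrs₂ G x v x')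
    (hx' : IsNbrs₂ G x' x x'') (hvg : v ≠ g) (hv : 3 ≤ deg G v) (hx''g : x'' ≠ g)
    (hx'' : 3 ≤ deg G x'') (hg : 3 ≤ deg G g) : Separated G {x, x'} (gammaSet G g) := by
  have hxd := hx.deg_eq
  have hx'd := hx'.deg_eq
  have hxg : x ≠ g := by rintro rfl; omega
  have hx'g : x' ≠ g := by rintro rfl; omega
  have hgx : ¬ G.Adj g x := fun h => by
    rcases (hx.2 g).mp h.symm with h | h
    exacts [hvg h.symm, hx'g h.symm]
  have hgx' : ¬ G.Adj g x' := fun h => by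
    rcases (hx'.2 g).mp h.symm with h | h
    exacts [hxg h.symm, hx''g h.symm]
  have hxm : x ∉ gammaSet G g := by
    rintro (h | ⟨h, -⟩ | ⟨-, q, hgq, hq, h⟩)
    · exact hxg h
    · exact hgx h
    · rcases (hx.2 q).mp h.symm with rfl | rfl
      · omega
      · exact hgx' hgq
  have hx'm : x' ∉ gammaSet G g := by
    rintro (h | ⟨h, -⟩ | ⟨-, q, hgq, hq, h⟩)
    · exact hx'g h
    · exact hgx' h
    · rcases (hx'.2 q).mp h.symm with rfl | rfl
      · exact hgx hgq
      · omega
  rintro _ (rfl | rfl) p hp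
  · refine ⟨fun h => hxm (h ▸ hp), fun h => ?_⟩
    rcases (hx.2 p).mp h with rfl | rfl
    exacts [notMem_gammaSet hvg hv hp, hx'm hp]
  · refine ⟨fun h => hx'm (h ▸ hp), fun h => ?_⟩
    rcases (hx'.2 p).mp h with rfl | rfl
    exacts [hxm hp, notMem_gammaSet hx''g hx'' hp]

namespace IsMinimalThreeBad

/-- The three kinds of `γ`-vertices `g`, seen from a neighbour `v` of large degree. -/
theorem gamma_cases (hG : IsMinimalThreeBad G) {g v : V} (hg : IsGamma G g) (hgv : G.Adj g v)
    (hv : 3 ≤ deg G v) :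
    (∃ x z₁ z₂, IsNbrs₄ G g v x z₁ z₂ ∧ (∀ u, G.Adj x u ↔ u = g) ∧ deg G x = 1 ∧
      3 ≤ deg G z₁ ∧ 3 ≤ deg G z₂) ∨
    (∃ x z x' x'', IsNbrs₃ G g v x z ∧ IsNbrs₂ G x g x' ∧ IsNbrs₂ G x' x x'' ∧ x'' ≠ g ∧
      3 ≤ deg G z ∧ 3 ≤ deg G x'') ∨
    (∃ y₁ y₂ o₁ o₂, IsNbrs₃ G g v y₁ y₂ ∧ IsNbrs₂ G y₁ g o₁ ∧ IsNbrs₂ G y₂ g o₂ ∧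
      ¬ G.Adj y₁ y₂ ∧ 3 ≤ deg G o₁ ∧ 3 ≤ deg G o₂) := by
  rcases hg with ⟨hg4, x, hgx, hx⟩ | ⟨hg3, h⟩
  · left
    obtain ⟨z₁, z₂, hn⟩ := exists_nbrs₄' hg4 hgv hgx (by rintro rfl; omega)
    have hz : ∀ z, G.Adj g z → x ≠ z → 3 ≤ deg G z := by
      intro z hz hxz
      by_contra hlt
      exact hG.not_configD ⟨g, hg4, x, z, hxz, hgx, hx, hz, by omega⟩
    exact ⟨x, z₁, z₂, hn, exists_adj_of_deg_eq_one hx hgx.symm, hx,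
      hz z₁ hn.adj₃ hn.1.2.2.2.1, hz z₂ hn.adj₄ hn.1.2.2.2.2.1⟩
  right
  by_cases hα : ∃ x, G.Adj g x ∧ IsAlpha G x
  · left
    obtain ⟨x, hgx, hx⟩ := hα
    obtain ⟨x', x'', h₁, h₂, h₃⟩ := hG.exists_alpha_path hg3.ge hgx hx
    obtain ⟨z, hn⟩ := exists_nbrs₃ hg3 hgv hgx (by rintro rfl; have := hx.1; omega)
    refine ⟨x, z, x', x'', hn, h₁, h₂, ?_, ?_, h₃⟩
    · rintro rfl
      exact hG.not_configC ⟨x'', hg3, x, x', G.ne_of_adj h₁.adj_right, hgx, hx,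
        h₂.adj_right.symm, h₂.deg_eq⟩
    · exact hG.three_le_deg (Or.inr hg3) hn.adj₃ fun h =>
        hG.not_configC ⟨g, hg3, x, z, hn.1.2.2, hgx, hx, hn.adj₃, h⟩
  · right
    obtain ⟨y₁, y₂, hne, hgy₁, hy₁, hgy₂, hy₂⟩ := two_le_card_filter (h.resolve_left hα)
    obtain ⟨z, hn⟩ := exists_nbrs₃ hg3 hgv hgy₁ (by rintro rfl; omega)
    obtain rfl : y₂ = z := by
      rcases (hn.2 y₂).mp hgy₂ with h | h | h
      · subst h; omega
      · exact absurd h.symm hne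
      · exact h
    obtain ⟨o₁, ho₁⟩ := exists_nbrs₂ hy₁ hgy₁.symm
    obtain ⟨o₂, ho₂⟩ := exists_nbrs₂ hy₂ hgy₂.symm
    exact ⟨y₁, y₂, o₁, o₂, hn, ho₁, ho₂, fun h => hα ⟨y₁, hgy₁, hy₁, y₂, h, hy₂⟩,
      hG.three_le_deg (Or.inl hy₁) ho₁.adj_right fun h => hα ⟨y₁, hgy₁, hy₁, o₁, ho₁.adj_right, h⟩,
      hG.three_le_deg (Or.inl hy₂) ho₂.adj_right fun h => hα ⟨y₂, hgy₂, hy₂, o₂, ho₂.adj_right, h⟩⟩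

theorem gammaSet_eq_leaf {g v x z₁ z₂ : V} (hn : IsNbrs₄ G g v x z₁ z₂) (hv : 3 ≤ deg G v)
    (hx : deg G x = 1) (h₁ : 3 ≤ deg G z₁) (h₂ : 3 ≤ deg G z₂) : gammaSet G g = {g, x} := by
  ext p
  constructor
  · rintro (rfl | ⟨h, hp⟩ | ⟨-, y, hgy, hy, -⟩)
    · simp
    · rcases (hn.2 p).mp h with rfl | rfl | rfl | rfl
      · omega
      · simp
      · omega
      · omega
    · rcases (hn.2 y).mp hgy with rfl | rfl | rfl | rfl <;> omega
  · rintro (rfl | rfl)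
    exacts [Or.inl rfl, Or.inr (Or.inl ⟨hn.adj₂, by omega⟩)]

theorem gammaSet_eq_alpha {g v x z x' x'' : V} (hn : IsNbrs₃ G g v x z) (hx : IsNbrs₂ G x g x')
    (hx' : IsNbrs₂ G x' x x'') (hv : 3 ≤ deg G v) (hz : 3 ≤ deg G z) :
    gammaSet G g = {g, x, x'} := by
  have hg := hn.deg_eq
  have hxd := hx.deg_eq
  have hxd' := hx'.deg_eq
  ext p
  constructor
  · rintro (rfl | ⟨h, hp⟩ | ⟨hp, y, hgy, hy, hyp⟩)
    · simp
    · rcases (hn.2 p).mp h with rfl | rfl | rfl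
      · omega
      · simp
      · omega
    · rcases (hn.2 y).mp hgy with rfl | rfl | rfl
      · omega
      · rcases (hx.2 p).mp hyp with rfl | rfl <;> simp
      · omega
  · rintro (rfl | rfl | rfl)
    exacts [Or.inl rfl, Or.inr (Or.inl ⟨hn.adj₂, by omega⟩),
      Or.inr (Or.inr ⟨hxd', x, hn.adj₂, hxd, hx.adj_right⟩)]

theorem gammaSet_eq_two {g v y₁ y₂ o₁ o₂ : V} (hn : IsNbrs₃ G g v y₁ y₂)
    (hy₁ : IsNbrs₂ G y₁ g o₁) (hy₂ : IsNbrs₂ G y₂ g o₂) (hv : 3 ≤ deg G v)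
    (ho₁ : 3 ≤ deg G o₁) (ho₂ : 3 ≤ deg G o₂) : gammaSet G g = {g, y₁, y₂} := by
  have hg := hn.deg_eq
  have hd₁ := hy₁.deg_eq
  have hd₂ := hy₂.deg_eq
  ext p
  constructor
  · rintro (rfl | ⟨h, hp⟩ | ⟨hp, y, hgy, hy, hyp⟩)
    · simp
    · rcases (hn.2 p).mp h with rfl | rfl | rfl
      · omega
      · simp
      · simp
    · rcases (hn.2 y).mp hgy with rfl | rfl | rfl
      · omega
      · rcases (hy₁.2 p).mp hyp with rfl | rfl <;> omega
      · rcases (hy₂.2 p).mp hyp with rfl | rfl <;> omega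
  · rintro (rfl | rfl | rfl)
    exacts [Or.inl rfl, Or.inr (Or.inl ⟨hn.adj₂, by omega⟩),
      Or.inr (Or.inl ⟨hn.adj₃, by omega⟩)]

/-- The gadget of a `γ`-neighbour `g` of `v` can be repaired whenever the new weight `a` of `s(g, v)`
and the new sum `A` at `v` satisfy a condition `P a A` that rules out at most one sum `A` for each
`a`, and no sum at all for some `a`. If `g` has a `2`-neighbour that is not an `α`-vertex, then
`a = 3` always works. -/
theorem gamma_repair (hG : IsMinimalThreeBad G) {g v : V} (hg : IsGamma G g) (hgv : G.Adj g v)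
    (hv : 3 ≤ deg G v) {w : Sym2 V → ℕ} (hw : IsWeighting G w) :
    ∃ P : ℕ → ℕ → Prop, (∀ a A A', (1 ≤ a ∧ a ≤ 3) → A ≠ A' → P a A ∨ P a A') ∧
      (∃ a, (1 ≤ a ∧ a ≤ 3) ∧ ∀ A, P a A) ∧
      ((∃ y, G.Adj g y ∧ deg G y = 2 ∧ ¬ IsAlpha G y) → ∀ A, P 3 A) ∧
      ∀ S f w₁ A, IsStarChange G w w₁ v S f → g ∈ S →
        (∀ s ∈ S, s ≠ g → s ∉ gammaSet G g ∧ ∀ t ∈ gammaSet G g, ¬ G.Adj t s) →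
        P (f g) A → LocalFix G w₁ (gammaSet G g) v A := by
  have hgvn := G.ne_of_adj hgv
  have hout : ∀ S : Finset V, (∀ s ∈ S, s ≠ g → s ∉ gammaSet G g ∧
      ∀ t ∈ gammaSet G g, ¬ G.Adj t s) → ∀ t ∈ gammaSet G g, ∀ z, G.Adj t z → z ≠ g → z ∉ S :=
    fun S h t ht z htz hz hzS => (h z hzS hz).2 t ht htz
  have hin : ∀ S : Finset V, (∀ s ∈ S, s ≠ g → s ∉ gammaSet G g ∧
      ∀ t ∈ gammaSet G g, ¬ G.Adj t s) → ∀ t ∈ gammaSet G g, t ≠ g → t ∉ S :=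
    fun S h t ht hz hzS => (h t hzS hz).1 ht
  rcases hG.gamma_cases hg hgv hv with ⟨x, z₁, z₂, hn, hx, hxd, hz₁, hz₂⟩ |
    ⟨x, z, x', x'', hn, hx, hx', hx''g, hz, hx''⟩ |
    ⟨y₁, y₂, o₁, o₂, hn, hy₁, hy₂, hnadj, ho₁, ho₂⟩
  · have hset := gammaSet_eq_leaf hn hv hxd hz₁ hz₂
    have hgz₁ := G.ne_of_adj hn.adj₃
    have hgz₂ := G.ne_of_adj hn.adj₄
    refine ⟨fun a A => ∃ b, (1 ≤ b ∧ b ≤ 3) ∧ a + b + w s(g, z₁) + w s(g, z₂) ≠ vertexSum G w z₁ ∧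
      a + b + w s(g, z₁) + w s(g, z₂) ≠ vertexSum G w z₂ ∧
      a + b + w s(g, z₁) + w s(g, z₂) ≠ A, fun a A A' _ h => gamma_leaf_unique _ _ _ _ _ _ _ h,
      gamma_leaf_exists _ _ _ _, ?_, ?_⟩
    · rintro ⟨y, hgy, hy, -⟩
      rcases (hn.2 y).mp hgy with rfl | rfl | rfl | rfl <;> omega
    · intro S f w₁ A h₁ hgS hS hP
      rw [hset]
      refine localFix_gamma_leaf h₁.isWeighting hn hx ?_
      have hz₁v := hn.1.2.1.symm
      have hz₂v := hn.1.2.2.1.symm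
      rwa [h₁.mem g hgS, h₁.of_ne g z₁ hgvn hz₁v, h₁.of_ne g z₂ hgvn hz₂v,
        h₁.sum z₁ hz₁v (hout S hS g (self_mem_gammaSet g) z₁ hn.adj₃ hgz₁.symm),
        h₁.sum z₂ hz₂v (hout S hS g (self_mem_gammaSet g) z₂ hn.adj₄ hgz₂.symm)]
  · have hset := gammaSet_eq_alpha hn hx hx' hv hz
    have hgz := G.ne_of_adj hn.adj₃
    have hgx := G.ne_of_adj hn.adj₂
    have hgx' := hx.1
    refine ⟨fun a A => ∃ b, (1 ≤ b ∧ b ≤ 3) ∧ b ≠ w s(x', x'') ∧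
      a + b + w s(g, z) ≠ vertexSum G w z ∧ a + b + w s(g, z) ≠ A,
      fun a A A' _ h => gamma_alpha_unique _ _ _ _ _ _ h, gamma_alpha_exists _ _ _, ?_, ?_⟩
    · rintro ⟨y, hgy, hy, hyα⟩
      rcases (hn.2 y).mp hgy with rfl | rfl | rfl
      · omega
      · exact absurd ⟨hy, x', hx.adj_right, hx'.deg_eq⟩ hyα
      · omega
    · intro S f w₁ A h₁ hgS hS hP
      have hx'S : x' ∉ S := hin S hS x' (by simp [hset]) hgx'.symm
      have hx'v : x' ≠ v := by rintro rfl; have := hx'.deg_eq; omega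
      rw [hset]
      refine localFix_gamma_alpha h₁.isWeighting hn hx hx' hx''g ?_
      have hzv := hn.1.2.1.symm
      rwa [h₁.mem g hgS, h₁.of_ne g z hgvn hzv, h₁.left hx'v hx'S,
        h₁.sum z hzv (hout S hS g (self_mem_gammaSet g) z hn.adj₃ hgz.symm)]
  · have hset := gammaSet_eq_two hn hy₁ hy₂ hv ho₁ ho₂
    have hgy₁ := G.ne_of_adj hn.adj₂
    have hgy₂ := G.ne_of_adj hn.adj₃
    have hm₁ := hw _ _ hy₁.adj_right
    have hm₂ := hw _ _ hy₂.adj_right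
    have hmono : ∀ z A A', A < A' → target G w v A z ≤ target G w v A' z := by
      intro z A A' h
      by_cases hz : z = v
      · simp [hz, h.le]
      · rw [target_of_ne hz, target_of_ne hz]
    refine ⟨fun a A => ∃ b₁ b₂, (1 ≤ b₁ ∧ b₁ ≤ 3) ∧ (1 ≤ b₂ ∧ b₂ ≤ 3) ∧
      b₁ + w s(y₁, o₁) ≠ target G w v A o₁ ∧ b₂ + w s(y₂, o₂) ≠ target G w v A o₂ ∧
      a + b₂ ≠ w s(y₁, o₁) ∧ a + b₁ ≠ w s(y₂, o₂) ∧ a + b₁ + b₂ ≠ A, ?_,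
      ⟨3, by omega, fun A => gamma_two_three _ _ _ _ _ hm₁ hm₂⟩,
      fun _ A => gamma_two_three _ _ _ _ _ hm₁ hm₂, ?_⟩
    · intro a A A' ha hne
      by_cases h : target G w v A o₁ + target G w v A o₂ + A = 12 + 3 * a
      · refine Or.inr (gamma_two_of_ne _ _ _ _ _ _ ha hm₁ hm₂ ?_)
        rcases Nat.lt_or_gt_of_ne hne with hlt | hlt
        · have := hmono o₁ _ _ hlt
          have := hmono o₂ _ _ hlt
          omega
        · have := hmono o₁ _ _ hlt
          have := hmono o₂ _ _ hlt
          omega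
      · exact Or.inl (gamma_two_of_ne _ _ _ _ _ _ ha hm₁ hm₂ h)
    · intro S f w₁ A h₁ hgS hS hP
      have hy₁m : y₁ ∈ gammaSet G g := by simp [hset]
      have hy₂m : y₂ ∈ gammaSet G g := by simp [hset]
      have hy₁S := hin S hS y₁ hy₁m hgy₁.symm
      have hy₂S := hin S hS y₂ hy₂m hgy₂.symm
      have ho₁S := hout S hS y₁ hy₁m o₁ hy₁.adj_right hy₁.1.symm
      have ho₂S := hout S hS y₂ hy₂m o₂ hy₂.adj_right hy₂.1.symm
      rw [hset]
      refine localFix_gamma_two h₁.isWeighting hn hy₁ hy₂ hnadj ?_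
      rwa [h₁.mem g hgS, h₁.left hn.1.1.symm hy₁S, h₁.left hn.1.2.1.symm hy₂S, h₁.target ho₁S,
        h₁.target ho₂S]

end IsMinimalThreeBad

namespace IsMinimalThreeBad

/-! ### Adjacent `γ`-vertices -/

theorem three_le_deg_of_isGamma {g : V} (hg : IsGamma G g) : 3 ≤ deg G g := by
  rcases hg with h | h <;> omega

theorem deg_eq_three_of_isGamma (hG : IsMinimalThreeBad G) {g y : V} (hg : IsGamma G g)
    (hgy : G.Adj g y) (hy : deg G y = 2) : deg G g = 3 := by
  rcases hg with ⟨h4, x, hgx, hx⟩ | h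
  · exact absurd ⟨g, h4, x, y, by rintro rfl; omega, hgx, hx, hgy, hy.le⟩ hG.not_configD
  · exact h.1

/-- A `γ`-vertex `u` with two `2`-neighbours, one of which is also adjacent to the `γ`-neighbour `g` of
`u`. The common `2`-neighbour belongs to the gadget of `g`, and weight `3` on `s(u, g)` always works. -/
theorem not_adj_of_gamma_two (hG : IsMinimalThreeBad G) {g u y₁ y₂ o : V} (hg : IsGamma G g)
    (hu : IsNbrs₃ G u g y₁ y₂) (hy₁ : IsNbrs₂ G y₁ u g) (hy₂ : IsNbrs₂ G y₂ u o)
    (hnadj : ¬ G.Adj y₁ y₂) (ho : 3 ≤ deg G o) (hog : o ≠ g) : False := by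
  classical
  have hud := hu.deg_eq
  have hgd := three_le_deg_of_isGamma hg
  have hug := G.ne_of_adj hu.adj₁
  have huy₁ := G.ne_of_adj hu.adj₂
  have huy₂ := G.ne_of_adj hu.adj₃
  obtain ⟨hgy₁, hgy₂, hy₁y₂⟩ := hu.1
  have hsep : Separated G {y₂} (gammaSet G g) :=
    separated_gammaSet_two hy₂ hug hud.ge hog ho hgd
  have huset : u ∉ gammaSet G g := notMem_gammaSet hug hud.ge
  obtain ⟨w, R, hw, hR, h⟩ := hG.star₂ (v := u) (s := g) (t := y₂) {gammaSet G g, {y₂}} hgy₂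
    hu.adj₁ hu.adj₃ (by simp [huset, huy₂])
    (sep_pair hsep.symm) (Or.inl ⟨gammaSet G g, by simp, self_mem_gammaSet g⟩) (Or.inl ⟨{y₂}, by simp⟩)
  obtain ⟨P, -, -, hP3, hP⟩ := hG.gamma_repair hg hu.adj₁.symm hud.ge hw
  have hR' := hR y₁ hu.adj₂ hgy₁.symm hy₁y₂
  obtain ⟨b, hb, hb1, -⟩ := exists_avoid₂ (w s(y₂, o)) (vertexSum G w o) 0 0
  have hm := hw _ _ hy₂.adj_right
  have hoy₂ : o ≠ y₂ := (G.ne_of_adj hy₂.adj_right).symm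
  obtain ⟨z, hz, hzg, hzy₂, hzT, -⟩ := h 3 b (by omega) hb (by
    rintro w₁ f h1 h2 h₁ _ (rfl | rfl)
    · refine hP _ f w₁ _ h₁ (by simp) ?_ ?_
      · intro s hs hsg
        obtain rfl : s = y₂ := by simpa [hsg] using hs
        exact ⟨fun h => (hsep _ rfl _ h).1 rfl, fun t ht k => (hsep _ rfl _ ht).2 k.symm⟩
      · rw [h1]
        refine hP3 ⟨y₁, hy₁.adj_right.symm, hy₁.deg_eq, ?_⟩ _
        rintro ⟨-, p, hp, hpd⟩
        rcases (hy₁.2 p).mp hp with rfl | rfl <;> omega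
    · refine localFix_two h₁.isWeighting hy₂ ?_ ?_
      · rw [h₁.mem _ (by simp), h₁.of_ne _ _ huy₂.symm hy₂.1.symm, h2]; omega
      · rw [h₁.mem _ (by simp), h₁.of_ne _ _ huy₂.symm hy₂.1.symm, h2,
          h₁.sum _ hy₂.1.symm (by simp [hog, hoy₂])]
        exact hb1)
  rcases (hu.2 z).mp hz with rfl | rfl | rfl
  · exact hzg rfl
  · exact hzT _ (Or.inl rfl) (Or.inr (Or.inl ⟨hy₁.adj_right.symm, hy₁.deg_eq.le⟩))
  · exact hzy₂ rfl

theorem not_configF (hG : IsMinimalThreeBad G) : ¬ ConfigF G := by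
  classical
  rintro ⟨u, g, hug, hu, hg⟩
  have hud := three_le_deg_of_isGamma hu
  have hgd := three_le_deg_of_isGamma hg
  have hugn := G.ne_of_adj hug
  have huset : u ∉ gammaSet G g := notMem_gammaSet hugn hud
  rcases hG.gamma_cases hu hug hgd with ⟨x, z₁, z₂, hn, hx, hxd, hz₁, hz₂⟩ |
    ⟨x, z, x', x'', hn, hx, hx', hx''u, hz, hx''⟩ |
    ⟨y₁, y₂, o₁, o₂, hn, hy₁, hy₂, hnadj, ho₁, ho₂⟩
  · obtain ⟨hgx, hgz₁, hgz₂, hxz₁, hxz₂, -⟩ := hn.1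
    obtain ⟨w, R, hw, -, h⟩ := hG.star₂ (v := u) (s := g) (t := x) {gammaSet G g} hgx hug hn.adj₂
      (by simpa using huset) (sep_singleton _) (Or.inl ⟨_, rfl, self_mem_gammaSet g⟩) (Or.inr hxd)
    obtain ⟨P, -, ⟨a, ha, hPa⟩, -, hP⟩ := hG.gamma_repair hg hug.symm hud hw
    obtain ⟨b, hb, hb1, hb2⟩ := exists_avoid₂ (a + R) (vertexSum G w z₁) (a + R) (vertexSum G w z₂)
    obtain ⟨p, hp, hpg, hpx, -, hs⟩ := h a b ha hb (by
      rintro w₁ f h1 h2 h₁ _ rfl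
      refine hP _ f w₁ _ h₁ (by simp) ?_ (by rw [h1]; exact hPa _)
      intro s hs hsg
      obtain rfl : s = x := by simpa [hsg] using hs
      refine ⟨?_, fun t ht k => ?_⟩
      · rintro (k | ⟨k, -⟩ | ⟨k, -⟩)
        · exact hsg k
        · exact hugn ((hx g).mp k.symm).symm
        · omega
      · obtain rfl := (hx t).mp k.symm
        exact huset ht)
    rcases (hn.2 p).mp hp with rfl | rfl | rfl | rfl
    exacts [hpg rfl, hpx rfl, by omega, by omega]
  · obtain ⟨hgx, hgz, hxz⟩ := hn.1
    have hun := hn.deg_eq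
    have hux := G.ne_of_adj hn.adj₂
    have hux' := hx.1
    have hxx' := G.ne_of_adj hx.adj_right
    by_cases hx''g : x'' = g
    · subst hx''g
      -- the path through the `α`-neighbour of `u` returns to `g`, which closes a `4`-cycle
      obtain ⟨t, ht⟩ := exists_nbrs₃ (hG.deg_eq_three_of_isGamma hg hx'.adj_right.symm hx'.deg_eq)
        hug.symm hx'.adj_right.symm hux'
      obtain ⟨w, R, hw, -, h⟩ := hG.star₂ (v := u) (s := x'') (t := x) {{x, x', x''}} hgx hug
        hn.adj₂ (by simp [hux, hux', hugn]) (sep_singleton _) (Or.inl ⟨_, rfl, by simp⟩)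
        (Or.inl ⟨_, rfl, by simp⟩)
      have hnum : ∃ a b, (1 ≤ a ∧ a ≤ 3) ∧ (1 ≤ b ∧ b ≤ 3) ∧ b ≠ a ∧
          1 + a + R ≠ vertexSum G w z ∧ 1 + b + w s(x'', t) ≠ vertexSum G w t ∧
          1 + b + w s(x'', t) ≠ 1 + a + R := by
        by_contra! h
        have h12 := h 1 2
        have h13 := h 1 3
        have h21 := h 2 1
        have h23 := h 2 3
        have h31 := h 3 1
        have h32 := h 3 2
        omega
      obtain ⟨a, b, ha, hb, h1, h2, h3, h4⟩ := hnum
      have hx''t := G.ne_of_adj ht.adj₃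
      have htx : t ≠ x := by
        rintro rfl
        rcases (hx.2 x'').mp ht.adj₃.symm with k | k
        exacts [hugn k.symm, G.ne_of_adj hx'.adj_right k.symm]
      obtain ⟨p, hp, hpg, hpx, -, hs⟩ := h 1 a (by omega) ha (by
        rintro w₁ f hf1 hf2 h₁ _ rfl
        refine localFix_fourCycle h₁.isWeighting hx hx' ht ⟨b, hb, ?_⟩
        rw [h₁.mem _ (by simp), h₁.mem _ (by simp), hf1, hf2,
          h₁.of_ne _ _ hugn.symm ht.1.2.1.symm, h₁.sum t ht.1.2.1.symm (by simp [hx''t.symm, htx])]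
        exact ⟨h1, h3, h4⟩)
      rcases (hn.2 p).mp hp with rfl | rfl | rfl
      exacts [hpg rfl, hpx rfl, by omega]
    · have hsep : Separated G {x, x'} (gammaSet G g) :=
        separated_gammaSet_alpha hx hx' hugn hud hx''g hx'' hgd
      obtain ⟨w, R, hw, -, h⟩ := hG.star₂ (v := u) (s := g) (t := x) {gammaSet G g, {x, x'}} hgx
        hug hn.adj₂ (by simp [huset, hux, hux']) (sep_pair hsep.symm)
        (Or.inl ⟨gammaSet G g, by simp, self_mem_gammaSet g⟩) (Or.inl ⟨{x, x'}, by simp⟩)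
      obtain ⟨P, -, ⟨a, ha, hPa⟩, -, hP⟩ := hG.gamma_repair hg hug.symm hud hw
      obtain ⟨b, hb, hb1, hb2⟩ := exists_avoid₂ 0 (w s(x', x'')) (a + R) (vertexSum G w z)
      have hx'g : x' ≠ g := by rintro rfl; have := hx'.deg_eq; omega
      obtain ⟨p, hp, hpg, hpx, -, hs⟩ := h a b ha hb (by
        rintro w₁ f h1 h2 h₁ _ (rfl | rfl)
        · refine hP _ f w₁ _ h₁ (by simp) ?_ (by rw [h1]; exact hPa _)
          intro s hs hsg
          obtain rfl : s = x := by simpa [hsg] using hs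
          exact ⟨fun h => (hsep s (by simp) _ h).1 rfl,
            fun t ht k => (hsep s (by simp) _ ht).2 k.symm⟩
        · refine localFix_alpha h₁.isWeighting hx hx' ?_
          rw [h₁.mem _ (by simp), h₁.left hux'.symm (by simp [hx'g, hxx'.symm]), h2]
          omega)
      rcases (hn.2 p).mp hp with rfl | rfl | rfl
      exacts [hpg rfl, hpx rfl, by omega]
  · obtain ⟨hgy₁, hgy₂, hy₁y₂⟩ := hn.1
    have hun := hn.deg_eq
    have huy₁ := G.ne_of_adj hn.adj₂
    have huy₂ := G.ne_of_adj hn.adj₃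
    have hn' : IsNbrs₃ G u g y₂ y₁ :=
      ⟨⟨hgy₂, hgy₁, hy₁y₂.symm⟩, fun p => by rw [hn.2 p, or_comm (a := p = y₁)]⟩
    by_cases h₁g : o₁ = g
    · subst h₁g
      by_cases h₂g : o₂ = o₁
      · subst h₂g
        -- both `2`-neighbours of `u` are adjacent to `g`, so that the gadget of `g` contains them
        obtain ⟨w, R, hw, h⟩ := hG.star₁ (v := u) (s := o₂) {gammaSet G o₂} hug
          (by omega) (by simpa using huset) (sep_singleton _)
          (Or.inl ⟨_, rfl, self_mem_gammaSet o₂⟩)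
        obtain ⟨P, -, ⟨a, ha, hPa⟩, -, hP⟩ := hG.gamma_repair hg hug.symm hud hw
        obtain ⟨p, hp, hpg, hpT, -⟩ := h a ha (by
          rintro w₁ f h1 h₁ _ rfl
          refine hP _ f w₁ _ h₁ (by simp) ?_ (by rw [h1]; exact hPa _)
          intro s hs hsg
          exact absurd (by simpa using hs) hsg)
        have hmem : ∀ q, IsNbrs₂ G q u o₂ → q ∈ gammaSet G o₂ := fun q hq =>
          Or.inr (Or.inl ⟨hq.adj_right.symm, hq.deg_eq.le⟩)
        rcases (hn.2 p).mp hp with rfl | rfl | rfl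
        exacts [hpg rfl, hpT _ rfl (hmem _ hy₁), hpT _ rfl (hmem _ hy₂)]
      · exact hG.not_adj_of_gamma_two hg hn hy₁ hy₂ hnadj ho₂ h₂g
    · by_cases h₂g : o₂ = g
      · subst h₂g
        exact hG.not_adj_of_gamma_two hg hn' hy₂ hy₁ (fun k => hnadj k.symm) ho₁ h₁g
      · have hsep₁ : Separated G {y₁} (gammaSet G g) :=
          separated_gammaSet_two hy₁ hugn hud h₁g ho₁ hgd
        have hsep₂ : Separated G {y₂} (gammaSet G g) :=
          separated_gammaSet_two hy₂ hugn hud h₂g ho₂ hgd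
        have hsep₁₂ : Separated G {y₁} {y₂} := by
          rintro _ rfl _ rfl
          exact ⟨hy₁y₂, hnadj⟩
        obtain ⟨w, R, hw, -, hR, h⟩ := hG.star₃ (v := u) (s := g) (t := y₁) (r := y₂)
          {gammaSet G g, {y₁}, {y₂}} hgy₁ hgy₂ hy₁y₂ hug hn.adj₂ hn.adj₃
          (by simp [huset, huy₁, huy₂]) (sep_triple hsep₁.symm hsep₂.symm hsep₁₂)
          (Or.inl ⟨gammaSet G g, by simp, self_mem_gammaSet g⟩) (Or.inl ⟨{y₁}, by simp⟩)
          (Or.inl ⟨{y₂}, by simp⟩)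
        have hR0 := hR fun p hp => (hn.2 p).mp hp
        subst hR0
        obtain ⟨P, -, ⟨a, ha, hPa⟩, -, hP⟩ := hG.gamma_repair hg hug.symm hud hw
        obtain ⟨b, hb, hb1, hb2⟩ := exists_avoid₂ (w s(y₁, o₁)) (vertexSum G w o₁) a (w s(y₂, o₂))
        obtain ⟨c, hc, hc1, hc2⟩ := exists_avoid₂ (w s(y₂, o₂)) (vertexSum G w o₂) a (w s(y₁, o₁))
        have h₁y₁ : o₁ ≠ y₁ := (G.ne_of_adj hy₁.adj_right).symm
        have h₁y₂ : o₁ ≠ y₂ := by rintro rfl; exact hnadj hy₁.adj_right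
        have h₂y₂ : o₂ ≠ y₂ := (G.ne_of_adj hy₂.adj_right).symm
        have h₂y₁ : o₂ ≠ y₁ := by rintro rfl; exact hnadj hy₂.adj_right.symm
        obtain ⟨p, hp, hpg, hp₁, hp₂, -⟩ := h a b c ha hb hc (by
          rintro w₁ f h1 h2 h3 h₁ _ (rfl | rfl | rfl)
          · refine hP _ f w₁ _ h₁ (by simp) ?_ (by rw [h1]; exact hPa _)
            intro s hs hsg
            have hs' : s = y₁ ∨ s = y₂ := by simpa [hsg] using hs
            rcases hs' with rfl | rfl
            · exact ⟨fun h => (hsep₁ s rfl _ h).1 rfl, fun t ht k => (hsep₁ s rfl _ ht).2 k.symm⟩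
            · exact ⟨fun h => (hsep₂ s rfl _ h).1 rfl, fun t ht k => (hsep₂ s rfl _ ht).2 k.symm⟩
          · refine localFix_two h₁.isWeighting hy₁ ?_ ?_
            · rw [h₁.mem _ (by simp), h₁.of_ne _ _ huy₁.symm hy₁.1.symm, h2]; omega
            · rw [h₁.mem _ (by simp), h₁.of_ne _ _ huy₁.symm hy₁.1.symm, h2,
                h₁.sum _ hy₁.1.symm (by simp [h₁g, h₁y₁, h₁y₂])]
              exact hb1
          · refine localFix_two h₁.isWeighting hy₂ ?_ ?_
            · rw [h₁.mem _ (by simp), h₁.of_ne _ _ huy₂.symm hy₂.1.symm, h3]; omega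
            · rw [h₁.mem _ (by simp), h₁.of_ne _ _ huy₂.symm hy₂.1.symm, h3,
                h₁.sum _ hy₂.1.symm (by simp [h₂g, h₂y₁, h₂y₂])]
              exact hc1)
        rcases (hn.2 p).mp hp with rfl | rfl | rfl
        exacts [hpg rfl, hp₁ rfl, hp₂ rfl]

end IsMinimalThreeBad

namespace IsMinimalThreeBad

/-! ### Vertices of degree four with an `α`-neighbour -/

theorem separated_alpha_alpha {v x₁ x₁' x₁'' x₂ x₂' x₂'' : V} (hx₁ : IsNbrs₂ G x₁ v x₁')
    (hx₁' : IsNbrs₂ G x₁' x₁ x₁'') (hx₂ : IsNbrs₂ G x₂ v x₂') (hx₂' : IsNbrs₂ G x₂' x₂ x₂'')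
    (hv : 3 ≤ deg G v) (h₁ : 3 ≤ deg G x₁'') (hne : x₁ ≠ x₂) (hnadj : ¬ G.Adj x₁ x₂) :
    Separated G {x₁, x₁'} {x₂, x₂'} := by
  have d₂ := hx₂.deg_eq
  have d₂' := hx₂'.deg_eq
  have e₂ : ¬ G.Adj x₁' x₂ := fun h => by
    rcases (hx₁'.2 x₂).mp h with rfl | rfl
    exacts [hne rfl, by omega]
  have e₃ : x₁' ≠ x₂' := by rintro rfl; exact e₂ hx₂.adj_right.symm
  have e₁ : ¬ G.Adj x₁ x₂' := fun h => by
    rcases (hx₁.2 x₂').mp h with rfl | rfl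
    exacts [by omega, e₃ rfl]
  rintro _ (rfl | rfl) _ (rfl | rfl)
  · exact ⟨hne, hnadj⟩
  · exact ⟨by rintro rfl; exact hnadj hx₂.adj_right.symm, e₁⟩
  · exact ⟨by rintro rfl; exact hnadj hx₁.adj_right, e₂⟩
  · refine ⟨e₃, fun h => ?_⟩
    rcases (hx₁'.2 _).mp h with rfl | rfl
    exacts [hnadj hx₂.adj_right.symm, by omega]

theorem not_configJ1 (hG : IsMinimalThreeBad G) : ¬ ConfigJ1 G := by
  classical
  rintro ⟨v, hv, hle⟩
  obtain ⟨x, y, hxy, hvx, hx, hvy, hy⟩ := two_le_card_filter hle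
  obtain ⟨z₁, z₂, hn⟩ := exists_nbrs₄' hv hvx hvy hxy
  obtain ⟨x', x'', hx₁, hx₂, hx₃⟩ := hG.exists_alpha_path (by omega) hvx hx
  obtain ⟨y', y'', hy₁, hy₂, hy₃⟩ := hG.exists_alpha_path (by omega) hvy hy
  have hvxn := G.ne_of_adj hvx
  have hvyn := G.ne_of_adj hvy
  by_cases hadj : G.Adj x y
  · obtain rfl : x' = y := by
      rcases (hx₁.2 y).mp hadj with h | h
      exacts [absurd h hvyn.symm, h.symm]
    obtain rfl : y' = x := by
      rcases (hy₁.2 x).mp hadj.symm with h | h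
      exacts [absurd h hvxn.symm, h.symm]
    obtain ⟨w, R, hw, -, h⟩ := hG.star₂ (v := v) (s := y') (t := x') {{y', x'}} hxy hvx hvy
      (by simp [hvxn, hvyn]) (sep_singleton _) (Or.inl ⟨_, rfl, by simp⟩)
      (Or.inl ⟨_, rfl, by simp⟩)
    have hnum : ∃ a b, (1 ≤ a ∧ a ≤ 3) ∧ (1 ≤ b ∧ b ≤ 3) ∧ a ≠ b ∧
        a + b + R ≠ vertexSum G w z₁ ∧ a + b + R ≠ vertexSum G w z₂ := by
      by_contra! h
      have h12 := h 1 2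
      have h13 := h 1 3
      have h23 := h 2 3
      omega
    obtain ⟨a, b, ha, hb, hab, h1, h2⟩ := hnum
    obtain ⟨u, hu, hua, hub, -, hs⟩ := h a b ha hb (by
      rintro w₁ f h1 h2 h₁ _ rfl
      refine localFix_triangle h₁.isWeighting hx₁ hy₁ ?_
      rwa [h₁.mem _ (by simp), h₁.mem _ (by simp), h1, h2])
    rcases (hn.2 u).mp hu with rfl | rfl | rfl | rfl
    exacts [hua rfl, hub rfl, by omega, by omega]
  · have hsep := separated_alpha_alpha hx₁ hx₂ hy₁ hy₂ (by omega) hx₃ hxy hadj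
    obtain ⟨w, R, hw, -, h⟩ := hG.star₂ (v := v) (s := x) (t := y) {{x, x'}, {y, y'}} hxy hvx hvy
      (by simp [hvxn, hvyn, hx₁.1, hy₁.1]) (sep_pair hsep) (Or.inl ⟨{x, x'}, by simp⟩)
      (Or.inl ⟨{y, y'}, by simp⟩)
    have hnum : ∃ a b, (1 ≤ a ∧ a ≤ 3) ∧ (1 ≤ b ∧ b ≤ 3) ∧ a ≠ w s(x', x'') ∧ b ≠ w s(y', y'') ∧
        a + b + R ≠ vertexSum G w z₁ ∧ a + b + R ≠ vertexSum G w z₂ := by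
      by_contra! h
      have h11 := h 1 1
      have h12 := h 1 2
      have h13 := h 1 3
      have h21 := h 2 1
      have h22 := h 2 2
      have h23 := h 2 3
      have h31 := h 3 1
      have h32 := h 3 2
      have h33 := h 3 3
      omega
    obtain ⟨a, b, ha, hb, ha', hb', h1, h2⟩ := hnum
    have hx'y := (hsep x' (by simp) y (by simp)).1
    have hxy' := (hsep x (by simp) y' (by simp)).1
    have hxx' := G.ne_of_adj hx₁.adj_right
    have hyy' := G.ne_of_adj hy₁.adj_right
    obtain ⟨u, hu, hua, hub, -, hs⟩ := h a b ha hb (by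
      rintro w₁ f h1 h2 h₁ _ (rfl | rfl)
      · refine localFix_alpha h₁.isWeighting hx₁ hx₂ ?_
        rwa [h₁.mem _ (by simp), h₁.left hx₁.1.symm (by simp [hxx'.symm, hx'y]), h1]
      · refine localFix_alpha h₁.isWeighting hy₁ hy₂ ?_
        rwa [h₁.mem _ (by simp), h₁.left hy₁.1.symm (by simp [hyy'.symm, hxy'.symm]), h2])
    rcases (hn.2 u).mp hu with rfl | rfl | rfl | rfl
    exacts [hua rfl, hub rfl, by omega, by omega]

theorem not_configJ2 (hG : IsMinimalThreeBad G) : ¬ ConfigJ2 G := by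
  classical
  rintro ⟨v, hv, ⟨x, y, hxy, hvx, hx, hvy, hy⟩, g, hvg, hg⟩
  have hgd := three_le_deg_of_isGamma hg
  have hxd := hx.1
  have hgx : g ≠ x := by rintro rfl; omega
  have hgy : g ≠ y := by rintro rfl; omega
  have hyα : ¬ IsAlpha G y := by
    intro hyα
    refine hG.not_configJ1 ⟨v, hv, ?_⟩
    rw [numNbrs]
    refine Finset.one_lt_card.mpr ⟨x, ?_, y, ?_, hxy⟩ <;>
      simp only [Finset.mem_filter, SimpleGraph.mem_neighborFinset]
    exacts [⟨hvx, hx⟩, ⟨hvy, hyα⟩]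
  obtain ⟨t, hn⟩ := exists_nbrs₄ hv hvx hvy hvg hxy hgx.symm hgy.symm
  obtain ⟨x', x'', hx₁, hx₂, hx₃⟩ := hG.exists_alpha_path (by omega) hvx hx
  obtain ⟨o, hy₁⟩ := exists_nbrs₂ hy hvy.symm
  have ho : 3 ≤ deg G o := hG.three_le_deg (Or.inl hy) hy₁.adj_right fun h =>
    hyα ⟨hy, o, hy₁.adj_right, h⟩
  have hx'd := hx₂.deg_eq
  have hvxn := G.ne_of_adj hvx
  have hvyn := G.ne_of_adj hvy
  have hvgn := G.ne_of_adj hvg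
  have hyx : ¬ G.Adj y x := fun h => hyα ⟨hy, x, h, hxd⟩
  have hyx' : ¬ G.Adj y x' := fun h => hyα ⟨hy, x', h, hx'd⟩
  have hy_ne_x' : y ≠ x' := by rintro rfl; exact hyx hx₁.adj_right.symm
  have hox : o ≠ x := by rintro rfl; omega
  have hoy : o ≠ y := (G.ne_of_adj hy₁.adj_right).symm
  have hxx' := G.ne_of_adj hx₁.adj_right
  have hx'g : x' ≠ g := by rintro rfl; omega
  by_cases hx''g : x'' = g
  · subst hx''g
    have hg3 := hG.deg_eq_three_of_isGamma hg hx₂.adj_right.symm hx'd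
    have hyg : ¬ G.Adj y x'' := fun h => hG.not_configC ⟨x'', hg3, x', y, hy_ne_x'.symm,
      hx₂.adj_right.symm, ⟨hx'd, x, hx₂.adj_left, hxd⟩, h.symm, hy⟩
    have hox'' : o ≠ x'' := by rintro rfl; exact hyg hy₁.adj_right
    -- the path through the `α`-neighbour `x` ends in `g`, which closes a `4`-cycle
    obtain ⟨r, hr⟩ := exists_nbrs₃ hg3 hvg.symm hx₂.adj_right.symm hx₁.1
    have hrg : r ≠ x'' := (G.ne_of_adj hr.adj₃).symm
    have hrx : r ≠ x := by
      rintro rfl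
      rcases (hx₁.2 x'').mp hr.adj₃.symm with k | k
      exacts [hvgn k.symm, hx'g k.symm]
    have hry : r ≠ y := by rintro rfl; exact hyg hr.adj₃.symm
    have hsep : Separated G {x, x', x''} {y} := by
      rintro _ (rfl | rfl | rfl) _ rfl
      exacts [⟨hxy, fun h => hyx h.symm⟩, ⟨hy_ne_x'.symm, fun h => hyx' h.symm⟩,
        ⟨hgy, fun h => hyg h.symm⟩]
    obtain ⟨w, R, hw, hR, -, h⟩ := hG.star₃ (v := v) (s := x) (t := y) (r := x'')
      {{x, x', x''}, {y}} hxy hgx.symm hgy.symm hvx hvy hvg (by simp [hvxn, hvyn, hvgn, hx₁.1])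
      (sep_pair hsep) (Or.inl ⟨{x, x', x''}, by simp⟩) (Or.inl ⟨{y}, by simp⟩)
      (Or.inl ⟨{x, x', x''}, by simp⟩)
    obtain ⟨c, hc, hc'⟩ := gamma_alpha_exists (w s(x'', r)) 3 (vertexSum G w r)
    obtain ⟨b, hb, hb1, hb2⟩ := exists_avoid₂ (w s(y, o)) (vertexSum G w o) (3 + c + R)
      (vertexSum G w t)
    have hm := hw _ _ hy₁.adj_right
    obtain ⟨u, hu, hua, hub, huc, -, hs⟩ := h 3 b c (by omega) hb hc (by
      rintro w₁ f h1 h2 h3 h₁ _ (rfl | rfl)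
      · refine localFix_fourCycle h₁.isWeighting hx₁ hx₂ hr ?_
        rw [h₁.mem _ (by simp), h₁.mem _ (by simp), h1, h3,
          h₁.of_ne _ _ hvgn.symm hr.1.2.1.symm, h₁.sum r hr.1.2.1.symm (by simp [hrg, hrx, hry])]
        exact hc' _
      · refine localFix_two h₁.isWeighting hy₁ ?_ ?_
        · rw [h₁.mem _ (by simp), h₁.of_ne _ _ hvyn.symm hy₁.1.symm, h2]; omega
        · rw [h₁.mem _ (by simp), h₁.of_ne _ _ hvyn.symm hy₁.1.symm, h2,
            h₁.sum _ hy₁.1.symm (by simp [hox, hoy, hox''])]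
          exact hb1)
    rcases (hn.2 u).mp hu with rfl | rfl | rfl | rfl
    exacts [hua rfl, hub rfl, huc rfl, by omega]
  have hsepx : Separated G {x, x'} (gammaSet G g) :=
    separated_gammaSet_alpha hx₁ hx₂ hvgn (by omega) hx''g hx₃ hgd
  have hvset : v ∉ gammaSet G g := notMem_gammaSet hvgn (by omega)
  by_cases hog : o = g
  · subst hog
    -- `y` is adjacent to the `γ`-vertex and hence belongs to its gadget; the edge from `v` to `y` is kept
    obtain ⟨w, R, hw, -, h⟩ := hG.star₂ (v := v) (s := x) (t := o) {{x, x'}, gammaSet G o}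
      hgx.symm hvx hvg (by simp [hvset, hvxn, hx₁.1]) (sep_pair hsepx)
      (Or.inl ⟨{x, x'}, by simp⟩) (Or.inl ⟨gammaSet G o, by simp, self_mem_gammaSet o⟩)
    obtain ⟨P, -, ⟨c, hc, hPc⟩, -, hP⟩ := hG.gamma_repair hg hvg.symm (by omega) hw
    obtain ⟨a, ha, ha1, ha2⟩ := exists_avoid₂ 0 (w s(x', x'')) (c + R) (vertexSum G w t)
    obtain ⟨u, hu, hua, hub, huT, hs⟩ := h a c ha hc (by
      rintro w₁ f h1 h2 h₁ _ (rfl | rfl)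
      · refine localFix_alpha h₁.isWeighting hx₁ hx₂ ?_
        rw [h₁.mem _ (by simp), h₁.left hx₁.1.symm (by simp [hxx'.symm, hx'g]), h1]
        omega
      · refine hP _ f w₁ _ h₁ (by simp) ?_ (by rw [h2]; exact hPc _)
        intro s hs hsg
        obtain rfl : s = x := by simpa [hsg] using hs
        exact ⟨fun h => (hsepx s (by simp) _ h).1 rfl,
          fun t ht k => (hsepx s (by simp) _ ht).2 k.symm⟩)
    rcases (hn.2 u).mp hu with rfl | rfl | rfl | rfl
    · exact hua rfl
    · exact huT _ (Or.inr rfl) (Or.inr (Or.inl ⟨hy₁.adj_right.symm, hy.le⟩))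
    · exact hub rfl
    · omega
  · have hsepy : Separated G {y} (gammaSet G g) :=
      separated_gammaSet_two hy₁ hvgn (by omega) hog ho hgd
    have hsepxy : Separated G {x, x'} {y} := by
      rintro _ (rfl | rfl) _ rfl
      exacts [⟨hxy, fun h => hyx h.symm⟩, ⟨hy_ne_x'.symm, fun h => hyx' h.symm⟩]
    obtain ⟨w, R, hw, -, -, h⟩ := hG.star₃ (v := v) (s := x) (t := y) (r := g)
      {{x, x'}, {y}, gammaSet G g} hxy hgx.symm hgy.symm hvx hvy hvg
      (by simp [hvset, hvxn, hvyn, hx₁.1]) (sep_triple hsepxy hsepx hsepy)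
      (Or.inl ⟨{x, x'}, by simp⟩) (Or.inl ⟨{y}, by simp⟩)
      (Or.inl ⟨gammaSet G g, by simp, self_mem_gammaSet g⟩)
    obtain ⟨P, -, ⟨c, hc, hPc⟩, -, hP⟩ := hG.gamma_repair hg hvg.symm (by omega) hw
    obtain ⟨a, ha, ha1, ha2⟩ := exists_avoid₂ 0 (w s(x', x'')) (c + R) (w s(y, o))
    obtain ⟨b, hb, hb1, hb2⟩ := exists_avoid₂ (w s(y, o)) (vertexSum G w o) (a + c + R)
      (vertexSum G w t)
    obtain ⟨u, hu, hua, hub, huc, -, hs⟩ := h a b c ha hb hc (by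
      rintro w₁ f h1 h2 h3 h₁ _ (rfl | rfl | rfl)
      · refine localFix_alpha h₁.isWeighting hx₁ hx₂ ?_
        rw [h₁.mem _ (by simp), h₁.left hx₁.1.symm (by simp [hxx'.symm, hx'g, hy_ne_x'.symm]), h1]
        omega
      · refine localFix_two h₁.isWeighting hy₁ ?_ ?_
        · rw [h₁.mem _ (by simp), h₁.of_ne _ _ hvyn.symm hy₁.1.symm, h2]; omega
        · rw [h₁.mem _ (by simp), h₁.of_ne _ _ hvyn.symm hy₁.1.symm, h2,
            h₁.sum _ hy₁.1.symm (by simp [hox, hoy, hog])]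
          exact hb1
      · refine hP _ f w₁ _ h₁ (by simp) ?_ (by rw [h3]; exact hPc _)
        intro s hs hsg
        have hs' : s = x ∨ s = y := by simpa [hsg] using hs
        rcases hs' with rfl | rfl
        · exact ⟨fun h => (hsepx s (by simp) _ h).1 rfl,
            fun t ht k => (hsepx s (by simp) _ ht).2 k.symm⟩
        · exact ⟨fun h => (hsepy s rfl _ h).1 rfl, fun t ht k => (hsepy s rfl _ ht).2 k.symm⟩)
    rcases (hn.2 u).mp hu with rfl | rfl | rfl | rfl
    exacts [hua rfl, hub rfl, huc rfl, by omega]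

end IsMinimalThreeBad

/-! ### Arithmetic of the gadgets at `β`-vertices -/

/-- At a `β`-vertex, a weight `a` towards `v` is blocked by at most one sum at `v`. -/
theorem beta_exists_bad (a p m k l : ℕ) : ∃ A₀, ∀ A, A ≠ A₀ →
    ∃ b, (1 ≤ b ∧ b ≤ 3) ∧ b + m ≠ k ∧ a + b + p ≠ l ∧ a + b + p ≠ A := by
  obtain ⟨b, hb, h1, h2⟩ := exists_avoid₂ m k (a + p) l
  exact ⟨a + b + p, fun A hA => ⟨b, hb, h1, by omega, hA.symm⟩⟩

/-- The weights `f` for a leaf and `a`, `b` for two `β`-vertices, where `α` and `β` describe the sums that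
block `a` and `b`, and `k` is the sum of the only neighbour that is not touched. -/
theorem leaf_two_betas (R m₁ m₂ p₁ p₂ k : ℕ) (α β : ℕ → ℕ) :
    ∃ f a b, (1 ≤ f ∧ f ≤ 3) ∧ (1 ≤ a ∧ a ≤ 3) ∧ (1 ≤ b ∧ b ≤ 3) ∧ a + p₁ ≠ m₁ ∧ b + p₂ ≠ m₂ ∧
      f + a + b + R ≠ α a ∧ f + a + b + R ≠ β b ∧ f + a + b + R ≠ k := by
  obtain ⟨a, a', ⟨ha, haa', ha'⟩, h1, h2⟩ := exists_pair_avoid p₁ m₁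
  obtain ⟨b, b', ⟨hb, hbb', hb'⟩, h3, h4⟩ := exists_pair_avoid p₂ m₂
  by_contra! h
  -- if a pair of weights fails, then the three forbidden values fill the window of possible sums
  have key : ∀ s t, (1 ≤ s ∧ s ≤ 3) → (1 ≤ t ∧ t ≤ 3) → s + p₁ ≠ m₁ → t + p₂ ≠ m₂ →
      (s + t + R < α s ∧ α s ≤ s + t + R + 3) ∧ (s + t + R < β t ∧ β t ≤ s + t + R + 3) ∧
      (s + t + R < k ∧ k ≤ s + t + R + 3) ∧ α s ≠ β t ∧ α s ≠ k ∧ β t ≠ k := by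
    intro s t hs ht hs' ht'
    have e1 := h 1 s t (by omega) hs ht hs' ht'
    have e2 := h 2 s t (by omega) hs ht hs' ht'
    have e3 := h 3 s t (by omega) hs ht hs' ht'
    omega
  have c1 := key a b (by omega) (by omega) h1 h3
  have c2 := key a' b (by omega) (by omega) h2 h3
  have c3 := key a b' (by omega) (by omega) h1 h4
  omega

/-- The weights `f` for an `α`-vertex and `a`, `b` for two `β`-vertices, when no neighbour is left
untouched. -/
theorem alpha_two_betas (m m₁ m₂ p₁ p₂ : ℕ) (α β : ℕ → ℕ) :
    ∃ f a b, (1 ≤ f ∧ f ≤ 3) ∧ (1 ≤ a ∧ a ≤ 3) ∧ (1 ≤ b ∧ b ≤ 3) ∧ f ≠ m ∧ a + p₁ ≠ m₁ ∧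
      b + p₂ ≠ m₂ ∧ f + a + b ≠ α a ∧ f + a + b ≠ β b := by
  obtain ⟨a, a', ⟨ha, haa', ha'⟩, h1, h2⟩ := exists_pair_avoid p₁ m₁
  obtain ⟨b, b', ⟨hb, hbb', hb'⟩, h3, h4⟩ := exists_pair_avoid p₂ m₂
  obtain ⟨f, f', ⟨hf, hff', hf'⟩, h5, h6⟩ := exists_pair_avoid 0 m
  by_contra! h
  have c1 := h f a b (by omega) (by omega) (by omega) h5 h1 h3
  have c2 := h f a' b (by omega) (by omega) (by omega) h5 h2 h3
  have c3 := h f a b' (by omega) (by omega) (by omega) h5 h1 h4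
  have d1 := h f' a b (by omega) (by omega) (by omega) h6 h1 h3
  have d2 := h f' a' b (by omega) (by omega) (by omega) h6 h2 h3
  have d3 := h f' a b' (by omega) (by omega) (by omega) h6 h1 h4
  omega

/-- The weights `b₁` and `b₂` of the edges from two adjacent `β`-vertices to their `2`-neighbours. -/
theorem adjacent_betas_of_ne (a c d m₁ m₂ k₁ k₂ A : ℕ)
    (hne : 2 * a + k₂ + m₁ ≠ 2 * c + k₁ + m₂) :
    ∃ b₁ b₂, (1 ≤ b₁ ∧ b₁ ≤ 3) ∧ (1 ≤ b₂ ∧ b₂ ≤ 3) ∧ b₁ + m₁ ≠ k₁ ∧ b₂ + m₂ ≠ k₂ ∧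
      a + b₁ ≠ c + b₂ ∧ a + b₁ + d ≠ A ∧ c + b₂ + d ≠ A := by
  -- unless both `b₁` and `b₂` are forced, one of them can be chosen to avoid the other sum
  by_cases h₁ : ∃ b b', (1 ≤ b ∧ b < b' ∧ b' ≤ 3) ∧ b + m₁ ≠ k₁ ∧ b' + m₁ ≠ k₁ ∧
      a + b + d ≠ A ∧ a + b' + d ≠ A
  · obtain ⟨b, b', hb, h1, h2, h3, h4⟩ := h₁
    obtain ⟨e, he, h5, h6⟩ := exists_avoid₂ m₂ k₂ (c + d) A
    by_cases h : a + b = c + e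
    · exact ⟨b', e, by omega, he, h2, h5, by omega, h4, by omega⟩
    · exact ⟨b, e, by omega, he, h1, h5, h, h3, by omega⟩
  by_cases h₂ : ∃ b b', (1 ≤ b ∧ b < b' ∧ b' ≤ 3) ∧ b + m₂ ≠ k₂ ∧ b' + m₂ ≠ k₂ ∧
      c + b + d ≠ A ∧ c + b' + d ≠ A
  · obtain ⟨b, b', hb, h1, h2, h3, h4⟩ := h₂
    obtain ⟨e, he, h5, h6⟩ := exists_avoid₂ m₁ k₁ (a + d) A
    by_cases h : a + e = c + b
    · exact ⟨e, b', he, by omega, h5, h2, by omega, by omega, h4⟩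
    · exact ⟨e, b, he, by omega, h5, h1, h, by omega, h3⟩
  obtain ⟨b, hb, h1, h2⟩ := exists_avoid₂ m₁ k₁ (a + d) A
  obtain ⟨e, he, h3, h4⟩ := exists_avoid₂ m₂ k₂ (c + d) A
  refine ⟨b, e, hb, he, h1, h3, fun heq => ?_, by omega, by omega⟩
  push Not at h₁ h₂
  have e1 := h₁ 1 2
  have e2 := h₁ 1 3
  have e3 := h₁ 2 3
  have f1 := h₂ 1 2
  have f2 := h₂ 1 3
  have f3 := h₂ 2 3
  clear h₁ h₂
  -- the two other values of `b₁` are `k₁ - m₁` and `A - a - d`, and similarly for `b₂`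
  have s1 : b + k₁ + A = 6 + m₁ + a + d := by omega
  have s2 : e + k₂ + A = 6 + m₂ + c + d := by omega
  omega

/-- Two adjacent `β`-neighbours of `v` can be given weights towards `v` that no sum `A` at `v` blocks. -/
theorem adjacent_betas (d m₁ m₂ k₁ k₂ : ℕ) (hd : 1 ≤ d) (hm₂ : m₂ ≤ 3) :
    ∃ a c, (1 ≤ a ∧ a ≤ 3) ∧ (1 ≤ c ∧ c ≤ 3) ∧ a + d ≠ m₁ ∧ c + d ≠ m₂ ∧ ∀ A,
      ∃ b₁ b₂, (1 ≤ b₁ ∧ b₁ ≤ 3) ∧ (1 ≤ b₂ ∧ b₂ ≤ 3) ∧ b₁ + m₁ ≠ k₁ ∧ b₂ + m₂ ≠ k₂ ∧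
        a + b₁ ≠ c + b₂ ∧ a + b₁ + d ≠ A ∧ c + b₂ + d ≠ A := by
  obtain ⟨a, a', ⟨ha, haa', ha'⟩, h1, h2⟩ := exists_pair_avoid d m₁
  by_cases h : 2 * a + k₂ + m₁ = 2 * 3 + k₁ + m₂
  · exact ⟨a', 3, by omega, by omega, h2, by omega, fun A =>
      adjacent_betas_of_ne _ _ _ _ _ _ _ _ (by omega)⟩
  · exact ⟨a, 3, by omega, by omega, h1, by omega, fun A => adjacent_betas_of_ne _ _ _ _ _ _ _ _ h⟩

theorem exists_common_of_rows {p₂₂ p₂₃ p₃₂ p₃₃ q₂₂ q₂₃ q₃₂ q₃₃ : Prop} (r₂ : p₂₂ ∨ p₂₃)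
    (r₃ : p₃₂ ∨ p₃₃) (s₂ : q₂₂ ∨ q₂₃) (s₃ : q₃₂ ∨ q₃₃) (c₂ : p₂₂ ∨ p₃₂) (c₃ : p₂₃ ∨ p₃₃)
    (d₂ : q₂₂ ∨ q₃₂) (d₃ : q₂₃ ∨ q₃₃) (x : p₂₃ ∨ p₃₂) (y : q₂₃ ∨ q₃₂) :
    (p₂₂ ∧ q₂₂) ∨ (p₂₃ ∧ q₃₂) ∨ (p₃₂ ∧ q₂₃) ∨ (p₃₃ ∧ q₃₃) := by
  by_cases p₂₂ <;> by_cases p₂₃ <;> by_cases p₃₂ <;> by_cases p₃₃ <;> simp_all <;> tauto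

/-- The weights of the two edges at a `2`-vertex whose neighbours both have a further `2`-neighbour; the
sum at the `2`-vertex is `b + c`. -/
theorem two_betas (a₁ a₂ m₁ m₂ k₁ k₂ l₁ l₂ : ℕ) (ha₁ : 1 ≤ a₁) (ha₂ : 1 ≤ a₂) :
    ∃ b c, (1 ≤ b ∧ b ≤ 3) ∧ (1 ≤ c ∧ c ≤ 3) ∧ b + a₁ ≠ m₁ ∧ c + a₂ ≠ m₂ ∧
      (∃ e, (1 ≤ e ∧ e ≤ 3) ∧ e + m₁ ≠ k₁ ∧ b + e + a₁ ≠ l₁ ∧ b + e + a₁ ≠ b + c) ∧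
      (∃ e, (1 ≤ e ∧ e ≤ 3) ∧ e + m₂ ≠ k₂ ∧ c + e + a₂ ≠ l₂ ∧ c + e + a₂ ≠ b + c) := by
  -- `P a m k l b c` is the condition on one side; it holds for `c = 1`, and among the pairs of
  -- `b, c ∈ {2, 3}` it fails at most once, except that it may fail for both pairs with `b = c`
  let P : ℕ → ℕ → ℕ → ℕ → ℕ → ℕ → Prop := fun a m k l b c =>
    ∃ e, (1 ≤ e ∧ e ≤ 3) ∧ e + m ≠ k ∧ b + e + a ≠ l ∧ e + a ≠ c
  have hone : ∀ a m k l b, 1 ≤ a → P a m k l b 1 := by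
    intro a m k l b ha
    obtain ⟨e, he, h1, h2⟩ := exists_avoid₂ m k (b + a) l
    exact ⟨e, he, h1, by omega, by omega⟩
  have hrow : ∀ a m k l b c c', c ≠ c' → P a m k l b c ∨ P a m k l b c' := by
    intro a m k l b c c' hc
    obtain ⟨e, he, h1, h2⟩ := exists_avoid₂ m k (b + a) l
    by_cases h : e + a = c
    · exact Or.inr ⟨e, he, h1, by omega, by omega⟩
    · exact Or.inl ⟨e, he, h1, by omega, h⟩
  have hcol : ∀ a m k l c, P a m k l 2 c ∨ P a m k l 3 c := by
    intro a m k l c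
    by_contra! h
    simp only [P] at h
    push Not at h
    have h1 := h.1 1
    have h2 := h.1 2
    have h3 := h.1 3
    have h1' := h.2 1
    have h2' := h.2 2
    have h3' := h.2 3
    omega
  have hdiag : ∀ a m k l, P a m k l 2 3 ∨ P a m k l 3 2 := by
    intro a m k l
    by_contra! h
    simp only [P] at h
    push Not at h
    have h1 := h.1 1
    have h2 := h.1 2
    have h3 := h.1 3
    have h1' := h.2 1
    have h2' := h.2 2
    have h3' := h.2 3
    omega
  suffices ∃ b c, (1 ≤ b ∧ b ≤ 3) ∧ (1 ≤ c ∧ c ≤ 3) ∧ b + a₁ ≠ m₁ ∧ c + a₂ ≠ m₂ ∧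
      P a₁ m₁ k₁ l₁ b c ∧ P a₂ m₂ k₂ l₂ c b by
    obtain ⟨b, c, hb, hc, h1, h2, ⟨e, he, e1, e2, e3⟩, ⟨e', he', e1', e2', e3'⟩⟩ := this
    exact ⟨b, c, hb, hc, h1, h2, ⟨e, he, e1, e2, by omega⟩, ⟨e', he', e1', e2', by omega⟩⟩
  by_cases h₁ : 1 + a₁ = m₁
  · by_cases h₂ : 1 + a₂ = m₂
    · have r22 := hrow a₁ m₁ k₁ l₁ 2 2 3 (by omega)
      have r33 := hrow a₁ m₁ k₁ l₁ 3 2 3 (by omega)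
      have s22 := hrow a₂ m₂ k₂ l₂ 2 2 3 (by omega)
      have s33 := hrow a₂ m₂ k₂ l₂ 3 2 3 (by omega)
      have c2 := hcol a₁ m₁ k₁ l₁ 2
      have c3 := hcol a₁ m₁ k₁ l₁ 3
      have d2 := hcol a₂ m₂ k₂ l₂ 2
      have d3 := hcol a₂ m₂ k₂ l₂ 3
      have x := hdiag a₁ m₁ k₁ l₁
      have y := hdiag a₂ m₂ k₂ l₂
      have : (P a₁ m₁ k₁ l₁ 2 2 ∧ P a₂ m₂ k₂ l₂ 2 2) ∨ (P a₁ m₁ k₁ l₁ 2 3 ∧ P a₂ m₂ k₂ l₂ 3 2) ∨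
          (P a₁ m₁ k₁ l₁ 3 2 ∧ P a₂ m₂ k₂ l₂ 2 3) ∨ (P a₁ m₁ k₁ l₁ 3 3 ∧ P a₂ m₂ k₂ l₂ 3 3) :=
        exists_common_of_rows r22 r33 s22 s33 c2 c3 d2 d3 x y
      rcases this with h | h | h | h
      · exact ⟨2, 2, by omega, by omega, by omega, by omega, h⟩
      · exact ⟨2, 3, by omega, by omega, by omega, by omega, h⟩
      · exact ⟨3, 2, by omega, by omega, by omega, by omega, h⟩
      · exact ⟨3, 3, by omega, by omega, by omega, by omega, h⟩
    · rcases hrow a₂ m₂ k₂ l₂ 1 2 3 (by omega) with h | h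
      · exact ⟨2, 1, by omega, by omega, by omega, h₂, hone _ _ _ _ _ ha₁, h⟩
      · exact ⟨3, 1, by omega, by omega, by omega, h₂, hone _ _ _ _ _ ha₁, h⟩
  · by_cases h₂ : 1 + a₂ = m₂
    · rcases hrow a₁ m₁ k₁ l₁ 1 2 3 (by omega) with h | h
      · exact ⟨1, 2, by omega, by omega, h₁, by omega, h, hone _ _ _ _ _ ha₂⟩
      · exact ⟨1, 3, by omega, by omega, h₁, by omega, h, hone _ _ _ _ _ ha₂⟩
    · exact ⟨1, 1, by omega, by omega, h₁, h₂, hone _ _ _ _ _ ha₁, hone _ _ _ _ _ ha₂⟩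

/-! ### Neighbours of degree three with one `2`-neighbour -/

/-- `g` is a `3`-vertex with neighbours `v`, `y`, `z`, where `y` is a `2`-vertex whose other neighbour
is `o`, and `z` and `o` have degree at least three. This describes a `β`-neighbour `g` of `v` that is
not a `γ`-vertex, but also a `γ`-neighbour `g` of a `2`-vertex `v`. -/
structure IsBetaNbr (G : SimpleGraph V) (v g y z o : V) : Prop where
  nbrs : IsNbrs₃ G g v y z
  nbrs' : IsNbrs₂ G y g o
  deg_z : 3 ≤ deg G z
  deg_o : 3 ≤ deg G o

namespace IsBetaNbr

variable {v g h y z o u t o' : V}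

theorem deg_g (hg : IsBetaNbr G v g y z o) : deg G g = 3 := hg.nbrs.deg_eq
theorem deg_y (hg : IsBetaNbr G v g y z o) : deg G y = 2 := hg.nbrs'.deg_eq
theorem ne_g (hg : IsBetaNbr G v g y z o) : g ≠ v := G.ne_of_adj hg.nbrs.adj₁
theorem ne_y (hg : IsBetaNbr G v g y z o) : v ≠ y := hg.nbrs.1.1

/-- The only `2`-neighbour of `g` besides `v` is `y`. -/
theorem eq_of_adj (hg : IsBetaNbr G v g y z o) {x : V} (hgx : G.Adj g x) (hxv : x ≠ v)
    (hx : deg G x = 2) : x = y := by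
  rcases (hg.nbrs.2 x).mp hgx with rfl | rfl | rfl
  · exact absurd rfl hxv
  · rfl
  · have := hg.deg_z; omega

/-- If the `2`-neighbour of `g` is adjacent to `h`, then it is also the `2`-neighbour of `h`. -/
theorem shared (hg : IsBetaNbr G v g y z h) (hh : IsBetaNbr G v h u t o') :
    u = y ∧ o' = g := by
  have hy : y = u := hh.eq_of_adj hg.nbrs'.adj_right.symm hg.ne_y.symm hg.deg_y
  subst hy
  refine ⟨rfl, ?_⟩
  rcases (hg.nbrs'.2 o').mp hh.nbrs'.adj_right with k | k
  · exact k
  · exact absurd k.symm hh.nbrs'.1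

theorem eq_of_adj_g (hg : IsBetaNbr G v g y z o) (hh : 3 ≤ deg G h) (hhv : h ≠ v)
    (hadj : G.Adj g h) : z = h := by
  rcases (hg.nbrs.2 h).mp hadj with k | k | k
  · exact absurd k hhv
  · subst k; have := hg.deg_y; omega
  · exact k.symm

theorem separated (hg : IsBetaNbr G v g y z o) (hh : IsBetaNbr G v h u t o') (hne : g ≠ h)
    (hnadj : ¬ G.Adj g h) (hoh : o ≠ h) : Separated G {g, y} {h, u} := by
  have d1 := hg.deg_g
  have d2 := hg.deg_y
  have d3 := hh.deg_g
  have d4 := hh.deg_y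
  have d5 := hg.deg_o
  have hyh : ¬ G.Adj y h := fun k => by
    rcases (hg.nbrs'.2 h).mp k with k | k
    exacts [hne k.symm, hoh k.symm]
  have hyu : y ≠ u := by rintro rfl; exact hyh hh.nbrs'.adj_left
  rintro _ (rfl | rfl) _ (rfl | rfl)
  · exact ⟨hne, hnadj⟩
  · exact ⟨by rintro rfl; omega, fun k => hyu (hg.eq_of_adj k hh.ne_y.symm d4).symm⟩
  · exact ⟨by rintro rfl; omega, hyh⟩
  · refine ⟨hyu, fun k => ?_⟩
    rcases (hg.nbrs'.2 _).mp k with rfl | rfl <;> omega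

theorem separated_alpha (hg : IsBetaNbr G v g y z o) {x x' x'' : V} (hx : IsNbrs₂ G x v x')
    (hx' : IsNbrs₂ G x' x x'') (hx'' : x'' ≠ g) : Separated G {x, x'} {g, y} := by
  have d1 := hg.deg_g
  have d2 := hg.deg_y
  have d3 := hg.deg_o
  have d4 := hx.deg_eq
  have d5 := hx'.deg_eq
  have hxg : ¬ G.Adj x g := fun k => by
    rcases (hx.2 g).mp k with rfl | rfl
    exacts [hg.ne_g rfl, by omega]
  have hx'g : ¬ G.Adj x' g := fun k => by
    rcases (hx'.2 g).mp k with rfl | rfl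
    exacts [by omega, hx'' rfl]
  have hy : ∀ p, deg G p = 2 → ¬ G.Adj y p := fun p hp k => by
    rcases (hg.nbrs'.2 p).mp k with rfl | rfl <;> omega
  rintro _ (rfl | rfl) _ (rfl | rfl)
  · exact ⟨by rintro rfl; omega, hxg⟩
  · exact ⟨by rintro rfl; exact hxg hg.nbrs.adj₂.symm, fun k => hy _ d4 k.symm⟩
  · exact ⟨by rintro rfl; omega, hx'g⟩
  · exact ⟨by rintro rfl; exact hx'g hg.nbrs.adj₂.symm, fun k => hy _ d5 k.symm⟩

theorem separated_two (hg : IsBetaNbr G v g y z o) {x : V} (hx : deg G x = 2) (hxv : x ≠ v)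
    (hxy : x ≠ y) : Separated G {g, y} {x} := by
  have d1 := hg.deg_g
  have d2 := hg.deg_o
  rintro _ (rfl | rfl) _ rfl
  · exact ⟨by rintro rfl; omega, fun k => hxy (hg.eq_of_adj k hxv hx)⟩
  · refine ⟨hxy.symm, fun k => ?_⟩
    rcases (hg.nbrs'.2 _).mp k with rfl | rfl <;> omega

theorem localFix (hg : IsBetaNbr G v g y z o) {w w₁ : Sym2 V → ℕ} {S : Finset V} {f : V → ℕ} {A : ℕ}
    (h₁ : IsStarChange G w w₁ v S f) (hgS : g ∈ S) (hyS : y ∉ S) (hzS : z ∉ S) (hoS : o ∉ S)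
    (hov : o ≠ v) (hm : f g + w s(g, z) ≠ w s(y, o))
    (h : ∃ b, (1 ≤ b ∧ b ≤ 3) ∧ b + w s(y, o) ≠ vertexSum G w o ∧
      f g + b + w s(g, z) ≠ vertexSum G w z ∧ f g + b + w s(g, z) ≠ A) :
    LocalFix G w₁ {g, y} v A := by
  have hzv := hg.nbrs.1.2.1.symm
  have e1 : w₁ s(y, o) = w s(y, o) := h₁.left hg.ne_y.symm hyS o
  have e2 : w₁ s(g, z) = w s(g, z) := h₁.of_ne _ _ hg.ne_g hzv
  refine localFix_beta h₁.isWeighting hg.nbrs hg.nbrs' ?_ ?_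
  · rwa [h₁.mem g hgS, e1, e2]
  · rwa [h₁.mem g hgS, e1, e2, h₁.sum z hzv hzS, target_of_ne hov, h₁.sum o hov hoS]

end IsBetaNbr

namespace IsMinimalThreeBad

theorem exists_isBetaNbr (hG : IsMinimalThreeBad G) {v g : V} (hv : 3 ≤ deg G v)
    (hgv : G.Adj g v) (hβ : IsBeta G g) (hγ : ¬ IsGamma G g) : ∃ y z o, IsBetaNbr G v g y z o := by
  classical
  obtain ⟨hg, y, hgy, hy⟩ := hβ
  obtain ⟨z, hn⟩ := exists_nbrs₃ hg hgv hgy (by rintro rfl; omega)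
  obtain ⟨o, ho⟩ := exists_nbrs₂ hy hgy.symm
  refine ⟨y, z, o, hn, ho, hG.three_le_deg (Or.inr hg) hn.adj₃ fun hz => hγ (Or.inr ⟨hg, Or.inr ?_⟩),
    hG.three_le_deg (Or.inl hy) ho.adj_right fun h =>
      hγ (Or.inr ⟨hg, Or.inl ⟨y, hgy, hy, o, ho.adj_right, h⟩⟩)⟩
  rw [numNbrs]
  refine Finset.one_lt_card.mpr ⟨y, ?_, z, ?_, hn.1.2.2⟩ <;>
    simp only [Finset.mem_filter, SimpleGraph.mem_neighborFinset]
  exacts [⟨hgy, hy⟩, ⟨hn.adj₃, hz⟩]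

/-- Re-weighting both edges at a `2`-vertex. -/
theorem star_nbrs₂ [DecidableEq V] (hG : IsMinimalThreeBad G) {v s t : V} (hv : IsNbrs₂ G v s t)
    (𝒯 : Set (Set V)) (hvT : ∀ T ∈ 𝒯, v ∉ T)
    (hsep : ∀ T ∈ 𝒯, ∀ T' ∈ 𝒯, T ≠ T' → Separated G T T')
    (hs : ∃ T ∈ 𝒯, s ∈ T) (ht : ∃ T ∈ 𝒯, t ∈ T) :
    ∃ w, IsWeighting G w ∧ ∀ a b, (1 ≤ a ∧ a ≤ 3) → (1 ≤ b ∧ b ≤ 3) →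
      ¬ ∀ w₁ f, f s = a → f t = b → IsStarChange G w w₁ v {s, t} f →
        ∀ T ∈ 𝒯, LocalFix G w₁ T v (a + b) := by
  obtain ⟨w, R, hw, hR, h⟩ := hG.star' (S := {s, t}) 𝒯 (by simp)
    (by simp [hv.adj_left, hv.adj_right]) hv.deg_eq.ge hvT hsep (by simp [hs, ht])
  rw [hv.nbrs_eq, Finset.sdiff_self, Finset.sum_empty] at hR
  subst hR
  refine ⟨w, hw, fun a b ha hb hT => ?_⟩
  have hs' : ∑ x ∈ ({s, t} : Finset V), (if x = s then a else b) = a + b := by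
    rw [Finset.sum_pair hv.1, if_pos rfl, if_neg hv.1.symm]
  obtain ⟨u, hu, huS, -⟩ := h (fun x => if x = s then a else b) (by simp [ha, hv.1.symm, hb])
    (fun w₁ h₁ => by
      rw [hs', add_zero]
      exact hT w₁ (fun x => if x = s then a else b) (if_pos rfl) (if_neg hv.1.symm) h₁)
  exact huS (by simpa using (hv.2 u).mp hu)

/-- The `2`-vertex `v` is adjacent to the `γ`-vertex `g`, which has another `2`-neighbour. -/
theorem exists_isBetaNbr_of_gamma (hG : IsMinimalThreeBad G) {v g : V} (hgv : G.Adj g v)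
    (hv : deg G v = 2) (hvα : ¬ IsAlpha G v) (hγ : IsGamma G g) :
    ∃ y z o, IsBetaNbr G v g y z o := by
  have hg := hG.deg_eq_three_of_isGamma hγ hgv hv
  have hα : ∀ x, G.Adj g x → ¬ IsAlpha G x := fun x hgx hx =>
    hG.not_configC ⟨g, hg, x, v, by rintro rfl; exact hvα hx, hgx, hx, hgv, hv⟩
  obtain ⟨y, hyv, hgy, hy⟩ : ∃ y, y ≠ v ∧ G.Adj g y ∧ deg G y = 2 := by
    rcases hγ with ⟨h, -⟩ | ⟨-, ⟨x, hgx, hx⟩ | h⟩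
    · omega
    · exact absurd hx (hα x hgx)
    · obtain ⟨p, q, hpq, hgp, hp, hgq, hq⟩ := two_le_card_filter h
      by_cases hpv : p = v
      · exact ⟨q, by rintro rfl; exact hpq hpv, hgq, hq⟩
      · exact ⟨p, hpv, hgp, hp⟩
  obtain ⟨z, hn⟩ := exists_nbrs₃ hg hgv hgy hyv.symm
  obtain ⟨o, ho⟩ := exists_nbrs₂ hy hgy.symm
  refine ⟨y, z, o, hn, ho, hG.three_le_deg (Or.inr hg) hn.adj₃ fun hz => ?_,
    hG.three_le_deg (Or.inl hy) ho.adj_right fun h => hα y hgy ⟨hy, o, ho.adj_right, h⟩⟩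
  refine hG.not_configB ⟨g, by omega, fun x hx => ?_⟩
  rcases (hn.2 x).mp hx with rfl | rfl | rfl
  exacts [hv, hy, hz]

/-- A `2`-vertex has at most one `γ`-neighbour. -/
theorem not_two_gamma (hG : IsMinimalThreeBad G) {v g h : V} (hv : IsNbrs₂ G v g h)
    (hg : IsGamma G g) (hh : IsGamma G h) : False := by
  classical
  have hvd := hv.deg_eq
  have hvα : ¬ IsAlpha G v := by
    rintro ⟨-, x, hx, hxd⟩
    have := three_le_deg_of_isGamma hg
    have := three_le_deg_of_isGamma hh
    rcases (hv.2 x).mp hx with rfl | rfl <;> omega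
  have hnadj : ¬ G.Adj g h := fun k => hG.not_configF ⟨g, h, k, hg, hh⟩
  obtain ⟨y, z, o, hg'⟩ := hG.exists_isBetaNbr_of_gamma hv.adj_left.symm hvd hvα hg
  obtain ⟨u, t, o', hh'⟩ := hG.exists_isBetaNbr_of_gamma hv.adj_right.symm hvd hvα hh
  by_cases hoh : o = h
  · subst hoh
    obtain ⟨rfl, rfl⟩ := hg'.shared hh'
    obtain ⟨w, hw, h⟩ := hG.star_nbrs₂ hv {{o', o, u}}
      (by simp [hg'.ne_g.symm, hh'.ne_g.symm, hg'.ne_y]) (sep_singleton _)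
      ⟨_, rfl, by simp⟩ ⟨_, rfl, by simp⟩
    refine h 3 3 (by omega) (by omega) ?_
    rintro w₁ f h1 h2 h₁ _ rfl
    exact localFix_shared h₁.isWeighting hg'.nbrs hh'.nbrs hg'.nbrs'
      (by rw [h₁.mem _ (by simp), h1]) (by rw [h₁.mem _ (by simp), h2])
  · have hsep := hg'.separated hh' hv.1 hnadj hoh
    obtain ⟨w, hw, H⟩ := hG.star_nbrs₂ hv {{g, y}, {h, u}}
      (by simp [hg'.ne_g.symm, hh'.ne_g.symm, hg'.ne_y, hh'.ne_y]) (sep_pair hsep)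
      ⟨{g, y}, by simp⟩ ⟨{h, u}, by simp⟩
    have ho'g : o' ≠ g := by
      rintro rfl
      exact hoh (hh'.shared hg').2
    obtain ⟨a, b, ha, hb, h1, h2, h3, h4⟩ := two_betas (w s(g, z)) (w s(h, t)) (w s(y, o))
      (w s(u, o')) (vertexSum G w o) (vertexSum G w o') (vertexSum G w z) (vertexSum G w t)
      (hw _ _ hg'.nbrs.adj₃).1 (hw _ _ hh'.nbrs.adj₃).1
    have hgd := hg'.deg_g
    have hyd := hg'.deg_y
    have hhd := hh'.deg_g
    have hud := hh'.deg_y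
    have hzd := hg'.deg_z
    have htd := hh'.deg_z
    have hod := hg'.deg_o
    have hod' := hh'.deg_o
    refine H a b ha hb ?_
    rintro w₁ f e1 e2 h₁ _ (rfl | rfl)
    · refine hg'.localFix h₁ (by simp) ?_ ?_ ?_ (by rintro rfl; omega) (by rwa [e1]) (by rwa [e1])
      · simp only [Finset.mem_insert, Finset.mem_singleton, not_or]
        exact ⟨by rintro rfl; omega, by rintro rfl; omega⟩
      · simp only [Finset.mem_insert, Finset.mem_singleton, not_or]
        exact ⟨(G.ne_of_adj hg'.nbrs.adj₃).symm, by rintro rfl; exact hnadj hg'.nbrs.adj₃⟩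
      · simp only [Finset.mem_insert, Finset.mem_singleton, not_or]
        exact ⟨hg'.nbrs'.1.symm, hoh⟩
    · refine hh'.localFix h₁ (by simp) ?_ ?_ ?_ (by rintro rfl; omega) (by rwa [e2]) (by rwa [e2])
      · simp only [Finset.mem_insert, Finset.mem_singleton, not_or]
        exact ⟨by rintro rfl; omega, by rintro rfl; omega⟩
      · simp only [Finset.mem_insert, Finset.mem_singleton, not_or]
        exact ⟨by rintro rfl; exact hnadj hh'.nbrs.adj₃.symm, (G.ne_of_adj hh'.nbrs.adj₃).symm⟩
      · simp only [Finset.mem_insert, Finset.mem_singleton, not_or]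
        exact ⟨ho'g, hh'.nbrs'.1.symm⟩

end IsMinimalThreeBad

namespace IsMinimalThreeBad

/-! ### `γ`-vertices with `β`-neighbours -/

/-- A `4`-vertex with a leaf and two `β`-neighbours whose gadgets do not touch; the fourth neighbour `k` is
left untouched. -/
theorem not_leaf_of_separated_betas (hG : IsMinimalThreeBad G) {v x g h k y z o u t o' : V}
    (hn : IsNbrs₄ G v x g h k) (hx : deg G x = 1) (hk : 3 ≤ deg G k) (hg : IsBetaNbr G v g y z o)
    (hh : IsBetaNbr G v h u t o') (hnadj : ¬ G.Adj g h) (hoh : o ≠ h) : False := by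
  classical
  obtain ⟨hxg, hxh, hxk, hgh, hgk, hhk⟩ := hn.1
  have hgd := hg.deg_g
  have hyd := hg.deg_y
  have hzd := hg.deg_z
  have hod := hg.deg_o
  have hhd := hh.deg_g
  have hud := hh.deg_y
  have htd := hh.deg_z
  have hod' := hh.deg_o
  have hv2 : ∀ p, G.Adj v p → deg G p ≠ 2 := by
    intro p hp
    rcases (hn.2 p).mp hp with rfl | rfl | rfl | rfl <;> omega
  have hov : o ≠ v := by rintro rfl; exact hv2 y hg.nbrs'.adj_right.symm hyd
  have hov' : o' ≠ v := by rintro rfl; exact hv2 u hh.nbrs'.adj_right.symm hud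
  have hog : o' ≠ g := by rintro rfl; exact hoh (hh.shared hg).2
  have hvx := G.ne_of_adj hn.adj₁
  obtain ⟨w, R, hw, -, -, H⟩ := hG.star₃ (v := v) (s := x) (t := g) (r := h)
    {{g, y}, {h, u}} hxg hxh hgh hn.adj₁ hn.adj₂ hn.adj₃
    (by simp [hg.ne_g.symm, hh.ne_g.symm, hg.ne_y, hh.ne_y])
    (sep_pair (hg.separated hh hgh hnadj hoh)) (Or.inr hx) (Or.inl ⟨{g, y}, by simp⟩)
    (Or.inl ⟨{h, u}, by simp⟩)
  choose α hα using fun a => beta_exists_bad a (w s(g, z)) (w s(y, o)) (vertexSum G w o)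
    (vertexSum G w z)
  choose β hβ using fun a => beta_exists_bad a (w s(h, t)) (w s(u, o')) (vertexSum G w o')
    (vertexSum G w t)
  obtain ⟨c, a, b, hc, ha, hb, h1, h2, h3, h4, h5⟩ := leaf_two_betas R (w s(y, o)) (w s(u, o'))
    (w s(g, z)) (w s(h, t)) (vertexSum G w k) α β
  obtain ⟨p, hp, hpx, hpg, hph, -, hs⟩ := H c a b hc ha hb (by
    rintro w₁ f e1 e2 e3 h₁ _ (rfl | rfl)
    · refine hg.localFix h₁ (by simp) ?_ ?_ ?_ hov (by rwa [e2]) (by rw [e2]; exact hα a _ h3)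
      · simp only [Finset.mem_insert, Finset.mem_singleton, not_or]
        exact ⟨by rintro rfl; omega, by rintro rfl; omega, by rintro rfl; omega⟩
      · simp only [Finset.mem_insert, Finset.mem_singleton, not_or]
        exact ⟨by rintro rfl; omega, (G.ne_of_adj hg.nbrs.adj₃).symm,
          by rintro rfl; exact hnadj hg.nbrs.adj₃⟩
      · simp only [Finset.mem_insert, Finset.mem_singleton, not_or]
        exact ⟨by rintro rfl; omega, hg.nbrs'.1.symm, hoh⟩
    · refine hh.localFix h₁ (by simp) ?_ ?_ ?_ hov' (by rwa [e3]) (by rw [e3]; exact hβ b _ h4)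
      · simp only [Finset.mem_insert, Finset.mem_singleton, not_or]
        exact ⟨by rintro rfl; omega, by rintro rfl; omega, by rintro rfl; omega⟩
      · simp only [Finset.mem_insert, Finset.mem_singleton, not_or]
        exact ⟨by rintro rfl; omega, by rintro rfl; exact hnadj hh.nbrs.adj₃.symm,
          (G.ne_of_adj hh.nbrs.adj₃).symm⟩
      · simp only [Finset.mem_insert, Finset.mem_singleton, not_or]
        exact ⟨by rintro rfl; omega, hog, hh.nbrs'.1.symm⟩)
  rcases (hn.2 p).mp hp with rfl | rfl | rfl | rfl
  exacts [hpx rfl, hpg rfl, hph rfl, by omega]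

/-- Three `β`-gadgets cannot pairwise overlap: an overlap of two of them uses up the third neighbour of
both, or the other neighbour of the `2`-neighbour of both. Each gadget takes part in two of the three
pairs, which would have to be of different kinds, but there are only two kinds. -/
theorem not_leaf_of_betas (hG : IsMinimalThreeBad G) {v x g₁ g₂ g₃ y₁ y₂ y₃ z₁ z₂ z₃ o₁ o₂ o₃ : V}
    (hn : IsNbrs₄ G v g₁ x g₂ g₃) (hx : deg G x = 1) (h₁ : IsBetaNbr G v g₁ y₁ z₁ o₁)
    (h₂ : IsBetaNbr G v g₂ y₂ z₂ o₂) (h₃ : IsBetaNbr G v g₃ y₃ z₃ o₃) : False := by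
  obtain ⟨h1x, h12, h13, hx2, hx3, h23⟩ := hn.1
  have d₁ := h₁.deg_g
  have d₂ := h₂.deg_g
  have d₃ := h₃.deg_g
  have key : ∀ {g h k y z o u t o'}, IsNbrs₄ G v x g h k → 3 ≤ deg G k → IsBetaNbr G v g y z o →
      IsBetaNbr G v h u t o' → (z = h ∧ t = g) ∨ (o = h ∧ o' = g) := by
    intro g h k y z o u t o' hn hk hg hh
    by_cases hadj : G.Adj g h
    · exact Or.inl ⟨hg.eq_of_adj_g hh.deg_g.ge hh.ne_g hadj,
        hh.eq_of_adj_g hg.deg_g.ge hg.ne_g hadj.symm⟩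
    · by_cases hoh : o = h
      · subst hoh
        exact Or.inr ⟨rfl, (hg.shared hh).2⟩
      · exact (hG.not_leaf_of_separated_betas hn hx hk hg hh hadj hoh).elim
  have k12 := key (k := g₃) ⟨⟨h1x.symm, hx2, hx3, h12, h13, h23⟩,
    fun p => by rw [hn.2 p]; tauto⟩ d₃.ge h₁ h₂
  have k13 := key (k := g₂) ⟨⟨h1x.symm, hx3, hx2, h13, h12, h23.symm⟩,
    fun p => by rw [hn.2 p]; tauto⟩ d₂.ge h₁ h₃
  have k23 := key (k := g₁) ⟨⟨hx2, hx3, h1x.symm, h23, h12.symm, h13.symm⟩,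
    fun p => by rw [hn.2 p]; tauto⟩ d₁.ge h₂ h₃
  rcases k12 with ⟨a1, a2⟩ | ⟨a1, a2⟩ <;> rcases k13 with ⟨b1, b2⟩ | ⟨b1, b2⟩ <;>
    rcases k23 with ⟨c1, c2⟩ | ⟨c1, c2⟩ <;> simp_all

/-- A `3`-vertex with an `α`-neighbour and two `β`-neighbours. -/
theorem not_alpha_of_betas (hG : IsMinimalThreeBad G) {v g x h x' x'' y z o u t o' : V}
    (hn : IsNbrs₃ G v g x h) (hx : IsNbrs₂ G x v x') (hx' : IsNbrs₂ G x' x x'')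
    (hx''g : x'' ≠ g) (hx''h : x'' ≠ h)
    (hg : IsBetaNbr G v g y z o) (hh : IsBetaNbr G v h u t o') : False := by
  classical
  obtain ⟨hgx, hgh, hxh⟩ := hn.1
  have hxd := hx.deg_eq
  have hx'd := hx'.deg_eq
  have hgd := hg.deg_g
  have hyd := hg.deg_y
  have hzd := hg.deg_z
  have hod := hg.deg_o
  have hhd := hh.deg_g
  have hud := hh.deg_y
  have htd := hh.deg_z
  have hod' := hh.deg_o
  have hvx := G.ne_of_adj hn.adj₂
  have hx'v := hx.1.symm
  have hsg := hg.separated_alpha hx hx' hx''g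
  have hsh := hh.separated_alpha hx hx' hx''h
  have hxy : x ≠ y := (hsg x (by simp) y (by simp)).1
  have hxu : x ≠ u := (hsh x (by simp) u (by simp)).1
  have hov : o ≠ v := by
    rintro rfl
    rcases (hn.2 y).mp hg.nbrs'.adj_right.symm with rfl | rfl | rfl
    exacts [by omega, hxy rfl, by omega]
  have hov' : o' ≠ v := by
    rintro rfl
    rcases (hn.2 u).mp hh.nbrs'.adj_right.symm with rfl | rfl | rfl
    exacts [by omega, hxu rfl, by omega]
  have hall : ∀ p, G.Adj v p → p = x ∨ p = g ∨ p = h := fun p hp => by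
    rcases (hn.2 p).mp hp with k | k | k
    exacts [Or.inr (Or.inl k), Or.inl k, Or.inr (Or.inr k)]
  have hfin : ∀ {Q : V → Prop}, (∃ p, G.Adj v p ∧ p ≠ x ∧ p ≠ g ∧ p ≠ h ∧ Q p) → False := by
    rintro Q ⟨p, hp, h1, h2, h3, -⟩
    rcases hall p hp with k | k | k
    exacts [h1 k, h2 k, h3 k]
  have halpha : ∀ w w₁ f A, f x ≠ w s(x', x'') → IsStarChange G w w₁ v {x, g, h} f →
      LocalFix G w₁ {x, x'} v A := by
    intro w w₁ f A hf h₁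
    refine localFix_alpha h₁.isWeighting hx hx' ?_
    rwa [h₁.mem _ (by simp), h₁.left hx'v]
    simp only [Finset.mem_insert, Finset.mem_singleton, not_or]
    exact ⟨(G.ne_of_adj hx.adj_right).symm, by rintro rfl; omega, by rintro rfl; omega⟩
  by_cases hoh : o = h
  · subst hoh
    -- the two `β`-vertices share their `2`-neighbour
    obtain ⟨rfl, rfl⟩ := hg.shared hh
    have hsep : Separated G {x, x'} {o', o, u} := by
      rintro p hp _ (rfl | rfl | rfl)
      exacts [hsg p hp _ (by simp), hsh p hp _ (by simp), hsg p hp _ (by simp)]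
    obtain ⟨w, R, hw, -, -, H⟩ := hG.star₃ (v := v) (s := x) (t := o') (r := o)
      {{x, x'}, {o', o, u}} hgx.symm hxh hgh hn.adj₂ hn.adj₁ hn.adj₃
      (by simp [hg.ne_g.symm, hh.ne_g.symm, hg.ne_y, hvx, hx'v.symm])
      (sep_pair hsep) (Or.inl ⟨{x, x'}, by simp⟩) (Or.inl ⟨{o', o, u}, by simp⟩)
      (Or.inl ⟨{o', o, u}, by simp⟩)
    obtain ⟨c, hc, hc', -⟩ := exists_avoid₂ 0 (w s(x', x'')) 0 0
    refine hfin (H c 3 3 hc (by omega) (by omega) ?_)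
    rintro w₁ f e1 e2 e3 h₁ _ (rfl | rfl)
    · exact halpha w w₁ f _ (by omega) h₁
    · exact localFix_shared h₁.isWeighting hg.nbrs hh.nbrs hg.nbrs'
        (by rw [h₁.mem _ (by simp), e2]) (by rw [h₁.mem _ (by simp), e3])
  have hog : o' ≠ g := by rintro rfl; exact hoh (hh.shared hg).2
  by_cases hadj : G.Adj g h
  · obtain rfl : z = h := hg.eq_of_adj_g hhd.ge hh.ne_g hadj
    obtain rfl : t = g := hh.eq_of_adj_g hgd.ge hg.ne_g hadj.symm
    have hyu : y ≠ u := by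
      rintro rfl
      rcases (hg.nbrs'.2 z).mp hh.nbrs'.adj_left with k | k
      exacts [hgh k.symm, hoh k.symm]
    have hsep : Separated G {x, x'} {t, z, y, u} := by
      rintro p hp _ (rfl | rfl | rfl | rfl)
      exacts [hsg p hp _ (by simp), hsh p hp _ (by simp), hsg p hp _ (by simp),
        hsh p hp _ (by simp)]
    obtain ⟨w, R, hw, -, -, H⟩ := hG.star₃ (v := v) (s := x) (t := t) (r := z)
      {{x, x'}, {t, z, y, u}} hgx.symm hxh hgh hn.adj₂ hn.adj₁ hn.adj₃
      (by simp [hg.ne_g.symm, hh.ne_g.symm, hg.ne_y, hh.ne_y, hvx, hx'v.symm])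
      (sep_pair hsep) (Or.inl ⟨{x, x'}, by simp⟩) (Or.inl ⟨{t, z, y, u}, by simp⟩)
      (Or.inl ⟨{t, z, y, u}, by simp⟩)
    obtain ⟨c, hc, hc', -⟩ := exists_avoid₂ 0 (w s(x', x'')) 0 0
    obtain ⟨a, b, ha, hb, h1, h2, h3⟩ := adjacent_betas (w s(t, z)) (w s(y, o)) (w s(u, o'))
      (vertexSum G w o) (vertexSum G w o') (hw _ _ hadj).1 (hw _ _ hh.nbrs'.adj_right).2
    refine hfin (H c a b hc ha hb ?_)
    rintro w₁ f e1 e2 e3 h₁ _ (rfl | rfl)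
    · exact halpha w w₁ f _ (by omega) h₁
    · have e4 : w₁ s(t, v) = a := by rw [h₁.mem _ (by simp), e2]
      have e5 : w₁ s(z, v) = b := by rw [h₁.mem _ (by simp), e3]
      have e6 : w₁ s(t, z) = w s(t, z) := h₁.of_ne _ _ hg.ne_g hh.ne_g
      have e7 : w₁ s(y, o) = w s(y, o) := h₁.of_ne _ _ hg.ne_y.symm hov
      have e8 : w₁ s(u, o') = w s(u, o') := h₁.of_ne _ _ hh.ne_y.symm hov'
      have e9 : vertexSum G w₁ o = vertexSum G w o := h₁.sum _ hov (by
        simp only [Finset.mem_insert, Finset.mem_singleton, not_or]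
        exact ⟨by rintro rfl; omega, hg.nbrs'.1.symm, hoh⟩)
      have e10 : vertexSum G w₁ o' = vertexSum G w o' := h₁.sum _ hov' (by
        simp only [Finset.mem_insert, Finset.mem_singleton, not_or]
        exact ⟨by rintro rfl; omega, hog, hh.nbrs'.1.symm⟩)
      refine localFix_adjacent h₁.isWeighting hg.nbrs hh.nbrs hg.nbrs' hh.nbrs' hyu ?_ hov hov' ?_
        ?_ ?_
      · intro k
        rcases (hg.nbrs'.2 u).mp k with rfl | rfl <;> omega
      · rwa [e4, e6, e7]
      · rwa [e5, e6, e8]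
      · rw [e4, e5, e6, e7, e8, e9, e10]
        exact h3 _
  · obtain ⟨w, R, hw, -, hR, H⟩ := hG.star₃ (v := v) (s := x) (t := g) (r := h)
      {{x, x'}, {g, y}, {h, u}} hgx.symm hxh hgh hn.adj₂ hn.adj₁ hn.adj₃
      (by simp [hg.ne_g.symm, hh.ne_g.symm, hg.ne_y, hh.ne_y, hvx, hx'v.symm])
      (sep_triple hsg hsh (hg.separated hh hgh hadj hoh)) (Or.inl ⟨{x, x'}, by simp⟩)
      (Or.inl ⟨{g, y}, by simp⟩) (Or.inl ⟨{h, u}, by simp⟩)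
    obtain rfl := hR hall
    choose α hα using fun a => beta_exists_bad a (w s(g, z)) (w s(y, o)) (vertexSum G w o)
      (vertexSum G w z)
    choose β hβ using fun a => beta_exists_bad a (w s(h, t)) (w s(u, o')) (vertexSum G w o')
      (vertexSum G w t)
    obtain ⟨c, a, b, hc, ha, hb, h0, h1, h2, h3, h4⟩ := alpha_two_betas (w s(x', x''))
      (w s(y, o)) (w s(u, o')) (w s(g, z)) (w s(h, t)) α β
    refine hfin (H c a b hc ha hb ?_)
    rintro w₁ f e1 e2 e3 h₁ _ (rfl | rfl | rfl)
    · exact halpha w w₁ f _ (by omega) h₁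
    · refine hg.localFix h₁ (by simp) ?_ ?_ ?_ hov (by rwa [e2]) (by rw [e2]; exact hα a _ h3)
      · simp only [Finset.mem_insert, Finset.mem_singleton, not_or]
        exact ⟨hxy.symm, by rintro rfl; omega, by rintro rfl; omega⟩
      · simp only [Finset.mem_insert, Finset.mem_singleton, not_or]
        exact ⟨by rintro rfl; omega, (G.ne_of_adj hg.nbrs.adj₃).symm,
          by rintro rfl; exact hadj hg.nbrs.adj₃⟩
      · simp only [Finset.mem_insert, Finset.mem_singleton, not_or]
        exact ⟨by rintro rfl; omega, hg.nbrs'.1.symm, hoh⟩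
    · refine hh.localFix h₁ (by simp) ?_ ?_ ?_ hov' (by rwa [e3]) (by rw [e3]; exact hβ b _ h4)
      · simp only [Finset.mem_insert, Finset.mem_singleton, not_or]
        exact ⟨hxu.symm, by rintro rfl; omega, by rintro rfl; omega⟩
      · simp only [Finset.mem_insert, Finset.mem_singleton, not_or]
        exact ⟨by rintro rfl; omega, by rintro rfl; exact hadj hh.nbrs.adj₃.symm,
          (G.ne_of_adj hh.nbrs.adj₃).symm⟩
      · simp only [Finset.mem_insert, Finset.mem_singleton, not_or]
        exact ⟨by rintro rfl; omega, hog, hh.nbrs'.1.symm⟩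

/-- The case that the `2`-neighbour `y` of the `β`-vertex `g` is also a neighbour of `v`. -/
theorem not_two_of_shared_beta (hG : IsMinimalThreeBad G) {v g y y₂ z o₂ : V}
    (hn : IsNbrs₃ G v g y y₂) (hy₂ : IsNbrs₂ G y₂ v o₂) (ho₂ : 3 ≤ deg G o₂)
    (hg : IsBetaNbr G v g y z v) : False := by
  classical
  obtain ⟨hgy, hgy₂, hyy₂⟩ := hn.1
  have hgd := hg.deg_g
  have hyd := hg.deg_y
  have hzd := hg.deg_z
  have hy₂d := hy₂.deg_eq
  have hvy₂ := G.ne_of_adj hn.adj₃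
  have ho₂g : o₂ ≠ g := by
    rintro rfl
    exact hyy₂ (hg.eq_of_adj hy₂.adj_right.symm hvy₂.symm hy₂d).symm
  obtain ⟨w, R, hw, -, hR, H⟩ := hG.star₃ (v := v) (s := g) (t := y) (r := y₂)
    {{g, y}, {y₂}} hgy hgy₂ hyy₂ hn.adj₁ hn.adj₂ hn.adj₃
    (by simp [hg.ne_g.symm, hg.ne_y, hvy₂])
    (sep_pair (hg.separated_two hy₂d hvy₂.symm hyy₂.symm)) (Or.inl ⟨{g, y}, by simp⟩)
    (Or.inl ⟨{g, y}, by simp⟩) (Or.inl ⟨{y₂}, by simp⟩)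
  obtain rfl := hR fun p hp => (hn.2 p).mp hp
  obtain ⟨c₂, hc₂, h1, -⟩ := exists_avoid₂ (w s(y₂, o₂)) (vertexSum G w o₂) 0 0
  obtain ⟨b, hb, h2, -⟩ := exists_avoid₂ (3 + w s(g, z)) (vertexSum G w z) 0 0
  obtain ⟨c₁, hc₁, h3, -⟩ := exists_avoid₂ c₂ (b + w s(g, z)) 0 0
  have hp := hw _ _ hg.nbrs.adj₃
  have hq := hw _ _ hy₂.adj_right
  obtain ⟨p, hp, h1, h2, h3, -⟩ := H 3 c₁ c₂ (by omega) hc₁ hc₂ (by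
    rintro w₁ f e1 e2 e3 h₁ _ (rfl | rfl)
    · have e4 : w₁ s(g, v) = 3 := by rw [h₁.mem _ (by simp), e1]
      have e5 : w₁ s(y, v) = c₁ := by rw [h₁.mem _ (by simp), e2]
      have e6 : w₁ s(g, z) = w s(g, z) := h₁.of_ne _ _ hg.ne_g hg.nbrs.1.2.1.symm
      have e7 : vertexSum G w₁ z = vertexSum G w z := h₁.sum z hg.nbrs.1.2.1.symm (by
        simp only [Finset.mem_insert, Finset.mem_singleton, not_or]
        exact ⟨(G.ne_of_adj hg.nbrs.adj₃).symm, by rintro rfl; omega, by rintro rfl; omega⟩)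
      refine localFix_beta h₁.isWeighting hg.nbrs hg.nbrs' ?_ ⟨b, hb, ?_, ?_, ?_⟩
      · omega
      · rw [e5, target_self]; omega
      · rw [e4, e6, e7]; omega
      · rw [e4, e6]; omega
    · refine localFix_two h₁.isWeighting hy₂ ?_ ?_
      · rw [h₁.mem _ (by simp), h₁.of_ne _ _ hvy₂.symm hy₂.1.symm, e3]; omega
      · rw [h₁.mem _ (by simp), h₁.of_ne _ _ hvy₂.symm hy₂.1.symm, e3, h₁.sum _ hy₂.1.symm]
        · exact h1
        · simp only [Finset.mem_insert, Finset.mem_singleton, not_or]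
          exact ⟨ho₂g, by rintro rfl; omega, by rintro rfl; omega⟩)
  rcases (hn.2 p).mp hp with k | k | k
  exacts [h1 k, h2 k, h3 k]

/-- A `3`-vertex with a `β`-neighbour and two `2`-neighbours. Weight `3` towards the `β`-vertex always
satisfies the condition at its `2`-neighbour. -/
theorem not_two_of_beta (hG : IsMinimalThreeBad G) {v g y₁ y₂ o₁ o₂ y z o : V}
    (hn : IsNbrs₃ G v g y₁ y₂) (hy₁ : IsNbrs₂ G y₁ v o₁) (hy₂ : IsNbrs₂ G y₂ v o₂)
    (hnadj : ¬ G.Adj y₁ y₂) (ho₁ : 3 ≤ deg G o₁) (ho₂ : 3 ≤ deg G o₂)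
    (hg : IsBetaNbr G v g y z o) : False := by
  classical
  obtain ⟨hgy₁, hgy₂, hy₁y₂⟩ := hn.1
  by_cases hy1 : y = y₁
  · subst hy1
    obtain rfl : v = o := by
      rcases (hg.nbrs'.2 v).mp hy₁.adj_left with k | k
      exacts [absurd k hg.ne_g.symm, k]
    exact hG.not_two_of_shared_beta hn hy₂ ho₂ hg
  by_cases hy2 : y = y₂
  · subst hy2
    obtain rfl : v = o := by
      rcases (hg.nbrs'.2 v).mp hy₂.adj_left with k | k
      exacts [absurd k hg.ne_g.symm, k]
    exact hG.not_two_of_shared_beta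
      ⟨⟨hgy₂, hgy₁, hy₁y₂.symm⟩, fun p => by rw [hn.2 p, or_comm (a := p = y₁)]⟩ hy₁ ho₁ hg
  have hgd := hg.deg_g
  have hyd := hg.deg_y
  have hzd := hg.deg_z
  have hod := hg.deg_o
  have hy₁d := hy₁.deg_eq
  have hy₂d := hy₂.deg_eq
  have hvy₁ := G.ne_of_adj hn.adj₂
  have hvy₂ := G.ne_of_adj hn.adj₃
  have ho₁g : o₁ ≠ g := by
    rintro rfl
    exact hy1 (hg.eq_of_adj hy₁.adj_right.symm hvy₁.symm hy₁d).symm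
  have ho₂g : o₂ ≠ g := by
    rintro rfl
    exact hy2 (hg.eq_of_adj hy₂.adj_right.symm hvy₂.symm hy₂d).symm
  have hov : o ≠ v := by
    rintro rfl
    rcases (hn.2 y).mp hg.nbrs'.adj_right.symm with k | k | k
    exacts [G.ne_of_adj hg.nbrs.adj₂ k.symm, hy1 k, hy2 k]
  obtain ⟨w, R, hw, -, hR, H⟩ := hG.star₃ (v := v) (s := g) (t := y₁) (r := y₂)
    {{g, y}, {y₁}, {y₂}} hgy₁ hgy₂ hy₁y₂ hn.adj₁ hn.adj₂ hn.adj₃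
    (by simp [hg.ne_g.symm, hg.ne_y, hvy₁, hvy₂])
    (sep_triple (hg.separated_two hy₁d hvy₁.symm (Ne.symm hy1))
      (hg.separated_two hy₂d hvy₂.symm (Ne.symm hy2)) (by
        rintro _ rfl _ rfl
        exact ⟨hy₁y₂, hnadj⟩))
    (Or.inl ⟨{g, y}, by simp⟩) (Or.inl ⟨{y₁}, by simp⟩) (Or.inl ⟨{y₂}, by simp⟩)
  obtain rfl := hR fun p hp => (hn.2 p).mp hp
  have hp := hw _ _ hg.nbrs.adj₃
  have hm := hw _ _ hg.nbrs'.adj_right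
  have hq₁ := hw _ _ hy₁.adj_right
  have hq₂ := hw _ _ hy₂.adj_right
  obtain ⟨b, hb, h1, h2⟩ := exists_avoid₂ (w s(y, o)) (vertexSum G w o) (3 + w s(g, z))
    (vertexSum G w z)
  obtain ⟨c₂, hc₂, h3, -⟩ := exists_avoid₂ (w s(y₂, o₂)) (vertexSum G w o₂) 0 0
  obtain ⟨c₁, hc₁, h4, h5⟩ := exists_avoid₂ (w s(y₁, o₁)) (vertexSum G w o₁) c₂ (b + w s(g, z))
  obtain ⟨p, hp, k1, k2, k3, -⟩ := H 3 c₁ c₂ (by omega) hc₁ hc₂ (by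
    rintro w₁ f e1 e2 e3 h₁ _ (rfl | rfl | rfl)
    · refine hg.localFix h₁ (by simp) ?_ ?_ ?_ hov (by rw [e1]; omega)
        ⟨b, hb, h1, by rw [e1]; omega, by rw [e1]; omega⟩
      · simp only [Finset.mem_insert, Finset.mem_singleton, not_or]
        exact ⟨by rintro rfl; omega, hy1, hy2⟩
      · simp only [Finset.mem_insert, Finset.mem_singleton, not_or]
        exact ⟨(G.ne_of_adj hg.nbrs.adj₃).symm, by rintro rfl; omega, by rintro rfl; omega⟩
      · simp only [Finset.mem_insert, Finset.mem_singleton, not_or]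
        exact ⟨hg.nbrs'.1.symm, by rintro rfl; omega, by rintro rfl; omega⟩
    · refine localFix_two h₁.isWeighting hy₁ ?_ ?_
      · rw [h₁.mem _ (by simp), h₁.of_ne _ _ hvy₁.symm hy₁.1.symm, e2]; omega
      · rw [h₁.mem _ (by simp), h₁.of_ne _ _ hvy₁.symm hy₁.1.symm, e2, h₁.sum _ hy₁.1.symm]
        · exact h4
        · simp only [Finset.mem_insert, Finset.mem_singleton, not_or]
          exact ⟨ho₁g, by rintro rfl; omega, by rintro rfl; omega⟩
    · refine localFix_two h₁.isWeighting hy₂ ?_ ?_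
      · rw [h₁.mem _ (by simp), h₁.of_ne _ _ hvy₂.symm hy₂.1.symm, e3]; omega
      · rw [h₁.mem _ (by simp), h₁.of_ne _ _ hvy₂.symm hy₂.1.symm, e3, h₁.sum _ hy₂.1.symm]
        · exact h3
        · simp only [Finset.mem_insert, Finset.mem_singleton, not_or]
          exact ⟨ho₂g, by rintro rfl; omega, by rintro rfl; omega⟩)
  rcases (hn.2 p).mp hp with k | k | k
  exacts [k1 k, k2 k, k3 k]

theorem exists_adj_three_le_deg (hG : IsMinimalThreeBad G) {v : V} (hv : IsGamma G v) :
    ∃ g, G.Adj v g ∧ 3 ≤ deg G g := by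
  rcases hv with ⟨hv, x, hvx, hx⟩ | ⟨hv, -⟩
  · have hv' := hv
    rw [deg_eq_card] at hv'
    obtain ⟨g, hg, hgx⟩ := Finset.exists_mem_ne (by omega : 1 < (nbrs G v).card) x
    rw [mem_nbrs] at hg
    refine ⟨g, hg, ?_⟩
    by_contra hlt
    exact hG.not_configD ⟨v, hv, x, g, hgx.symm, hvx, hx, hg, by omega⟩
  · by_contra! h
    refine hG.not_configB ⟨v, by omega, fun x hx => ?_⟩
    by_contra h2
    have := hG.three_le_deg (Or.inr hv) hx h2
    have := h x hx
    omega

theorem not_configK (hG : IsMinimalThreeBad G) : ¬ ConfigK G := by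
  rintro ⟨v, hv, hβ⟩
  have hvd := three_le_deg_of_isGamma hv
  obtain ⟨g, hvg, hg⟩ := hG.exists_adj_three_le_deg hv
  have hbeta : ∀ p, G.Adj v p → 3 ≤ deg G p → ∃ y z o, IsBetaNbr G v p y z o := fun p hp hpd =>
    hG.exists_isBetaNbr hvd hp.symm (hβ p hp hpd) fun h => hG.not_configF ⟨v, p, hp, hv, h⟩
  obtain ⟨y, z, o, hgB⟩ := hbeta g hvg hg
  rcases hG.gamma_cases hv hvg hg with ⟨x, z₁, z₂, hn, -, hxd, hz₁, hz₂⟩ |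
    ⟨x, h, x', x'', hn, hx, hx', hx''v, hh, hx''⟩ |
    ⟨y₁, y₂, o₁, o₂, hn, hy₁, hy₂, hnadj, ho₁, ho₂⟩
  · obtain ⟨_, _, _, h₂⟩ := hbeta z₁ hn.adj₃ hz₁
    obtain ⟨_, _, _, h₃⟩ := hbeta z₂ hn.adj₄ hz₂
    exact hG.not_leaf_of_betas hn hxd hgB h₂ h₃
  · obtain ⟨_, _, _, hhB⟩ := hbeta h hn.adj₃ hh
    have hne : ∀ p, G.Adj v p → deg G p = 3 → x'' ≠ p := by
      rintro p hp hpd rfl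
      exact hG.not_configF ⟨v, x'', hp, hv, Or.inr ⟨hpd, Or.inl ⟨x', hx'.adj_right.symm,
        hx'.deg_eq, x, hx'.adj_left, hx.deg_eq⟩⟩⟩
    exact hG.not_alpha_of_betas hn hx hx' (hne _ hvg hgB.deg_g) (hne _ hn.adj₃ hhB.deg_g) hgB hhB
  · exact hG.not_two_of_beta hn hy₁ hy₂ hnadj ho₁ ho₂ hgB

end IsMinimalThreeBad

/-! ### Choosing the weights of a star -/

/-- Moving one weight after another from `lo` to `hi` changes the sum in steps of at most `2`, and the
free weight `r ∈ {1, 2, 3}` fills the gaps. -/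
theorem exists_sum_eq_of_lo_hi {ι : Type*} [DecidableEq ι] (S : Finset ι) (lo hi : ι → ℕ)
    (h : ∀ s ∈ S, lo s ≤ hi s ∧ hi s ≤ lo s + 2) (N : ℕ) (h₁ : ∑ s ∈ S, lo s + 1 ≤ N)
    (h₂ : N ≤ ∑ s ∈ S, hi s + 3) :
    ∃ (f : ι → ℕ) (r : ℕ), (∀ s ∈ S, f s = lo s ∨ f s = hi s) ∧ (1 ≤ r ∧ r ≤ 3) ∧
      ∑ s ∈ S, f s + r = N := by
  induction S using Finset.induction_on generalizing N with
  | empty => exact ⟨lo, N, by simp, by simpa using ⟨h₁, h₂⟩, by simp⟩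
  | insert a S ha ih =>
    rw [Finset.sum_insert ha] at h₁ h₂
    have hle : ∑ s ∈ S, lo s ≤ ∑ s ∈ S, hi s :=
      Finset.sum_le_sum fun s hs => (h s (Finset.mem_insert_of_mem hs)).1
    have hla := h a (Finset.mem_insert_self a S)
    have hS : ∀ s ∈ S, lo s ≤ hi s ∧ hi s ≤ lo s + 2 := fun s hs => h s (Finset.mem_insert_of_mem hs)
    obtain ⟨k, hk, hk₁, hk₂, hk₃⟩ : ∃ k, (k = lo a ∨ k = hi a) ∧ k ≤ N ∧
        ∑ s ∈ S, lo s + 1 ≤ N - k ∧ N - k ≤ ∑ s ∈ S, hi s + 3 := by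
      by_cases hN : N ≤ ∑ s ∈ S, hi s + lo a + 3
      · exact ⟨lo a, Or.inl rfl, by omega, by omega, by omega⟩
      · exact ⟨hi a, Or.inr rfl, by omega, by omega, by omega⟩
    obtain ⟨f, r, hf, hr, hsum⟩ := ih hS (N - k) hk₂ hk₃
    refine ⟨Function.update f a k, r, fun s hs => ?_, hr, ?_⟩
    · by_cases hsa : s = a
      · subst hsa; simpa using hk
      · rw [Function.update_of_ne hsa]
        exact hf s ((Finset.mem_insert.mp hs).resolve_left hsa)
    · rw [Finset.sum_insert ha, Function.update_self, Finset.sum_congr rfl fun s hs =>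
        Function.update_of_ne (ne_of_mem_of_not_mem hs ha) _ _]
      omega

/-- The smallest and the largest weight `a` with `(a, A) ∉ F`. -/
theorem exists_lo_hi (F : Finset (ℕ × ℕ)) (A : ℕ) (h : (F.filter fun x => x.2 = A).card < 3) :
    ∃ lo hi, 1 ≤ lo ∧ lo ≤ hi ∧ hi ≤ 3 ∧ (lo, A) ∉ F ∧ (hi, A) ∉ F ∧
      lo ≤ 1 + (F.filter fun x => x.2 = A).card ∧ 3 ≤ hi + (F.filter fun x => x.2 = A).card := by
  have hcard : ∑ i ∈ ({1, 2, 3} : Finset ℕ), (if (i, A) ∈ F then 1 else 0) ≤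
      (F.filter fun x => x.2 = A).card := by
    rw [← Finset.card_filter]
    refine Finset.card_le_card_of_injOn (fun i => (i, A)) ?_ ?_
    · intro i hi
      simpa using (Finset.mem_filter.mp hi).2
    · intro i _ j _ hij
      exact (Prod.ext_iff.mp hij).1
  rw [Finset.sum_insert (by simp), Finset.sum_insert (by simp), Finset.sum_singleton] at hcard
  by_cases h1 : (1, A) ∈ F <;> by_cases h2 : (2, A) ∈ F <;> by_cases h3 : (3, A) ∈ F <;>
    simp only [h1, h2, h3, if_true, if_false] at hcard
  · omega
  · exact ⟨3, 3, by omega, by omega, by omega, h3, h3, by omega, by omega⟩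
  · exact ⟨2, 2, by omega, by omega, by omega, h2, h2, by omega, by omega⟩
  · exact ⟨2, 3, by omega, by omega, by omega, h2, h3, by omega, by omega⟩
  · exact ⟨1, 1, by omega, by omega, by omega, h1, h1, by omega, by omega⟩
  · exact ⟨1, 3, by omega, by omega, by omega, h1, h3, by omega, by omega⟩
  · exact ⟨1, 2, by omega, by omega, by omega, h1, h2, by omega, by omega⟩
  · exact ⟨1, 3, by omega, by omega, by omega, h1, h3, by omega, by omega⟩

/-- The weights of a star with a given sum `N` can be chosen outside of the sets `B s`, provided that
few pairs in these sets have second entry `A`. -/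
theorem exists_weights_of_sum {ι : Type*} [DecidableEq ι] (S : Finset ι) (B : ι → Finset (ℕ × ℕ))
    (A N k : ℕ) (hk : ∑ s ∈ S, ((B s).filter fun x => x.2 = A).card = k) (hk3 : k < 3)
    (hkn : k < S.card) (h₁ : S.card + k ≤ N) (h₂ : N + k ≤ 3 * S.card) :
    ∃ f : ι → ℕ, (∀ s ∈ S, 1 ≤ f s ∧ f s ≤ 3) ∧ ∑ s ∈ S, f s = N ∧ ∀ s ∈ S, (f s, A) ∉ B s := by
  obtain ⟨s₀, hs₀, hB₀⟩ : ∃ s ∈ S, ((B s).filter fun x => x.2 = A).card = 0 := by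
    by_contra! h
    have : ∑ s ∈ S, 1 ≤ ∑ s ∈ S, ((B s).filter fun x => x.2 = A).card :=
      Finset.sum_le_sum fun s hs => Nat.one_le_iff_ne_zero.mpr (h s hs)
    rw [← Finset.card_eq_sum_ones] at this
    omega
  have hle : ∀ s ∈ S, ((B s).filter fun x => x.2 = A).card < 3 := fun s hs =>
    lt_of_le_of_lt (hk ▸ Finset.single_le_sum
      (f := fun s => ((B s).filter fun x => x.2 = A).card) (fun _ _ => Nat.zero_le _) hs) hk3
  choose! lo hi hlo hlohi hhi hloB hhiB hlo' hhi' using fun s (hs : s ∈ S) =>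
    exists_lo_hi (B s) A (hle s hs)
  have hsum := Finset.add_sum_erase S (fun s => ((B s).filter fun x => x.2 = A).card) hs₀
  have hcard := Finset.card_erase_add_one hs₀
  have hS : ∀ s ∈ S.erase s₀, s ∈ S := fun s hs => Finset.mem_of_mem_erase hs
  have e₁ : ∑ s ∈ S.erase s₀, lo s ≤
      (S.erase s₀).card + ∑ s ∈ S.erase s₀, ((B s).filter fun x => x.2 = A).card := by
    rw [Finset.card_eq_sum_ones, ← Finset.sum_add_distrib]
    exact Finset.sum_le_sum fun s hs => hlo' s (hS s hs)
  have e₂ : 3 * (S.erase s₀).card ≤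
      ∑ s ∈ S.erase s₀, hi s + ∑ s ∈ S.erase s₀, ((B s).filter fun x => x.2 = A).card := by
    rw [Finset.card_eq_sum_ones, ← Finset.sum_add_distrib, Finset.mul_sum]
    exact Finset.sum_le_sum fun s hs => hhi' s (hS s hs)
  obtain ⟨f, r, hf, hr, hfr⟩ := exists_sum_eq_of_lo_hi (S.erase s₀) lo hi
    (fun s hs => by
      have := hlo s (hS s hs)
      have := hlohi s (hS s hs)
      have := hhi s (hS s hs)
      omega) N (by omega) (by omega)
  refine ⟨Function.update f s₀ r, fun s hs => ?_, ?_, fun s hs => ?_⟩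
  · by_cases hss : s = s₀
    · subst hss; simpa using hr
    · rw [Function.update_of_ne hss]
      have := hlo s hs
      have := hlohi s hs
      have := hhi s hs
      rcases hf s (Finset.mem_erase.mpr ⟨hss, hs⟩) with k | k <;> omega
  · rw [← Finset.add_sum_erase S _ hs₀, Function.update_self, Finset.sum_congr rfl fun s hs =>
      Function.update_of_ne (Finset.ne_of_mem_erase hs) _ _]
    omega
  · by_cases hss : s = s₀
    · subst hss
      intro hmem
      rw [Finset.card_eq_zero] at hB₀
      have : (Function.update f s r s, A) ∈ (B s).filter fun x => x.2 = A :=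
        Finset.mem_filter.mpr ⟨hmem, rfl⟩
      rw [hB₀] at this
      simp at this
    · rw [Function.update_of_ne hss]
      rcases hf s (Finset.mem_erase.mpr ⟨hss, hs⟩) with k | k <;> rw [k]
      exacts [hloB s hs, hhiB s hs]

/-- How many pairs with a given second entry are needed to block the sum `n + j` of a star with `n`
edges. -/
def threshold (n j : ℕ) : ℕ := min (min 3 n) (min (j + 1) (2 * n + 1 - j))

theorem sum_threshold (n : ℕ) (hn : 3 ≤ n) :
    ∑ j ∈ Finset.range (2 * n + 1), threshold n j + 6 = 3 * (2 * n + 1) := by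
  obtain ⟨k, rfl⟩ := Nat.exists_eq_add_of_le' hn
  rw [show 2 * (k + 3) + 1 = 2 * k + 3 + 1 + 1 + 1 + 1 by ring, Finset.sum_range_succ,
    Finset.sum_range_succ, Finset.sum_range_succ', Finset.sum_range_succ',
    Finset.sum_congr rfl (g := fun _ => 3) fun j hj => ?_, Finset.sum_const, Finset.card_range,
    smul_eq_mul]
  · simp only [threshold]
    omega
  · rw [Finset.mem_range] at hj
    simp only [threshold]
    omega

/-- The weights `f` of a star with edge set `S` and the sum at its centre can be chosen such that the sum
is not in `M` and no pair of a weight and the sum is blocked. The sums `n + j` with `j ≤ 2 * n` are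
blocked only by `threshold n j` pairs each, and there are too few pairs for that. -/
theorem exists_weights {ι : Type*} [DecidableEq ι] (S : Finset ι) (B : ι → Finset (ℕ × ℕ))
    (M : Finset ℕ) (R : ℕ)
    (h : (3 ≤ S.card ∧ ∑ s ∈ S, (B s).card + 6 + 3 * M.card < 3 * (2 * S.card + 1)) ∨
      (S.card = 2 ∧ ∑ s ∈ S, (B s).card + 2 * M.card < 8)) :
    ∃ f : ι → ℕ, (∀ s ∈ S, 1 ≤ f s ∧ f s ≤ 3) ∧ ∑ s ∈ S, f s + R ∉ M ∧
      ∀ s ∈ S, (f s, ∑ s ∈ S, f s + R) ∉ B s := by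
  by_contra! hcon
  set n := S.card with hn
  let A : ℕ → ℕ := fun j => n + j + R
  let K : ℕ → ℕ := fun j => ∑ s ∈ S, ((B s).filter fun x => x.2 = A j).card
  have hblock : ∀ j ∈ Finset.range (2 * n + 1),
      threshold n j ≤ K j + if A j ∈ M then min 3 n else 0 := by
    intro j hj
    rw [Finset.mem_range] at hj
    split_ifs with hM
    · simp only [threshold]; omega
    · by_contra hlt
      simp only [threshold, not_le] at hlt
      obtain ⟨f, hf, hsum, hfB⟩ := exists_weights_of_sum S B (A j) (n + j) (K j) rfl (by omega)
        (by omega) (by omega) (by omega)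
      obtain ⟨s, hs, hs'⟩ := hcon f hf (by rw [hsum]; exact hM)
      rw [hsum] at hs'
      exact hfB s hs hs'
  have hA : Function.Injective A := fun i j hij => by simp only [A] at hij; omega
  have hK : ∑ j ∈ Finset.range (2 * n + 1), K j ≤ ∑ s ∈ S, (B s).card := by
    simp only [K]
    rw [Finset.sum_comm]
    refine Finset.sum_le_sum fun s _ => ?_
    rw [← Finset.card_biUnion]
    · exact Finset.card_le_card (Finset.biUnion_subset.mpr fun j _ => Finset.filter_subset _ _)
    · intro i _ j _ hij
      refine Finset.disjoint_left.mpr fun x hx hx' => hij (hA ?_)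
      rw [← (Finset.mem_filter.mp hx).2, ← (Finset.mem_filter.mp hx').2]
  have hM : ∑ j ∈ Finset.range (2 * n + 1), (if A j ∈ M then min 3 n else 0) ≤
      min 3 n * M.card := by
    rw [← Finset.sum_filter, Finset.sum_const, smul_eq_mul, mul_comm]
    refine Nat.mul_le_mul_left _ (Finset.card_le_card_of_injOn A ?_ hA.injOn)
    intro j hj
    exact (Finset.mem_filter.mp hj).2
  have htotal := Finset.sum_le_sum hblock
  rw [Finset.sum_add_distrib] at htotal
  rcases h with ⟨hn3, h⟩ | ⟨hn2, h⟩
  · have := sum_threshold n hn3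
    rw [min_eq_left hn3] at hM htotal
    omega
  · rw [hn2] at hM htotal hK
    simp [Finset.sum_range_succ, threshold] at hM htotal hK
    omega

/-! ### Arithmetic of pairs of `γ`-vertices -/

/-- The weights of the edges from two `γ`-vertices with overlapping gadgets into the path that joins them.
They cannot be chosen only if both are forced to the same value. -/
theorem pair_exists (P Q k₁ k₂ A : ℕ) (hne : ¬ (2 * P + k₂ = 2 * Q + k₁ ∧ A ≠ k₁ ∧
    (P < A ∧ A ≤ P + 3 ∧ P < k₁ ∧ k₁ ≤ P + 3) ∧ Q < A ∧ A ≤ Q + 3 ∧ Q < k₂ ∧ k₂ ≤ Q + 3 ∧ A ≠ k₂)) :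
    ∃ b₁ b₂, (1 ≤ b₁ ∧ b₁ ≤ 3) ∧ (1 ≤ b₂ ∧ b₂ ≤ 3) ∧ b₁ ≠ b₂ ∧
      P + b₁ ≠ k₁ ∧ P + b₁ ≠ A ∧ Q + b₂ ≠ k₂ ∧ Q + b₂ ≠ A := by
  by_cases h₁ : ∃ b b', (1 ≤ b ∧ b < b' ∧ b' ≤ 3) ∧ P + b ≠ k₁ ∧ P + b' ≠ k₁ ∧ P + b ≠ A ∧
      P + b' ≠ A
  · obtain ⟨b, b', hb, h1, h2, h3, h4⟩ := h₁
    obtain ⟨e, he, h5, h6⟩ := exists_avoid₂ Q k₂ Q A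
    by_cases h : b = e
    · exact ⟨b', e, by omega, he, by omega, h2, h4, by omega, by omega⟩
    · exact ⟨b, e, by omega, he, h, h1, h3, by omega, by omega⟩
  by_cases h₂ : ∃ b b', (1 ≤ b ∧ b < b' ∧ b' ≤ 3) ∧ Q + b ≠ k₂ ∧ Q + b' ≠ k₂ ∧ Q + b ≠ A ∧
      Q + b' ≠ A
  · obtain ⟨b, b', hb, h1, h2, h3, h4⟩ := h₂
    obtain ⟨e, he, h5, h6⟩ := exists_avoid₂ P k₁ P A
    by_cases h : e = b
    · exact ⟨e, b', he, by omega, by omega, by omega, by omega, h2, h4⟩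
    · exact ⟨e, b, he, by omega, h, by omega, by omega, h1, h3⟩
  obtain ⟨b, hb, h1, h2⟩ := exists_avoid₂ P k₁ P A
  obtain ⟨e, he, h3, h4⟩ := exists_avoid₂ Q k₂ Q A
  refine ⟨b, e, hb, he, fun heq => hne ?_, by omega, by omega, by omega, by omega⟩
  push Not at h₁ h₂
  have e1 := h₁ 1 2
  have e2 := h₁ 1 3
  have e3 := h₁ 2 3
  have f1 := h₂ 1 2
  have f2 := h₂ 1 3
  have f3 := h₂ 2 3
  clear h₁ h₂
  have s1 : b + k₁ + A = 6 + 2 * P ∧ A ≠ k₁ ∧ P < A ∧ A ≤ P + 3 ∧ P < k₁ ∧ k₁ ≤ P + 3 := by omega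
  have s2 : e + k₂ + A = 6 + 2 * Q ∧ A ≠ k₂ ∧ Q < A ∧ A ≤ Q + 3 ∧ Q < k₂ ∧ k₂ ≤ Q + 3 := by omega
  omega

/-- For two `γ`-vertices whose gadgets overlap, only the weights `(1, 1)` and `(3, 3)` can be blocked
for good, each by at most two values of `A`; any other sum of the two weights can be realized. -/
theorem pair_blocked (p q k₁ k₂ : ℕ) : ∃ B₁ B₂ : Finset (ℕ × ℕ), B₁.card ≤ 2 ∧ B₂.card ≤ 2 ∧
    ∀ a b A, (1 ≤ a ∧ a ≤ 3) → (1 ≤ b ∧ b ≤ 3) → (a, A) ∉ B₁ → (b, A) ∉ B₂ →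
      ∃ a' b', (1 ≤ a' ∧ a' ≤ 3) ∧ (1 ≤ b' ∧ b' ≤ 3) ∧ a' + b' = a + b ∧
      ∃ b₁ b₂, (1 ≤ b₁ ∧ b₁ ≤ 3) ∧ (1 ≤ b₂ ∧ b₂ ≤ 3) ∧ b₁ ≠ b₂ ∧
        a' + b₁ + p ≠ k₁ ∧ a' + b₁ + p ≠ A ∧ b' + b₂ + q ≠ k₂ ∧ b' + b₂ + q ≠ A := by
  have hcard : ∀ (c r k : ℕ), ((((Finset.Icc (r + 1) (r + 3)).erase k).image
      fun A => (c, A)).filter fun _ => k ∈ Finset.Icc (r + 1) (r + 3)).card ≤ 2 := by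
    intro c r k
    by_cases hk : k ∈ Finset.Icc (r + 1) (r + 3)
    · refine (Finset.card_filter_le _ _).trans (Finset.card_image_le.trans ?_)
      rw [Finset.card_erase_of_mem hk, Nat.card_Icc]
      omega
    · simp [hk]
  refine ⟨_, _, hcard 1 (1 + p) k₁, hcard 3 (3 + q) k₂, fun a b A ha hb h₁ h₂ => ?_⟩
  simp only [Finset.mem_filter, Finset.mem_image, Finset.mem_erase, Finset.mem_Icc, Prod.mk.injEq,
    not_and] at h₁ h₂
  have key : ∀ a' b', (1 ≤ a' ∧ a' ≤ 3) → (1 ≤ b' ∧ b' ≤ 3) → a' + b' = a + b →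
      ¬ (2 * (a' + p) + k₂ = 2 * (b' + q) + k₁ ∧ A ≠ k₁ ∧
        (a' + p < A ∧ A ≤ a' + p + 3 ∧ a' + p < k₁ ∧ k₁ ≤ a' + p + 3) ∧
        b' + q < A ∧ A ≤ b' + q + 3 ∧ b' + q < k₂ ∧ k₂ ≤ b' + q + 3 ∧ A ≠ k₂) →
      ∃ a' b', (1 ≤ a' ∧ a' ≤ 3) ∧ (1 ≤ b' ∧ b' ≤ 3) ∧ a' + b' = a + b ∧
      ∃ b₁ b₂, (1 ≤ b₁ ∧ b₁ ≤ 3) ∧ (1 ≤ b₂ ∧ b₂ ≤ 3) ∧ b₁ ≠ b₂ ∧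
        a' + b₁ + p ≠ k₁ ∧ a' + b₁ + p ≠ A ∧ b' + b₂ + q ≠ k₂ ∧ b' + b₂ + q ≠ A := by
    intro a' b' ha' hb' hab hne
    obtain ⟨b₁, b₂, h1, h2, h3, h4, h5, h6, h7⟩ := pair_exists _ _ _ _ _ hne
    exact ⟨a', b', ha', hb', hab, b₁, b₂, h1, h2, h3, by omega, by omega, by omega, by omega⟩
  by_cases h11 : a = 1 ∧ b = 1
  · refine key a b ha hb rfl fun h => h₁ ⟨A, ⟨by omega, by omega⟩, h11.1.symm, rfl⟩ (by omega)
      (by omega)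
  by_cases h33 : a = 3 ∧ b = 3
  · refine key a b ha hb rfl fun h => h₂ ⟨A, ⟨by omega, by omega⟩, h33.2.symm, rfl⟩ (by omega)
      (by omega)
  by_cases h : 2 * (a + p) + k₂ = 2 * (b + q) + k₁
  · -- another pair of weights with the same sum has a different difference
    obtain ⟨a', b', ha', hb', hab, hne⟩ : ∃ a' b', (1 ≤ a' ∧ a' ≤ 3) ∧ (1 ≤ b' ∧ b' ≤ 3) ∧
        a' + b' = a + b ∧ a' ≠ a := by
      by_cases h' : a + 1 ≤ 3 ∧ 2 ≤ b
      · exact ⟨a + 1, b - 1, by omega, by omega, by omega, by omega⟩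
      · exact ⟨a - 1, b + 1, by omega, by omega, by omega, by omega⟩
    exact key a' b' ha' hb' hab (by omega)
  · exact key a b ha hb rfl fun k => h k.1

/-- The analogue of `pair_blocked` for one `γ`-vertex. -/
theorem single_blocked (P : ℕ → ℕ → Prop)
    (h : ∀ a A A', (1 ≤ a ∧ a ≤ 3) → A ≠ A' → P a A ∨ P a A')
    (h' : ∃ a, (1 ≤ a ∧ a ≤ 3) ∧ ∀ A, P a A) :
    ∃ B : Finset (ℕ × ℕ), B.card ≤ 2 ∧
      ∀ a A, (1 ≤ a ∧ a ≤ 3) → (a, A) ∉ B → P a A := by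
  obtain ⟨a₀, ha₀, hP⟩ := h'
  have : ∀ a, ∃ A₀, (1 ≤ a ∧ a ≤ 3) → ∀ A, A ≠ A₀ → P a A := by
    intro a
    by_cases ha : ∃ A₀, (1 ≤ a ∧ a ≤ 3) ∧ ¬ P a A₀
    · obtain ⟨A₀, ha, hA₀⟩ := ha
      exact ⟨A₀, fun _ A hA => (h a A A₀ ha hA).resolve_right hA₀⟩
    · push Not at ha
      exact ⟨0, fun h1 A _ => ha A h1⟩
  choose bad hbad using this
  refine ⟨((Finset.Icc 1 3).erase a₀).image fun a => (a, bad a), ?_, fun a A ha hB => ?_⟩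
  · refine Finset.card_image_le.trans ?_
    rw [Finset.card_erase_of_mem (Finset.mem_Icc.mpr ha₀), Nat.card_Icc]
  · by_cases haa : a = a₀
    · rw [haa]; exact hP A
    · refine hbad a ha A fun hA => hB ?_
      rw [Finset.mem_image]
      exact ⟨a, Finset.mem_erase.mpr ⟨haa, Finset.mem_Icc.mpr ha⟩, by rw [hA]⟩

/-! ### Overlapping gadgets of `γ`-vertices -/

/-- `g` and `h` are joined by a path `g`, `x`, `x'`, `h` with two `2`-vertices inside. -/
def Paired (G : SimpleGraph V) (g h : V) : Prop :=
  ∃ x x', IsNbrs₂ G x g x' ∧ IsNbrs₂ G x' x h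

theorem Paired.symm {g h : V} : Paired G g h → Paired G h g :=
  fun ⟨x, x', hx, hx'⟩ => ⟨x', x, hx'.symm, hx.symm⟩

namespace IsMinimalThreeBad

theorem alpha_unique (hG : IsMinimalThreeBad G) {g x y : V} (hg : IsGamma G g) (hgx : G.Adj g x)
    (hx : IsAlpha G x) (hgy : G.Adj g y) (hy : deg G y = 2) : x = y := by
  by_contra hxy
  exact hG.not_configC ⟨g, hG.deg_eq_three_of_isGamma hg hgx hx.1, x, y, hxy, hgx, hx, hgy, hy⟩

theorem paired_unique (hG : IsMinimalThreeBad G) {g h h' : V} (hg : IsGamma G g)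
    (h₁ : Paired G g h) (h₂ : Paired G g h') : h = h' := by
  obtain ⟨x, x', hx, hx'⟩ := h₁
  obtain ⟨y, y', hy, hy'⟩ := h₂
  obtain rfl : x = y := hG.alpha_unique hg hx.adj_left.symm
    ⟨hx.deg_eq, x', hx.adj_right, hx'.deg_eq⟩ hy.adj_left.symm hy.deg_eq
  obtain rfl : x' = y' := by
    rcases (hy.2 x').mp hx.adj_right with k | k
    exacts [absurd k.symm hx.1, k]
  rcases (hy'.2 h).mp hx'.adj_right with k | k
  exacts [absurd k.symm hx'.1, k]

theorem Paired.ne (hG : IsMinimalThreeBad G) {g h : V} (hg : IsGamma G g) (hp : Paired G g h) :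
    g ≠ h := by
  rintro rfl
  obtain ⟨x, x', hx, hx'⟩ := hp
  exact G.ne_of_adj hx.adj_right (hG.alpha_unique hg hx.adj_left.symm
    ⟨hx.deg_eq, x', hx.adj_right, hx'.deg_eq⟩ hx'.adj_right.symm hx'.deg_eq)

/-- Any overlap or adjacency of the gadgets of two `γ`-vertices would come from a short path through
vertices of degree two. A path with one inner vertex, or with three or more, is impossible. -/
theorem separated_gammaSet (hG : IsMinimalThreeBad G) {g h : V} (hg : IsGamma G g)
    (hh : IsGamma G h) (hne : g ≠ h) (hnp : ¬ Paired G g h) :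
    Separated G (gammaSet G g) (gammaSet G h) := by
  have hgd := three_le_deg_of_isGamma hg
  have hhd := three_le_deg_of_isGamma hh
  have hgh : ¬ G.Adj g h := fun k => hG.not_configF ⟨g, h, k, hg, hh⟩
  -- a vertex of degree at most two with two neighbours
  have hlight : ∀ {y a b}, G.Adj y a → G.Adj y b → a ≠ b → deg G y ≤ 2 → IsNbrs₂ G y a b := by
    intro y a b ha hb hab hy
    have hy2 : deg G y = 2 := by
      have h0 := hG.deg_ne_zero y
      have h1 : deg G y ≠ 1 := fun h1 => hab ((exists_adj_of_deg_eq_one h1 ha b).mp hb).symm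
      omega
    obtain ⟨c, hc⟩ := exists_nbrs₂ hy2 ha
    rcases (hc.2 b).mp hb with k | k
    · exact absurd k.symm hab
    · rwa [k]
  have hone : ∀ y, G.Adj y g → G.Adj y h → deg G y ≤ 2 → False := fun y h1 h2 hy =>
    hG.not_two_gamma (hlight h1 h2 hne hy) hg hh
  have htwo : ∀ y u, G.Adj y g → G.Adj y u → G.Adj u h → deg G y ≤ 2 → deg G u ≤ 2 → False := by
    intro y u h1 h2 h3 hy hu
    refine hnp ⟨y, u, hlight h1 h2 (by rintro rfl; omega) hy,
      hlight h2.symm h3 (by rintro rfl; omega) hu⟩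
  -- the second inner vertex of a path leaves to a vertex of large degree
  have hend : ∀ {k y x q}, 3 ≤ deg G k → G.Adj k y → deg G y = 2 → G.Adj y x → deg G x = 2 →
      G.Adj x q → deg G q ≤ 2 → q = y := by
    intro k y x q hk hky hy hyx hx hxq hq
    obtain ⟨x', x'', h1, h2, h3⟩ := hG.exists_alpha_path hk hky ⟨hy, x, hyx, hx⟩
    obtain rfl : x = x' := by
      rcases (h1.2 x).mp hyx with e | e
      · subst e; omega
      · exact e
    rcases (h2.2 q).mp hxq with e | e
    · exact e
    · subst e; omega
  rintro p (rfl | ⟨hgp, hp⟩ | ⟨hp, y, hgy, hy, hyp⟩) q (rfl | ⟨hhq, hq⟩ | ⟨hq, u, hhu, hu, huq⟩)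
  · exact ⟨hne, hgh⟩
  · exact ⟨by rintro rfl; omega, fun k => hone q k.symm hhq.symm hq⟩
  · exact ⟨by rintro rfl; omega, fun k => htwo q u k.symm huq.symm hhu.symm hq.le hu.le⟩
  · exact ⟨by rintro rfl; omega, fun k => hone p hgp.symm k hp⟩
  · refine ⟨?_, fun k => htwo p q hgp.symm k hhq.symm hp hq⟩
    rintro rfl
    exact hone p hgp.symm hhq.symm hp
  · refine ⟨?_, fun k => ?_⟩
    · rintro rfl
      exact htwo p u hgp.symm huq.symm hhu.symm hp hu.le
    · obtain rfl := hend hhd hhu hu huq hq k.symm hp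
      exact hone p hgp.symm hhu.symm hp
  · exact ⟨by rintro rfl; omega, fun k => htwo y p hgy.symm hyp k hy.le hp.le⟩
  · refine ⟨?_, fun k => ?_⟩
    · rintro rfl
      exact htwo y p hgy.symm hyp hhq.symm hy.le hp.le
    · obtain rfl := hend hgd hgy hy hyp hp k hq
      exact hone q hgy.symm hhq.symm hq
  · refine ⟨?_, fun k => ?_⟩
    · rintro rfl
      obtain rfl := hend hgd hgy hy hyp hp huq.symm hu.le
      exact hone u hgy.symm hhu.symm hu.le
    · obtain rfl := hend hgd hgy hy hyp hp k hq.le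
      obtain rfl := hend hhd hhu hu huq hq k.symm hp.le
      exact htwo q p hgy.symm k.symm hhu.symm hq.le hp.le

/-- The repair of the common gadget of a pair of `γ`-neighbours of `v`. -/
theorem pair_repair (hG : IsMinimalThreeBad G) {g h v : V} (hg : IsGamma G g) (hh : IsGamma G h)
    (hgv : G.Adj g v) (hhv : G.Adj h v) (hv : 3 ≤ deg G v) (hp : Paired G g h)
    (w : Sym2 V → ℕ) :
    ∃ B₁ B₂ : Finset (ℕ × ℕ), B₁.card ≤ 2 ∧ B₂.card ≤ 2 ∧
      ∀ a b A, (1 ≤ a ∧ a ≤ 3) → (1 ≤ b ∧ b ≤ 3) → (a, A) ∉ B₁ → (b, A) ∉ B₂ →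
        ∃ a' b', (1 ≤ a' ∧ a' ≤ 3) ∧ (1 ≤ b' ∧ b' ≤ 3) ∧ a' + b' = a + b ∧
          ∀ S f w₁, IsStarChange G w w₁ v S f → g ∈ S → h ∈ S →
            (∀ s ∈ S, IsGamma G s ∨ deg G s = 1) → f g = a' → f h = b' →
            LocalFix G w₁ (gammaSet G g ∪ gammaSet G h) v A := by
  have hne := Paired.ne hG hg hp
  obtain ⟨x, x', hx, hx'⟩ := hp
  have hxd := hx.deg_eq
  have hx'd := hx'.deg_eq
  have hgd := hG.deg_eq_three_of_isGamma hg hx.adj_left.symm hxd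
  have hhd := hG.deg_eq_three_of_isGamma hh hx'.adj_right.symm hx'd
  obtain ⟨z, hgn⟩ := exists_nbrs₃ hgd hgv hx.adj_left.symm (by rintro rfl; omega)
  obtain ⟨t, hhn⟩ := exists_nbrs₃ hhd hhv hx'.adj_right.symm (by rintro rfl; omega)
  have hz : 3 ≤ deg G z := hG.three_le_deg (Or.inr hgd) hgn.adj₃ fun k => hgn.1.2.2
    (hG.alpha_unique hg hgn.adj₂ ⟨hxd, x', hx.adj_right, hx'd⟩ hgn.adj₃ k)
  have ht : 3 ≤ deg G t := hG.three_le_deg (Or.inr hhd) hhn.adj₃ fun k => hhn.1.2.2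
    (hG.alpha_unique hh hhn.adj₂ ⟨hx'd, x, hx'.adj_left, hxd⟩ hhn.adj₃ k)
  obtain ⟨B₁, B₂, hB₁, hB₂, hB⟩ := pair_blocked (w s(g, z)) (w s(h, t)) (vertexSum G w z)
    (vertexSum G w t)
  refine ⟨B₁, B₂, hB₁, hB₂, fun a b A ha hb h₁ h₂ => ?_⟩
  obtain ⟨a', b', ha', hb', hab, hfix⟩ := hB a b A ha hb h₁ h₂
  refine ⟨a', b', ha', hb', hab, fun S f w₁ hc hgS hhS hS hfg hfh => ?_⟩
  have hset : gammaSet G g ∪ gammaSet G h = {g, x, x', h} := by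
    rw [gammaSet_eq_alpha hgn hx hx' hv hz, gammaSet_eq_alpha hhn hx'.symm hx.symm hv ht]
    ext p
    simp only [Set.mem_union, Set.mem_insert_iff, Set.mem_singleton_iff]
    tauto
  have hout : ∀ k p, IsGamma G k → G.Adj k p → 3 ≤ deg G p → p ∉ S := by
    intro k p hk hkp hp hpS
    rcases hS p hpS with h | h
    · exact hG.not_configF ⟨k, p, hkp, hk, h⟩
    · omega
  have hgvn := G.ne_of_adj hgv
  have hhvn := G.ne_of_adj hhv
  have hzv := hgn.1.2.1.symm
  have htv := hhn.1.2.1.symm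
  rw [hset]
  refine localFix_pair hc.isWeighting hgn hx hx' hhn hne
    (fun k => hG.not_configF ⟨g, h, k, hg, hh⟩) ?_
  rwa [hc.mem g hgS, hc.mem h hhS, hc.of_ne g z hgvn hzv, hc.of_ne h t hhvn htv,
    hc.sum z hzv (hout g z hg hgn.adj₃ hz), hc.sum t htv (hout h t hh hhn.adj₃ ht), hfg, hfh]

/-! ### Stars of leaves and `γ`-vertices -/

/-- A vertex `v` cannot have too many `γ`-neighbours and leaves compared to its degree: if all edges
from `v` to the `γ`-vertices in `Q` and the leaves in `X` are re-weighted, then each `γ`-vertex blocks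
at most two combinations of a weight and a sum at `v`, and each of the `m` other neighbours blocks one
sum. -/
theorem star_gamma (hG : IsMinimalThreeBad G) {v : V} {Q X : Finset V} {m : ℕ}
    (hv : 3 ≤ deg G v) (hQ : ∀ g ∈ Q, G.Adj v g ∧ IsGamma G g)
    (hX : ∀ x ∈ X, G.Adj v x ∧ deg G x = 1) (hm : Q.card + X.card + m = deg G v)
    (h : (3 ≤ Q.card + X.card ∧ 2 * Q.card + 6 + 3 * m < 3 * (2 * (Q.card + X.card) + 1)) ∨
      (Q.card + X.card = 2 ∧ 2 * Q.card + 2 * m < 8)) : False := by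
  classical
  have hQd : ∀ g ∈ Q, 3 ≤ deg G g := fun g hg => three_le_deg_of_isGamma (hQ g hg).2
  have hdisj : Disjoint Q X := Finset.disjoint_left.mpr fun g hg hgX => by
    have := hQd g hg
    have := (hX g hgX).2
    omega
  have hSv : ∀ s ∈ Q ∪ X, G.Adj v s := fun s hs =>
    (Finset.mem_union.mp hs).elim (fun k => (hQ s k).1) (fun k => (hX s k).1)
  have hSγ : ∀ s ∈ Q ∪ X, IsGamma G s ∨ deg G s = 1 := fun s hs =>
    (Finset.mem_union.mp hs).imp (fun k => (hQ s k).2) (fun k => (hX s k).2)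
  have hcard : (Q ∪ X).card = Q.card + X.card := Finset.card_union_of_disjoint hdisj
  -- the involution that exchanges the two members of each pair
  let π : V → V := fun g => if h : ∃ k ∈ Q, Paired G g k then h.choose else g
  have hπ : ∀ g ∈ Q, (π g ∈ Q ∧ Paired G g (π g)) ∨ (π g = g ∧ ∀ k ∈ Q, ¬ Paired G g k) := by
    intro g hg
    by_cases h : ∃ k ∈ Q, Paired G g k
    · simp only [π, dif_pos h]
      exact Or.inl h.choose_spec
    · right
      simp only [π, dif_neg h]
      push Not at h
      exact ⟨trivial, h⟩
  have hπQ : ∀ g ∈ Q, π g ∈ Q := fun g hg => by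
    rcases hπ g hg with h | h
    exacts [h.1, h.1.symm ▸ hg]
  have hππ : ∀ g ∈ Q, π (π g) = g := by
    intro g hg
    rcases hπ g hg with ⟨h1, h2⟩ | ⟨h1, -⟩
    · rcases hπ _ h1 with ⟨-, h4⟩ | ⟨-, h4⟩
      · exact hG.paired_unique (hQ _ h1).2 h4 h2.symm
      · exact absurd h2.symm (h4 g hg)
    · rw [h1, h1]
  have hπP : ∀ g ∈ Q, ∀ k ∈ Q, Paired G g k → k = π g := by
    intro g hg k hk hgk
    rcases hπ g hg with ⟨-, h⟩ | ⟨-, h⟩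
    exacts [hG.paired_unique (hQ g hg).2 hgk h, absurd hgk (h k hk)]
  let T : V → Set V := fun g => gammaSet G g ∪ gammaSet G (π g)
  have hTπ : ∀ g ∈ Q, T (π g) = T g := fun g hg => by simp only [T, hππ g hg, Set.union_comm]
  have hsepγ : ∀ g ∈ Q, ∀ k ∈ Q, k ≠ g → k ≠ π g → Separated G (gammaSet G g) (gammaSet G k) :=
    fun g hg k hk h1 h2 => hG.separated_gammaSet (hQ g hg).2 (hQ k hk).2 h1.symm
      fun hp => h2 (hπP g hg k hk hp)
  have hsepT : ∀ g ∈ Q, ∀ k ∈ Q, k ≠ g → k ≠ π g → Separated G (T g) (T k) := by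
    intro g hg k hk h1 h2
    have h3 : π k ≠ g := fun e => h2 (by rw [← e, hππ k hk])
    have h4 : π k ≠ π g := fun e => h1 (by rw [← hππ k hk, e, hππ g hg])
    rintro p (hp | hp) q (hq | hq)
    · exact hsepγ g hg k hk h1 h2 p hp q hq
    · exact hsepγ g hg _ (hπQ k hk) h3 h4 p hp q hq
    · exact hsepγ _ (hπQ g hg) k hk h2 (by rwa [hππ g hg]) p hp q hq
    · exact hsepγ _ (hπQ g hg) _ (hπQ k hk) h4 (by rwa [hππ g hg]) p hp q hq
  have hvγ : ∀ g ∈ Q, v ∉ gammaSet G g := fun g hg =>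
    notMem_gammaSet (G.ne_of_adj (hQ g hg).1) hv
  let 𝒯 : Set (Set V) := {U | ∃ g ∈ Q, U = T g}
  have hmem : ∀ g ∈ Q, ∃ U ∈ 𝒯, g ∈ U := fun g hg =>
    ⟨T g, ⟨g, hg, rfl⟩, Or.inl (self_mem_gammaSet g)⟩
  obtain ⟨w, R, hw, -, H⟩ := hG.star' (v := v) (S := Q ∪ X) 𝒯
    (Finset.card_pos.mp (by omega)) hSv (by omega)
    (by
      rintro _ ⟨g, hg, rfl⟩ (k | k)
      exacts [hvγ g hg k, hvγ _ (hπQ g hg) k])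
    (by
      rintro _ ⟨g, hg, rfl⟩ _ ⟨k, hk, rfl⟩ hne
      refine hsepT g hg k hk (by rintro rfl; exact hne rfl) ?_
      rintro rfl
      exact hne (hTπ g hg).symm)
    (fun s hs => (Finset.mem_union.mp hs).imp (hmem s) fun k => (hX s k).2)
  let Fix : V → ℕ → ℕ → ℕ → Prop := fun g a b A => ∀ f w₁, IsStarChange G w w₁ v (Q ∪ X) f →
    f g = a → f (π g) = b → LocalFix G w₁ (T g) v A
  -- each `γ`-vertex blocks at most two pairs of a weight and a sum
  let r : V → ℕ := fun g => (Fintype.equivFin V g : ℕ)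
  have hr : ∀ {g k}, r g = r k → g = k := fun h => (Fintype.equivFin V).injective (Fin.ext h)
  have hblock : ∀ g ∈ Q, ∃ B₁ B₂ : Finset (ℕ × ℕ), B₁.card ≤ 2 ∧ B₂.card ≤ 2 ∧ (π g = g → B₁ = B₂) ∧
      ∀ a b A, (1 ≤ a ∧ a ≤ 3) → (1 ≤ b ∧ b ≤ 3) → (π g = g → a = b) → (a, A) ∉ B₁ → (b, A) ∉ B₂ →
        ∃ a' b', (1 ≤ a' ∧ a' ≤ 3) ∧ (1 ≤ b' ∧ b' ≤ 3) ∧ a' + b' = a + b ∧ (π g = g → a' = b') ∧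
          Fix g a' b' A := by
    intro g hg
    obtain ⟨hvg, hγ⟩ := hQ g hg
    rcases hπ g hg with ⟨h1, h2⟩ | ⟨h1, h2⟩
    · obtain ⟨B₁, B₂, hB₁, hB₂, hB⟩ := hG.pair_repair hγ (hQ _ h1).2 hvg.symm (hQ _ h1).1.symm hv h2 w
      refine ⟨B₁, B₂, hB₁, hB₂, fun k => absurd k.symm (Paired.ne hG hγ h2),
        fun a b A ha hb _ h3 h4 => ?_⟩
      obtain ⟨a', b', ha', hb', hab, hfix⟩ := hB a b A ha hb h3 h4
      exact ⟨a', b', ha', hb', hab, fun k => absurd k.symm (Paired.ne hG hγ h2),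
        fun f w₁ hc hfa hfb => hfix _ f w₁ hc
        (Finset.mem_union_left _ hg) (Finset.mem_union_left _ h1) hSγ hfa hfb⟩
    · obtain ⟨P, hP₁, hP₂, -, hP⟩ := hG.gamma_repair hγ hvg.symm hv hw
      obtain ⟨B, hB, hBP⟩ := single_blocked P hP₁ hP₂
      refine ⟨B, B, hB, hB, fun _ => rfl, fun a b A ha hb hab h3 _ =>
        ⟨a, b, ha, hb, rfl, hab, fun f w₁ hc hfa _ => ?_⟩⟩
      have hTg : T g = gammaSet G g := by simp only [T, h1, Set.union_self]
      rw [hTg]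
      refine hP _ f w₁ A hc (Finset.mem_union_left _ hg) (fun s hs hsg => ?_)
        (by rw [hfa]; exact hBP a A ha h3)
      rcases Finset.mem_union.mp hs with hs | hs
      · have hsep := hsepγ g hg s hs hsg (by rwa [h1])
        exact ⟨fun k => (hsep s k s (self_mem_gammaSet s)).1 rfl,
          fun t ht => (hsep t ht s (self_mem_gammaSet s)).2⟩
      · obtain ⟨hvs, hsd⟩ := hX s hs
        have huniq := exists_adj_of_deg_eq_one hsd hvs.symm
        refine ⟨?_, fun t ht k => ?_⟩
        · rintro (k | ⟨k, -⟩ | ⟨k, -⟩)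
          · exact hsg k
          · exact G.ne_of_adj hvg ((huniq g).mp k.symm).symm
          · omega
        · obtain rfl := (huniq t).mp k.symm
          exact hvγ g hg ht
  choose! B₁ B₂ hB₁ hB₂ hB₁₂ hB using hblock
  let B : V → Finset (ℕ × ℕ) := fun g =>
    if g ∈ Q then (if r g ≤ r (π g) then B₁ g else B₂ (π g)) else ∅
  have hBcard : ∑ s ∈ Q ∪ X, (B s).card ≤ 2 * Q.card := by
    rw [Finset.sum_union hdisj, Finset.sum_eq_zero (s := X) fun x hx => ?_, add_zero, mul_comm]
    · refine Finset.sum_le_card_nsmul _ _ _ fun g hg => ?_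
      simp only [B, if_pos hg]
      split_ifs
      exacts [hB₁ g hg, hB₂ _ (hπQ g hg)]
    · simp only [B, if_neg (Finset.disjoint_right.mp hdisj hx), Finset.card_empty]
  have hM : ((nbrs G v \ (Q ∪ X)).image (vertexSum G w)).card ≤ m := by
    refine Finset.card_image_le.trans ?_
    rw [Finset.card_sdiff_of_subset fun s hs => by simpa using hSv s hs, ← deg_eq_card, hcard]
    omega
  obtain ⟨f, hf, hfM, hfB⟩ := exists_weights (Q ∪ X) B
    ((nbrs G v \ (Q ∪ X)).image (vertexSum G w)) R (by rw [hcard]; omega)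
  set A := ∑ s ∈ Q ∪ X, f s + R with hA
  -- adjust the weights of the pairs without changing their sum
  have hfQ : ∀ g ∈ Q, 1 ≤ f g ∧ f g ≤ 3 := fun g hg => hf g (Finset.mem_union_left _ hg)
  have hpair : ∀ g ∈ Q, r g ≤ r (π g) →
      ∃ a' b', (1 ≤ a' ∧ a' ≤ 3) ∧ (1 ≤ b' ∧ b' ≤ 3) ∧ a' + b' = f g + f (π g) ∧
        (π g = g → a' = b') ∧ Fix g a' b' A := by
    intro g hg hle
    have h1 := hfB g (Finset.mem_union_left _ hg)
    have h2 := hfB (π g) (Finset.mem_union_left _ (hπQ g hg))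
    simp only [B, if_pos hg, if_pos hle] at h1
    simp only [B, if_pos (hπQ g hg), hππ g hg] at h2
    refine hB g hg _ _ A (hfQ g hg) (hfQ _ (hπQ g hg)) (fun k => by rw [k]) h1 ?_
    by_cases hfix : π g = g
    · rw [hfix] at h2 ⊢
      rwa [if_pos le_rfl, hB₁₂ g hg hfix] at h2
    · rwa [if_neg fun k => hfix (hr (le_antisymm k hle))] at h2
  choose! α β hα hβ hαβ hαβ' hFix using hpair
  let f' : V → ℕ := fun g => if g ∈ Q then (if r g ≤ r (π g) then α g else β (π g)) else f g
  have hfst : ∀ g ∈ Q, r g ≤ r (π g) → f' g = α g ∧ f' (π g) = β g := by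
    intro g hg hle
    refine ⟨by simp only [f', if_pos hg, if_pos hle], ?_⟩
    simp only [f', if_pos (hπQ g hg), hππ g hg]
    by_cases hfix : π g = g
    · rw [hfix, if_pos le_rfl, hαβ' g hg hle hfix]
    · rw [if_neg fun k => hfix (hr (le_antisymm k hle))]
  have hsnd : ∀ g ∈ Q, ¬ r g ≤ r (π g) → π g ∈ Q ∧ r (π g) ≤ r (π (π g)) := by
    intro g hg hle
    rw [hππ g hg]
    exact ⟨hπQ g hg, by omega⟩
  have hf' : ∀ s ∈ Q ∪ X, 1 ≤ f' s ∧ f' s ≤ 3 := by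
    intro s hs
    by_cases hsQ : s ∈ Q
    · by_cases hle : r s ≤ r (π s)
      · rw [(hfst s hsQ hle).1]
        exact hα s hsQ hle
      · obtain ⟨h1, h2⟩ := hsnd s hsQ hle
        have h3 := (hfst _ h1 h2).2
        rw [hππ s hsQ] at h3
        rw [h3]
        exact hβ _ h1 h2
    · simpa only [f', if_neg hsQ] using hf s hs
  have hsumπ : ∀ e : V → ℕ, ∑ g ∈ Q, e (π g) = ∑ g ∈ Q, e g := fun e =>
    Finset.sum_nbij' π π hπQ hπQ hππ hππ fun _ _ => rfl
  have hsumQ : ∑ g ∈ Q, f' g = ∑ g ∈ Q, f g := by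
    have : ∑ g ∈ Q, (f' g + f' (π g)) = ∑ g ∈ Q, (f g + f (π g)) := by
      refine Finset.sum_congr rfl fun g hg => ?_
      by_cases hle : r g ≤ r (π g)
      · rw [(hfst g hg hle).1, (hfst g hg hle).2, hαβ g hg hle]
      · obtain ⟨h1, h2⟩ := hsnd g hg hle
        have h3 := hfst _ h1 h2
        have h4 := hαβ _ h1 h2
        rw [hππ g hg] at h3 h4
        omega
    rw [Finset.sum_add_distrib, Finset.sum_add_distrib, hsumπ, hsumπ] at this
    omega
  have hsum : ∑ s ∈ Q ∪ X, f' s + R = A := by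
    rw [hA, Finset.sum_union hdisj, Finset.sum_union hdisj, hsumQ,
      Finset.sum_congr (s₁ := X) rfl fun x hx => if_neg (Finset.disjoint_right.mp hdisj hx)]
  have hlocal : ∀ g ∈ Q, r g ≤ r (π g) → ∀ w₁, IsStarChange G w w₁ v (Q ∪ X) f' →
      LocalFix G w₁ (T g) v A := fun g hg hle w₁ hc =>
    hFix g hg hle f' w₁ hc (hfst g hg hle).1 (hfst g hg hle).2
  obtain ⟨u, hvu, huS, -, hu⟩ := H f' hf' (by
    rintro w₁ hc _ ⟨g, hg, rfl⟩
    rw [hsum]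
    by_cases hle : r g ≤ r (π g)
    · exact hlocal g hg hle w₁ hc
    · obtain ⟨h1, h2⟩ := hsnd g hg hle
      rw [← hTπ g hg]
      exact hlocal _ h1 h2 w₁ hc)
  rw [hsum] at hu
  exact hfM (Finset.mem_image.mpr ⟨u, Finset.mem_sdiff.mpr ⟨by simpa using hvu, huS⟩, hu⟩)

theorem exists_finset_of_le_numNbrs {v : V} {n : ℕ} {P : V → Prop} (h : n ≤ numNbrs G v P) :
    ∃ Q : Finset V, Q.card = n ∧ ∀ g ∈ Q, G.Adj v g ∧ P g := by
  classical
  obtain ⟨Q, hQ, hcard⟩ := Finset.exists_subset_card_eq h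
  refine ⟨Q, hcard, fun g hg => ?_⟩
  have := hQ hg
  simpa only [Finset.mem_filter, SimpleGraph.mem_neighborFinset] using this

theorem not_configG (hG : IsMinimalThreeBad G) : ¬ ConfigG G := by
  rintro ⟨v, hv, h⟩
  obtain ⟨Q, hcard, hQ⟩ := exists_finset_of_le_numNbrs h
  exact hG.star_gamma (Q := Q) (X := ∅) (m := 1) hv.ge hQ (by simp) (by simp; omega)
    (by simp; omega)

theorem not_configI (hG : IsMinimalThreeBad G) : ¬ ConfigI G := by
  rintro ⟨v, hv, ⟨x, hvx, hx⟩, h⟩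
  obtain ⟨Q, hcard, hQ⟩ := exists_finset_of_le_numNbrs h
  exact hG.star_gamma (Q := Q) (X := {x}) (m := 1) (by omega) hQ (by simp [hvx, hx])
    (by simp; omega) (by simp; omega)

theorem not_configJ3 (hG : IsMinimalThreeBad G) : ¬ ConfigJ3 G := by
  rintro ⟨v, hv, -, h⟩
  obtain ⟨Q, hcard, hQ⟩ := exists_finset_of_le_numNbrs h
  exact hG.star_gamma (Q := Q) (X := ∅) (m := 1) (by omega) hQ (by simp) (by simp; omega)
    (by simp; omega)

theorem not_configH (hG : IsMinimalThreeBad G) : ¬ ConfigH G := by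
  classical
  rintro ⟨v, hv, h⟩
  obtain ⟨Q, hQc, hQ⟩ := exists_finset_of_le_numNbrs (G := G) (v := v) (P := IsGamma G) le_rfl
  obtain ⟨X, hXc, hX⟩ := exists_finset_of_le_numNbrs (G := G) (v := v) (P := fun x => deg G x = 1) le_rfl
  have hdisj : Disjoint Q X := Finset.disjoint_left.mpr fun g hg hgX => by
    have := three_le_deg_of_isGamma (hQ g hg).2
    have := (hX g hgX).2
    omega
  have hle : Q.card + X.card ≤ deg G v := by
    rw [← Finset.card_union_of_disjoint hdisj, deg_eq_card]
    refine Finset.card_le_card fun u hu => ?_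
    rcases Finset.mem_union.mp hu with k | k
    exacts [by simpa using (hQ u k).1, by simpa using (hX u k).1]
  exact hG.star_gamma (m := deg G v - (Q.card + X.card)) (by omega) hQ hX (by omega) (by omega)

end IsMinimalThreeBad

end ThreeWeighting

theorem lemma4p5 {V : Type*} [Fintype V] (G : SimpleGraph V)
    (hG : ThreeWeighting.IsMinimalThreeBad G) :
    ¬ ThreeWeighting.ConfigA G ∧
    ¬ ThreeWeighting.ConfigB G ∧
    ¬ ThreeWeighting.ConfigC G ∧
    ¬ ThreeWeighting.ConfigD G ∧
    ¬ ThreeWeighting.ConfigE G ∧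
    ¬ ThreeWeighting.ConfigF G ∧
    ¬ ThreeWeighting.ConfigG G ∧
    ¬ ThreeWeighting.ConfigH G ∧
    ¬ ThreeWeighting.ConfigI G ∧
    ¬ ThreeWeighting.ConfigJ1 G ∧
    ¬ ThreeWeighting.ConfigJ2 G ∧
    ¬ ThreeWeighting.ConfigJ3 G ∧
    ¬ ThreeWeighting.ConfigK G :=
  ⟨hG.not_configA, hG.not_configB, hG.not_configC, hG.not_configD, hG.not_configE, hG.not_configF,
    hG.not_configG, hG.not_configH, hG.not_configI, hG.not_configJ1, hG.not_configJ2,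
    hG.not_configJ3, hG.not_configK⟩
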